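/- Let $\mathbf T^2=\mathbf R^2/2\pi\mathbf Z^2$, let $V:\mathbf T^2\to\mathbf R$ be a smooth potential, let $\beta,\gamma>0$, and consider the Langevin dynamics $$ d q_t = p_t\,dt,\qquad d p_t = -\nabla V(q_t)\,dt-\gamma\,p_t\,dt+\sqrt{2\gamma\beta^{-1}}\,dw_t $$ on $\mathbf T^2\times\mathbf R^2$, with $w$ a standard two-dimensional Brownian motion, and its invariant probability measure $\mu(dq\,dp)=Z^{-1}e^{-\beta(V(q)+|p|^2/2)}\,dq\,dp$. Let $D^\gamma\in\mathbf R^{2\times 2}$ be the effective diffusion matrix, in either of the following two senses. (a) For a stationary solution, started from $(q_0,p_0)\sim\mu$ independent of $w$, with positions followed continuously in $\mathbf R^2$, the rescaled process $(\varepsilon q_{t/\varepsilon^2})_{t\ge 0}$ converges as $\varepsilon\to0$, weakly in the space of continuous functions with uniform convergence on compact time intervals, to $\sqrt{2D^\gamma}\,W$ with $W$ a standard two-dimensional Brownian motion. (b) $D^\gamma_{ij}=\int\phi_i\,p_j\,d\mu$, where for $i\in\{1,2\}$ the function $\phi_i\in L^2_0(\mu)=\{u\in L^2(\mu):\int u\,d\mu=0\}$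 is a solution, in the sense of distributions, of the Poisson equation $-\mathcal L\phi_i=p_i$, with $\mathcal L=p\cdot\nabla_q-\nabla V\cdot\nabla_p+\gamma(-p\cdot\nabla_p+\beta^{-1}\Delta_p)$. Then: 1. If $V(q_1,q_2)=V(q_2,q_1)$ for all $q$, then $D^\gamma_{11}=D^\gamma_{22}$. 2. If $V(q_1,q_2)=V(q_1,-q_2)$ for all $q$, or $V(q_1,q_2)=V(-q_1,q_2)$ for all $q$, then $D^\gamma_{12}=D^\gamma_{21}=0$. (The symmetry assumed in 1 is not needed here.) -/

import Mathlib

open MeasureTheory ProbabilityTheory Filter Topology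
open scoped NNReal ENNReal Matrix

universe u v

noncomputable section

namespace Langevin

/-- Two-dimensional position or velocity space `ℝ²`. -/
abbrev E2 := EuclideanSpace ℝ (Fin 2)

/-- Phase space; a point is a pair (position, velocity). Functions on `𝕋² × ℝ²` are represented
by functions on `ℝ² × ℝ²` that are `2π`-periodic in the position coordinates. -/
abbrev Phase := E2 × E2

/-- The lattice vector `2πk`, for `k ∈ ℤ²`. -/
def latticeVec (k : Fin 2 → ℤ) : E2 := WithLp.toLp 2 fun i => 2 * Real.pi * (k i : ℝ)

/-- A smooth potential on the torus `𝕋² = ℝ² / 2πℤ²`. -/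
structure IsPotential (V : E2 → ℝ) : Prop where
  smooth : ContDiff ℝ (⊤ : ℕ∞) V
  periodic : ∀ (k : Fin 2 → ℤ) (q : E2), V (q + latticeVec k) = V q

/-- The fundamental cell `[0, 2π)²` of the torus. -/
def cell : Set E2 := {q | ∀ i, q i ∈ Set.Ico 0 (2 * Real.pi)}

/-- The Hamiltonian `H(q, p) = V(q) + |p|² / 2`. -/
def hamiltonian (V : E2 → ℝ) (x : Phase) : ℝ := V x.1 + ‖x.2‖ ^ 2 / 2

/-- The unnormalised Gibbs measure `exp (-β H) dq dp` on `𝕋² × ℝ²`, the torus being identified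
with its fundamental cell. -/
def gibbsWeight (V : E2 → ℝ) (β : ℝ) : Measure Phase :=
  ((volume : Measure Phase).restrict (cell ×ˢ Set.univ)).withDensity
    fun x => ENNReal.ofReal (Real.exp (-β * hamiltonian V x))

/-- The Boltzmann--Gibbs probability measure `μ = Z⁻¹ exp (-β H) dq dp`. -/
def gibbs (V : E2 → ℝ) (β : ℝ) : Measure Phase :=
  (gibbsWeight V β Set.univ)⁻¹ • gibbsWeight V β

/-! ### The Langevin dynamics and its diffusive limit -/

/-- The Borel σ-algebra of the space of continuous paths, which carries the topology of uniform
convergence on compact time intervals. -/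
instance : MeasurableSpace C(ℝ≥0, E2) := borel _

instance : BorelSpace C(ℝ≥0, E2) := ⟨rfl⟩

/-- `w = (w₀, w₁)` is a standard two-dimensional Brownian motion. -/
structure IsBrownian2 {Ω : Type*} [MeasurableSpace Ω] (P : Measure Ω)
    (w : Fin 2 → ℝ≥0 → Ω → ℝ) : Prop where
  measurable : ∀ i t, Measurable (w i t)
  brownian : ∀ i, IsBrownianReal (w i) P
  indep : iIndepFun (fun i ω t => w i t ω) P

/-- `(q, p)` is a stationary solution, driven by the Brownian motion `w`, of
`dq = p dt`, `dp = -∇V(q) dt - γ p dt + √(2γ/β) dw`. The noise being additive, the equation is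
the pathwise integral equation. Positions are followed continuously in `ℝ²`, starting from the
representative of `q₀ ∈ 𝕋²` in the fundamental cell; the initial condition has law `μ` and is
independent of `w`. -/
structure IsStationarySolution {Ω : Type*} [MeasurableSpace Ω] (P : Measure Ω)
    (V : E2 → ℝ) (β γ : ℝ) (w : Fin 2 → ℝ≥0 → Ω → ℝ) (q p : Ω → C(ℝ≥0, E2)) : Prop where
  brownian : IsBrownian2 P w
  measurable_q : Measurable q
  measurable_p : Measurable p
  initial_law : HasLaw (fun ω => (q ω 0, p ω 0)) (gibbs V β) P
  initial_indep : IndepFun (fun ω => (q ω 0, p ω 0)) (fun ω i t => w i t ω) P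
  position : ∀ᵐ ω ∂P, ∀ t : ℝ≥0, q ω t = q ω 0 + ∫ s in (0 : ℝ)..t, p ω s.toNNReal
  velocity : ∀ᵐ ω ∂P, ∀ t : ℝ≥0,
    p ω t = p ω 0 - (∫ s in (0 : ℝ)..t, gradient V (q ω s.toNNReal))
      - γ • (∫ s in (0 : ℝ)..t, p ω s.toNNReal)
      + √(2 * γ / β) • WithLp.toLp 2 fun i => w i t ω

/-- The diffusively rescaled path `t ↦ ε q_{t / ε²}`. -/
def rescale (ε : ℝ≥0) (q : C(ℝ≥0, E2)) : C(ℝ≥0, E2) where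
  toFun t := (ε : ℝ) • q (t / ε ^ 2)
  continuous_toFun := by fun_prop

/-- `D` is the effective diffusion matrix of the Langevin dynamics: as `ε → 0⁺`, the rescaled
position process `(ε q_{t/ε²})_{t ≥ 0}` of a stationary solution converges, weakly in the space of
continuous paths, to `√(2D) W`, where `W` is a standard Brownian motion and `√(2D)` is the
positive semidefinite square root `S` of `2D`. -/
def IsEffectiveDiffusion (V : E2 → ℝ) (β γ : ℝ) (D : Matrix (Fin 2) (Fin 2) ℝ) : Prop :=
  ∃ (Ω : Type u) (_ : MeasurableSpace Ω) (P : Measure Ω) (_ : IsProbabilityMeasure P)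
    (w : Fin 2 → ℝ≥0 → Ω → ℝ) (q p : Ω → C(ℝ≥0, E2))
    (Ω' : Type v) (_ : MeasurableSpace Ω') (P' : Measure Ω') (_ : IsProbabilityMeasure P')
    (W : Fin 2 → ℝ≥0 → Ω' → ℝ) (Z : Ω' → C(ℝ≥0, E2)) (S : Matrix (Fin 2) (Fin 2) ℝ),
    IsStationarySolution P V β γ w q p ∧
    IsBrownian2 P' W ∧
    S.PosSemidef ∧ S * S = (2 : ℝ) • D ∧
    (∀ᵐ ω ∂P', ∀ t : ℝ≥0, Z ω t = WithLp.toLp 2 (S *ᵥ fun j => W j t ω)) ∧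
    TendstoInDistribution (fun (ε : ℝ≥0) ω => rescale ε (q ω)) (𝓝[>] 0) Z (fun _ => P) P'

/-! ### The Poisson equation -/

/-- Smooth test functions on `𝕋² × ℝ²` with compact support. -/
structure IsTestFunction (ψ : Phase → ℝ) : Prop where
  smooth : ContDiff ℝ (⊤ : ℕ∞) ψ
  periodic : ∀ (k : Fin 2 → ℤ) (q p : E2), ψ (q + latticeVec k, p) = ψ (q, p)
  support : ∃ R : ℝ, ∀ q p : E2, R < ‖p‖ → ψ (q, p) = 0

/-- `L_Ham f = p · ∇_q f - ∇V · ∇_p f`. -/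
def genHam (V : E2 → ℝ) (f : Phase → ℝ) (x : Phase) : ℝ :=
  fderiv ℝ f x (x.2, -gradient V x.1)

/-- `L_FD f = -p · ∇_p f + β⁻¹ Δ_p f`. -/
def genFD (β : ℝ) (f : Phase → ℝ) (x : Phase) : ℝ :=
  -(fderiv ℝ f x (0, x.2)) + β⁻¹ * Laplacian.laplacian (fun p => f (x.1, p)) x.2

/-- The formal adjoint in `L²(μ)` of the generator `L = L_Ham + γ L_FD`: in `L²(μ)` the first
part is antisymmetric and the second one is symmetric. -/
def genAdjoint (V : E2 → ℝ) (β γ : ℝ) (f : Phase → ℝ) (x : Phase) : ℝ :=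
  -genHam V f x + γ * genFD β f x

/-- `φ` is a solution, in the sense of distributions, of the Poisson equation `-L φ = pᵢ`,
`φ ∈ L²₀(μ)`. -/
structure IsPoissonSolution (V : E2 → ℝ) (β γ : ℝ) (i : Fin 2) (φ : Phase → ℝ) : Prop where
  periodic : ∀ (k : Fin 2 → ℤ) (q p : E2), φ (q + latticeVec k, p) = φ (q, p)
  memLp : MemLp φ 2 (gibbs V β)
  mean_zero : ∫ x, φ x ∂(gibbs V β) = 0
  equation : ∀ ψ : Phase → ℝ, IsTestFunction ψ →
    -∫ x, φ x * genAdjoint V β γ ψ x ∂(gibbs V β) = ∫ x, x.2 i * ψ x ∂(gibbs V β)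

/-- `D` is the matrix with entries `D_{ij} = ⟨φᵢ, pⱼ⟩_{L²(μ)}`, where `φᵢ` solves the Poisson
equation `-L φᵢ = pᵢ`. -/
def IsPoissonDiffusion (V : E2 → ℝ) (β γ : ℝ) (D : Matrix (Fin 2) (Fin 2) ℝ) : Prop :=
  ∃ φ : Fin 2 → Phase → ℝ, (∀ i, IsPoissonSolution V β γ i (φ i)) ∧
    ∀ i j, D i j = ∫ x, φ i x * x.2 j ∂(gibbs V β)

end Langevin

end

/-! Everything follows from one equivariance statement. Let `q ↦ R q + c` be an involution of the
torus that preserves `V`, with `R` a signed permutation of the coordinates. Acting by `R` on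
velocities as well, it preserves the Gibbs measure and commutes with the dynamics, and the claim is
that `D` commutes with `R`. For the exchange of coordinates this gives `D 0 0 = D 1 1`. For the
reflection of one coordinate, `D 0 1` and `D 1 0` equal their own negatives.

For the diffusive limit, the law of the stationary process must be shown invariant under the
symmetry (`map_path`). The integral equation says that the path minus its integrated drift equals
the initial point plus the noise. This "forcing" determines the path, since the drift is locally
Lipschitz, and by the Lusin-Souslin theorem the forcing map is a measurable embedding. Hence the law
of the path is determined by the law of (initial point, Brownian motion), which is visibly
invariant, and no solution map has to be constructed. The translation `ε c` disappears in the limit,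
so the law of `√(2D) W₁` is invariant under `R` (`map_limit`). Its covariance is `2D`, so `D = R D
Rᵀ`.

For the Poisson equation, `φᵢ ∘ T` and `sᵢ φ_{τ i}` solve the same equation, so their difference `u`
satisfies `L u = 0` in the sense of distributions. What is needed is `∫ u pⱼ dμ = 0`
(`integral_mul_velocity_eq_zero`). Formally, pairing the equation with `u` kills the antisymmetric
Hamiltonian part and leaves the dissipation in `p`, so `u` depends on `q` only. As `u` is merely in
`L²`, the pairing has to be justified without regularity theory. In the orthogonal system of the
functions `e^{βV/2} e^{-ik·q}` times Hermite functions of `p`, the equation reads `γ |α| c = A c`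
with `A` an infinite anti-Hermitian matrix and `c` square summable (Bessel). The identity `Re ⟨c, A
c⟩ = 0` is recovered with finitely supported weights (`mul_sq_norm_eq_zero_of_antiHermitian`). Their
commutators with `A` stay bounded when the Hermite degree is cut at `(n+1)²` and the frequency at
`n+1`, because `A` grows like `√α (|k| + 1)` and changes `α` by one (`modeCutoff_commutator_le`).
Thus `c` lives on `α = 0`, and `pⱼ` is orthogonal to it. -/

namespace Langevin

/-! ### Energy identity for infinite anti-Hermitian systems -/

/-- A weak Liouville principle for anti-Hermitian infinite matrices: a solution `c` of `d c = A c`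
has no component where `d ≠ 0`, as soon as there are finitely supported weights tending to `1`
whose commutators with `A` are dominated by a kernel that is summable against `|c| ⊗ |c|`. -/
theorem mul_sq_norm_eq_zero_of_antiHermitian {X : Type*} (c : X → ℂ) (d : X → ℝ)
    (hd : ∀ x, 0 ≤ d x) (A : X → X → ℂ) (hA : ∀ x y, A y x = -(starRingEnd ℂ) (A x y))
    (heq : ∀ x, HasSum (fun y => A x y * c y) (d x * c x)) (w : ℕ → X → ℝ)
    (hw0 : ∀ n x, 0 ≤ w n x) (hwfin : ∀ n, (Function.support (w n)).Finite)
    (hw1 : ∀ x, Tendsto (fun n => w n x) atTop (𝓝 1)) (Φ : X → X → ℝ)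
    (hΦ : ∀ n x y, |w n x - w n y| * ‖A x y‖ ≤ Φ x y)
    (hs : Summable fun z : X × X => Φ z.1 z.2 * (‖c z.1‖ * ‖c z.2‖)) (x : X) :
    d x * ‖c x‖ ^ 2 = 0 := by
  classical
  -- Real part of the `(x, y)` term of `⟨c, A c⟩`. It is antisymmetric because `A` is
  -- anti-Hermitian, and row `x` sums to `d x * ‖c x‖ ^ 2`. The double series itself need not
  -- converge absolutely, hence the weights.
  set t : X → X → ℝ := fun x y => ((starRingEnd ℂ) (c x) * (A x y * c y)).re with ht
  have ht_swap : ∀ x y, t y x = -t x y := by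
    intro x y
    simp only [ht, hA x y]
    rw [← Complex.conj_re, ← Complex.neg_re]
    congr 1
    simp only [map_mul, map_neg, Complex.conj_conj]
    ring
  have ht_sum : ∀ x, HasSum (t x) (d x * ‖c x‖ ^ 2) := by
    intro x
    have h := Complex.hasSum_re ((heq x).mul_left ((starRingEnd ℂ) (c x)))
    convert h using 1
    rw [mul_left_comm, ← Complex.normSq_eq_conj_mul_self, Complex.normSq_eq_norm_sq,
      ← Complex.ofReal_mul, Complex.ofReal_re]
  have ht_le : ∀ x y, |t x y| ≤ ‖A x y‖ * (‖c x‖ * ‖c y‖) := by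
    intro x y
    refine (Complex.abs_re_le_norm _).trans (le_of_eq ?_)
    simp only [norm_mul, RCLike.norm_conj]
    ring
  set E : ℕ → ℝ := fun n => ∑ x ∈ (hwfin n).toFinset, w n x * (d x * ‖c x‖ ^ 2) with hE
  have hF : ∀ n, HasSum (fun z : X × X => w n z.1 * t z.1 z.2) (E n) := by
    intro n
    have h1 : ∀ x ∈ (hwfin n).toFinset,
        HasSum (fun z : X × X => if z.1 = x then w n x * t x z.2 else 0)
          (w n x * (d x * ‖c x‖ ^ 2)) := by
      intro x _
      have hinj : Function.Injective (fun y : X => (x, y)) := fun a b h => by simpa using h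
      rw [← hinj.hasSum_iff]
      · simpa [Function.comp_def] using (ht_sum x).mul_left (w n x)
      · rintro ⟨a, b⟩ hab
        rw [if_neg]
        rintro rfl
        exact hab ⟨b, rfl⟩
    have h2 := hasSum_sum h1
    convert h2 using 2 with z
    rw [Finset.sum_ite_eq]
    split_ifs with hz
    · rfl
    · have : w n z.1 = 0 := by simpa using hz
      rw [this, zero_mul]
  -- Symmetrising under `(x, y) ↦ (y, x)` turns the weighted sum into a commutator, which is
  -- dominated by `Φ` and tends to zero termwise.
  have hG : ∀ n, HasSum (fun z : X × X => (w n z.1 - w n z.2) * t z.1 z.2) (2 * E n) := by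
    intro n
    have h1 := (hF n).add ((Equiv.prodComm X X).hasSum_iff.mpr (hF n))
    convert h1 using 1
    · funext z
      simp only [Function.comp, Equiv.prodComm_apply, Prod.fst_swap, Prod.snd_swap]
      rw [ht_swap z.1 z.2]
      ring
    · ring
  have hlim : Tendsto (fun n => 2 * E n) atTop (𝓝 0) := by
    have h := tendsto_tsum_of_dominated_convergence (𝓕 := atTop)
      (f := fun n (z : X × X) => (w n z.1 - w n z.2) * t z.1 z.2) (g := fun _ => 0) hs
      (by
        intro z
        simpa using ((hw1 z.1).sub (hw1 z.2)).mul_const (t z.1 z.2))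
      (Eventually.of_forall fun n z => by
        rw [Real.norm_eq_abs, abs_mul]
        calc |w n z.1 - w n z.2| * |t z.1 z.2|
            ≤ |w n z.1 - w n z.2| * (‖A z.1 z.2‖ * (‖c z.1‖ * ‖c z.2‖)) := by
              gcongr; exact ht_le _ _
          _ = |w n z.1 - w n z.2| * ‖A z.1 z.2‖ * (‖c z.1‖ * ‖c z.2‖) := by ring
          _ ≤ _ := by gcongr; exact hΦ _ _ _)
    simpa [fun n => (hG n).tsum_eq] using h
  -- All terms of `E n` are nonnegative, so a single one is controlled by the whole sum.
  have hle : ∀ n, w n x * (d x * ‖c x‖ ^ 2) ≤ E n := by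
    intro n
    have hnn : ∀ y, 0 ≤ w n y * (d y * ‖c y‖ ^ 2) := fun y =>
      mul_nonneg (hw0 n y) (mul_nonneg (hd y) (sq_nonneg _))
    by_cases hx : x ∈ (hwfin n).toFinset
    · exact Finset.single_le_sum (f := fun y => w n y * (d y * ‖c y‖ ^ 2)) (fun y _ => hnn y) hx
    · have : w n x = 0 := by simpa using hx
      rw [this, zero_mul]
      exact Finset.sum_nonneg fun y _ => hnn y
  have hlim' : Tendsto E atTop (𝓝 0) := by
    have := hlim.const_mul (1 / 2)
    simpa using this
  refine le_antisymm ?_ (mul_nonneg (hd x) (sq_nonneg _))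
  have h1 := (hw1 x).mul_const (d x * ‖c x‖ ^ 2)
  rw [one_mul] at h1
  exact le_of_tendsto_of_tendsto' h1 hlim' hle

end Langevin

/-! ### The stationary equation as a system on Fourier-Hermite modes -/

noncomputable section
namespace Langevin

/-- Pairs of a Hermite multi-index and a Fourier frequency. -/
abbrev Mode := (Fin 2 → ℕ) × (Fin 2 → ℤ)

/-- The cutoff of the modes at Hermite degree `(n+1)²` and frequency `n+1`. -/
def modeCutoff (n : ℕ) (x : Mode) : ℝ :=
  max 0 (1 - (∑ j, (x.1 j : ℝ)) / ((n : ℝ) + 1) ^ 2) * max 0 (1 - ‖x.2‖ / ((n : ℝ) + 1))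

/-- The part of the Hamiltonian operator that raises the Hermite index `j`. -/
def raiseMatrix (κ : ℝ) (b : Fin 2 → (Fin 2 → ℤ) → ℂ) (j : Fin 2) (x y : Mode) : ℂ :=
  if y.1 = x.1 + Pi.single j 1 then
    (κ * √((x.1 j : ℝ) + 1) : ℝ) *
      ((if y.2 = x.2 then Complex.I * (x.2 j : ℂ) else 0) - b j (x.2 - y.2))
  else 0

/-- The kernel that dominates the commutators of `raiseMatrix` with the cutoffs. -/
def raiseKernel (b : Fin 2 → (Fin 2 → ℤ) → ℂ) (j : Fin 2) (l : Fin 2 → ℤ) : ℝ :=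
  (if l = 0 then 1 else 0) + (1 + ‖l‖) * ‖b j l‖

theorem raiseKernel_nonneg (b : Fin 2 → (Fin 2 → ℤ) → ℂ) (j : Fin 2) (l : Fin 2 → ℤ) :
    0 ≤ raiseKernel b j l := by
  unfold raiseKernel
  split_ifs <;> positivity

theorem summable_raiseKernel {b : Fin 2 → (Fin 2 → ℤ) → ℂ} {j : Fin 2}
    (hb : Summable fun l => (1 + ‖l‖) * ‖b j l‖) : Summable (raiseKernel b j) :=
  (summable_of_ne_finset_zero (s := {0}) fun l hl => by
    simpa using fun h => hl (by simp [h])).add hb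

theorem modeCutoff_nonneg (n : ℕ) (x : Mode) : 0 ≤ modeCutoff n x :=
  mul_nonneg (le_max_left _ _) (le_max_left _ _)

theorem finite_support_modeCutoff (n : ℕ) : (Function.support (modeCutoff n)).Finite := by
  have h1 : ({α : Fin 2 → ℕ | ∀ j, α j ≤ (n + 1) ^ 2}).Finite := by
    have : {α : Fin 2 → ℕ | ∀ j, α j ≤ (n + 1) ^ 2} = Set.Iic (fun _ => (n + 1) ^ 2) := by
      ext; simp [Pi.le_def]
    rw [this]
    exact Set.finite_Iic _
  have h2 : (Metric.closedBall (0 : Fin 2 → ℤ) (n + 1)).Finite :=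
    (isCompact_closedBall _ _).finite_of_discrete
  refine (h1.prod h2).subset ?_
  rintro ⟨α, k⟩ hx
  have hn : (0 : ℝ) < n + 1 := by positivity
  have hx' := mul_ne_zero_iff.mp hx
  refine ⟨fun j => ?_, ?_⟩
  · by_contra! h
    apply hx'.1
    apply max_eq_left
    rw [sub_nonpos, one_le_div (by positivity)]
    have h3 : (((n + 1) ^ 2 : ℕ) : ℝ) < α j := by exact_mod_cast h
    have h4 : (α j : ℝ) ≤ ∑ j, (α j : ℝ) :=
      Finset.single_le_sum (f := fun j => (α j : ℝ)) (fun _ _ => by positivity)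
        (Finset.mem_univ j)
    push_cast at h3
    exact h3.le.trans h4
  · rw [mem_closedBall_zero_iff]
    by_contra! h
    apply hx'.2
    apply max_eq_left
    rw [sub_nonpos, one_le_div hn]
    exact h.le

theorem tendsto_modeCutoff (x : Mode) : Tendsto (fun n => modeCutoff n x) atTop (𝓝 1) := by
  have h0 : Tendsto (fun n : ℕ => ((n : ℝ) + 1)) atTop atTop :=
    tendsto_atTop_add_const_right _ _ tendsto_natCast_atTop_atTop
  have h1 : Tendsto (fun n : ℕ => (∑ j, (x.1 j : ℝ)) / ((n : ℝ) + 1) ^ 2) atTop (𝓝 0) :=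
    Tendsto.div_atTop tendsto_const_nhds ((tendsto_pow_atTop two_ne_zero).comp h0)
  have h2 : Tendsto (fun n : ℕ => ‖x.2‖ / ((n : ℝ) + 1)) atTop (𝓝 0) :=
    Tendsto.div_atTop tendsto_const_nhds h0
  have h3 := (tendsto_const_nhds (x := (0 : ℝ))).max ((tendsto_const_nhds (x := (1 : ℝ))).sub h1)
  have h4 := (tendsto_const_nhds (x := (0 : ℝ))).max ((tendsto_const_nhds (x := (1 : ℝ))).sub h2)
  simpa [modeCutoff] using h3.mul h4

theorem abs_max_zero_sub_max_zero_le (a b : ℝ) : |max 0 a - max 0 b| ≤ |a - b| := by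
  have := abs_max_sub_max_le_max 0 a 0 b
  simpa using this

theorem abs_max_zero_one_sub_le_one {a : ℝ} (ha : 0 ≤ a) : |max 0 (1 - a)| ≤ 1 := by
  rw [abs_of_nonneg (le_max_left _ _)]
  exact max_le zero_le_one (by linarith)

/-- Write `m = n + 1`. On the support of the cutoffs the matrix entry is at most of size `m (|k| +
|b|)`, since `√(α j + 1) ≤ m`. Raising the degree by one changes the Hermite cutoff by at most `1 /
m²`, which pays for both `√α` and `|k j| ≤ m`; a frequency shift `l` changes the other cutoff by
`‖l‖ / m`, which pays for `√α` alone. Convolution with `b` needs only the latter, and the derivative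
term `i k j` involves no shift. This balance dictates the scales `m²` and `m`. -/
theorem modeCutoff_commutator_le (κ : ℝ) (b : Fin 2 → (Fin 2 → ℤ) → ℂ) (j : Fin 2) (n : ℕ)
    (x y : Mode) : |modeCutoff n x - modeCutoff n y| * ‖raiseMatrix κ b j x y‖ ≤
      if y.1 = x.1 + Pi.single j 1 then |κ| * raiseKernel b j (x.2 - y.2) else 0 := by
  unfold raiseMatrix
  by_cases hy : y.1 = x.1 + Pi.single j 1
  swap
  · simp [hy]
  rw [if_pos hy, if_pos hy]
  obtain ⟨α, k⟩ := x
  obtain ⟨α', k'⟩ := y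
  simp only at hy ⊢
  subst hy
  set m : ℝ := (n : ℝ) + 1 with hm
  have hm1 : 1 ≤ m := by simp [hm]
  have hm0 : 0 < m := by linarith
  set a : ℝ := ∑ i, (α i : ℝ) with ha
  have ha0 : 0 ≤ a := Finset.sum_nonneg fun _ _ => by positivity
  have haj : (α j : ℝ) ≤ a :=
    Finset.single_le_sum (f := fun j => (α j : ℝ)) (fun _ _ => by positivity) (Finset.mem_univ j)
  have ha' : ∑ i, (((α + Pi.single j 1 : Fin 2 → ℕ) i : ℕ) : ℝ) = a + 1 := by
    simp only [Pi.add_apply, Nat.cast_add, Finset.sum_add_distrib, ← ha]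
    congr 1
    rw [← Nat.cast_sum]
    simp
  have hw : ∀ k, modeCutoff n (α, k) = max 0 (1 - a / m ^ 2) * max 0 (1 - ‖k‖ / m) := fun _ => rfl
  have hw' : ∀ k, modeCutoff n (α + Pi.single j 1, k) =
      max 0 (1 - (a + 1) / m ^ 2) * max 0 (1 - ‖k‖ / m) := by
    intro k
    simp only [modeCutoff, ha', hm]
  rw [hw, hw']
  -- Above degree `m²` both cutoffs vanish; below it, integrality upgrades `a < m²` to `a + 1 ≤ m²`,
  -- which is what the square root needs.
  rcases le_or_gt (m ^ 2) a with hbig | hsmall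
  · have h1 : max 0 (1 - a / m ^ 2) = 0 := by
      apply max_eq_left; rw [sub_nonpos, one_le_div (by positivity)]; exact hbig
    have h2 : max 0 (1 - (a + 1) / m ^ 2) = 0 := by
      apply max_eq_left; rw [sub_nonpos, one_le_div (by positivity)]; linarith
    rw [h1, h2]
    simp only [zero_mul, sub_self, abs_zero]
    exact mul_nonneg (abs_nonneg _) (raiseKernel_nonneg _ _ _)
  have hsq : √((α j : ℝ) + 1) ≤ m := by
    rw [Real.sqrt_le_left hm0.le]
    have h1 : ((∑ i, α i : ℕ) : ℝ) < (((n + 1) ^ 2 : ℕ) : ℝ) := by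
      push_cast; exact hsmall
    have h2 : (∑ i, α i) + 1 ≤ (n + 1) ^ 2 := by exact_mod_cast h1
    have h3 : (((∑ i, α i) + 1 : ℕ) : ℝ) ≤ (((n + 1) ^ 2 : ℕ) : ℝ) := by exact_mod_cast h2
    push_cast at h3
    linarith
  have hda : |max 0 (1 - a / m ^ 2) - max 0 (1 - (a + 1) / m ^ 2)| ≤ 1 / m ^ 2 := by
    refine (abs_max_zero_sub_max_zero_le _ _).trans (le_of_eq ?_)
    rw [abs_of_nonneg]
    · ring
    · have : a / m ^ 2 ≤ (a + 1) / m ^ 2 := by gcongr; linarith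
      linarith
  have hdk : |max 0 (1 - ‖k‖ / m) - max 0 (1 - ‖k'‖ / m)| ≤ ‖k - k'‖ / m := by
    refine (abs_max_zero_sub_max_zero_le _ _).trans ?_
    rw [sub_sub_sub_cancel_left, ← sub_div, abs_div, abs_of_pos hm0]
    gcongr
    rw [abs_sub_comm]
    exact abs_norm_sub_norm_le _ _
  have hdiff : |max 0 (1 - a / m ^ 2) * max 0 (1 - ‖k‖ / m) -
      max 0 (1 - (a + 1) / m ^ 2) * max 0 (1 - ‖k'‖ / m)| ≤ (1 + ‖k - k'‖) / m := by
    have e : max 0 (1 - a / m ^ 2) * max 0 (1 - ‖k‖ / m) -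
        max 0 (1 - (a + 1) / m ^ 2) * max 0 (1 - ‖k'‖ / m) =
        (max 0 (1 - a / m ^ 2) - max 0 (1 - (a + 1) / m ^ 2)) * max 0 (1 - ‖k'‖ / m) +
          max 0 (1 - a / m ^ 2) * (max 0 (1 - ‖k‖ / m) - max 0 (1 - ‖k'‖ / m)) := by ring
    rw [e]
    refine (abs_add_le _ _).trans ?_
    rw [abs_mul, abs_mul]
    have h1 := abs_max_zero_one_sub_le_one (a := ‖k'‖ / m) (by positivity)
    have h2 := abs_max_zero_one_sub_le_one (a := a / m ^ 2) (by positivity)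
    calc _ ≤ 1 / m ^ 2 * 1 + 1 * (‖k - k'‖ / m) := by gcongr
      _ ≤ 1 / m + ‖k - k'‖ / m := by
        have : 1 / m ^ 2 ≤ 1 / m := by
          apply one_div_le_one_div_of_le hm0
          nlinarith
        linarith
      _ = _ := by ring
  have hbpart : |max 0 (1 - a / m ^ 2) * max 0 (1 - ‖k‖ / m) -
      max 0 (1 - (a + 1) / m ^ 2) * max 0 (1 - ‖k'‖ / m)| * (m * ‖b j (k - k')‖) ≤
      (1 + ‖k - k'‖) * ‖b j (k - k')‖ := by
    calc _ ≤ (1 + ‖k - k'‖) / m * (m * ‖b j (k - k')‖) := by gcongr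
      _ = _ := by field_simp
  -- Here `k' = k`, so only the Hermite cutoff varies: the gain `1 / m²` beats `m * ‖k‖` where the
  -- frequency cutoff is nonzero, and otherwise both products vanish.
  have hkpart : |max 0 (1 - a / m ^ 2) * max 0 (1 - ‖k‖ / m) -
      max 0 (1 - (a + 1) / m ^ 2) * max 0 (1 - ‖k'‖ / m)| *
        (m * ‖(if k' = k then Complex.I * (k j : ℂ) else 0)‖) ≤
      if k - k' = 0 then 1 else 0 := by
    by_cases hk : k' = k
    · subst hk
      simp only [if_true, sub_self, norm_mul, Complex.norm_I, one_mul]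
      rw [← sub_mul, abs_mul]
      have hkj : ‖((k' j : ℤ) : ℂ)‖ ≤ ‖k'‖ := by
        rw [Complex.norm_intCast, ← Int.norm_eq_abs]
        exact norm_le_pi_norm k' j
      rcases le_or_gt m ‖k'‖ with h | h
      · have : max 0 (1 - ‖k'‖ / m) = 0 := by
          apply max_eq_left; rw [sub_nonpos, one_le_div hm0]; exact h
        rw [this]
        simp
      · have h1 := abs_max_zero_one_sub_le_one (a := ‖k'‖ / m) (by positivity)
        calc _ ≤ 1 / m ^ 2 * 1 * (m * m) := by
              gcongr
              exact hkj.trans h.le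
          _ = 1 := by field_simp
    · simp only [hk, if_false, norm_zero, mul_zero]
      split_ifs <;> norm_num
  rw [norm_mul, Complex.norm_real, norm_mul, Real.norm_eq_abs, Real.norm_eq_abs,
    abs_of_nonneg (Real.sqrt_nonneg _), raiseKernel]
  have hle : √((α j : ℝ) + 1) * ‖(if k' = k then Complex.I * (k j : ℂ) else 0) - b j (k - k')‖ ≤
      m * ‖(if k' = k then Complex.I * (k j : ℂ) else 0)‖ + m * ‖b j (k - k')‖ := by
    rw [← mul_add]
    gcongr
    exact norm_sub_le _ _
  set δ := |max 0 (1 - a / m ^ 2) * max 0 (1 - ‖k‖ / m) -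
      max 0 (1 - (a + 1) / m ^ 2) * max 0 (1 - ‖k'‖ / m)|
  calc _ = |κ| * (δ * (√((α j : ℝ) + 1) *
        ‖(if k' = k then Complex.I * (k j : ℂ) else 0) - b j (k - k')‖)) := by ring
    _ ≤ |κ| * (δ * (m * ‖(if k' = k then Complex.I * (k j : ℂ) else 0)‖ +
          m * ‖b j (k - k')‖)) := by
        gcongr
    _ ≤ _ := by
        rw [mul_add δ]
        gcongr

/-- An `ℓ¹` kernel in the frequency difference is bounded on `ℓ²`: parametrise the relevant pairs by
`x` and the shift `l`, bound `‖c x‖ * ‖c y‖` by the sum of squares, and note that `y` and `l` also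
determine the pair. -/
theorem summable_raiseKernel_mul {b : Fin 2 → (Fin 2 → ℤ) → ℂ} {j : Fin 2}
    (hb : Summable fun l => (1 + ‖l‖) * ‖b j l‖) (κ : ℝ) {c : Mode → ℂ}
    (hc : Summable fun x => ‖c x‖ ^ 2) :
    Summable fun z : Mode × Mode =>
      (if z.2.1 = z.1.1 + Pi.single j 1 then |κ| * raiseKernel b j (z.1.2 - z.2.2) else 0) *
        (‖c z.1‖ * ‖c z.2‖) := by
  set ι : Mode × (Fin 2 → ℤ) → Mode × Mode :=
    fun z => (z.1, (z.1.1 + Pi.single j 1, z.1.2 - z.2)) with hι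
  have hinj : Function.Injective ι := by
    rintro ⟨⟨a, k⟩, l⟩ ⟨⟨a', k'⟩, l'⟩ h
    simp only [hι, Prod.mk.injEq] at h
    obtain ⟨⟨rfl, rfl⟩, -, h⟩ := h
    simp only [sub_right_inj] at h
    rw [h]
  have hinj2 : Function.Injective fun z : Mode × (Fin 2 → ℤ) =>
      (((z.1.1 + Pi.single j 1, z.1.2 - z.2) : Mode), z.2) := by
    rintro ⟨⟨a, k⟩, l⟩ ⟨⟨a', k'⟩, l'⟩ h
    simp only [Prod.mk.injEq, add_left_inj] at h
    obtain ⟨⟨rfl, h⟩, rfl⟩ := h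
    simp only [sub_left_inj] at h
    rw [h]
  rw [← hinj.summable_iff]
  · have h1 := (hc.mul_of_nonneg (summable_raiseKernel hb) (fun _ => sq_nonneg _)
      (raiseKernel_nonneg b j)).mul_left |κ|
    have h2 := h1.comp_injective hinj2
    refine Summable.of_nonneg_of_le ?_ ?_ (h1.add h2)
    · intro z
      simp only [Function.comp, hι, if_true]
      have := raiseKernel_nonneg b j (z.1.2 - (z.1.2 - z.2))
      positivity
    · intro z
      simp only [Function.comp, hι, if_true, sub_sub_cancel]
      have h := mul_nonneg (abs_nonneg κ) (raiseKernel_nonneg b j z.2)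
      have := two_mul_le_add_sq ‖c z.1‖ ‖c (z.1.1 + Pi.single j 1, z.1.2 - z.2)‖
      have h3 : ‖c z.1‖ * ‖c (z.1.1 + Pi.single j 1, z.1.2 - z.2)‖ ≤
          ‖c z.1‖ ^ 2 + ‖c (z.1.1 + Pi.single j 1, z.1.2 - z.2)‖ ^ 2 := by nlinarith [sq_nonneg ‖c z.1‖, sq_nonneg ‖c (z.1.1 + Pi.single j 1, z.1.2 - z.2)‖]
      calc _ ≤ |κ| * raiseKernel b j z.2 *
            (‖c z.1‖ ^ 2 + ‖c (z.1.1 + Pi.single j 1, z.1.2 - z.2)‖ ^ 2) := by gcongr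
        _ = _ := by ring
  · rintro ⟨x, y⟩ hz
    rw [if_neg, zero_mul]
    intro h
    apply hz
    refine ⟨(x, x.2 - y.2), ?_⟩
    simp only [hι, sub_sub_cancel]
    simp only at h
    rw [← h]

/-- A square-summable family of coefficients that solves the stationary Langevin equation in the
Fourier--Hermite basis is concentrated on the Hermite index `0`. -/
theorem mode_coeff_eq_zero {γ : ℝ} (hγ : 0 < γ) (κ : ℝ) (b : Fin 2 → (Fin 2 → ℤ) → ℂ)
    (hbc : ∀ j l, b j (-l) = (starRingEnd ℂ) (b j l))
    (hb : ∀ j, Summable fun l => (1 + ‖l‖) * ‖b j l‖) (c : Mode → ℂ)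
    (hc : Summable fun x => ‖c x‖ ^ 2)
    (heq : ∀ α k, ((γ * ∑ j, (α j : ℝ) : ℝ) : ℂ) * c (α, k) = ∑ j,
      (((κ * √((α j : ℝ) + 1) : ℝ) : ℂ) * (Complex.I * (k j : ℂ) * c (α + Pi.single j 1, k)
          - ∑' l, b j l * c (α + Pi.single j 1, k - l))
        + ((κ * √(α j : ℝ) : ℝ) : ℂ) * (Complex.I * (k j : ℂ) * c (α - Pi.single j 1, k)
          + ∑' l, b j l * c (α - Pi.single j 1, k - l))))
    (α : Fin 2 → ℕ) (k : Fin 2 → ℤ) (hα : α ≠ 0) : c (α, k) = 0 := by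
  have hcb : ∃ C, ∀ x, ‖c x‖ ≤ C := by
    refine ⟨√(∑' x, ‖c x‖ ^ 2), fun x => ?_⟩
    apply Real.le_sqrt_of_sq_le
    exact hc.le_tsum x fun _ _ => sq_nonneg _
  obtain ⟨C, hC⟩ := hcb
  have hbs : ∀ j, Summable fun l => ‖b j l‖ := fun j =>
    (hb j).of_nonneg_of_le (fun _ => norm_nonneg _) fun l => by
      nlinarith [norm_nonneg l, norm_nonneg (b j l)]
  have hconv : ∀ j (α : Fin 2 → ℕ) (k : Fin 2 → ℤ),
      HasSum (fun k' => b j (k - k') * c (α, k')) (∑' l, b j l * c (α, k - l)) := by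
    intro j α k
    have h1 : Summable fun l => b j l * c (α, k - l) := by
      refine Summable.of_norm_bounded ((hbs j).mul_right C) fun l => ?_
      rw [norm_mul]
      gcongr
      exact hC _
    have h2 := (Equiv.subLeft k).hasSum_iff.mpr h1.hasSum
    simpa [Function.comp_def] using h2
  have hdelta : ∀ (a : ℂ) (α : Fin 2 → ℕ) (k : Fin 2 → ℤ),
      HasSum (fun k' => (if k' = k then a else 0) * c (α, k')) (a * c (α, k)) := by
    intro a α k
    convert hasSum_ite_eq k (a * c (α, k)) using 2 with k'
    split_ifs with h
    · rw [h]
    · rw [zero_mul]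
  have hfiber : ∀ (f : Mode → ℂ) (α : Fin 2 → ℕ) (s : ℂ),
      (∀ y : Mode, y.1 ≠ α → f y = 0) → HasSum (fun k' => f (α, k')) s → HasSum f s := by
    intro f α s h0 hs
    have hinj : Function.Injective fun k' : Fin 2 → ℤ => ((α, k') : Mode) := fun _ _ h => by
      simpa using h
    refine (hinj.hasSum_iff ?_).mp hs
    rintro ⟨α', k'⟩ h
    apply h0
    rintro rfl
    exact h ⟨k', rfl⟩
  have hup : ∀ j (α : Fin 2 → ℕ) (k : Fin 2 → ℤ),
      HasSum (fun y => raiseMatrix κ b j (α, k) y * c y)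
        (((κ * √((α j : ℝ) + 1) : ℝ) : ℂ) * (Complex.I * (k j : ℂ) * c (α + Pi.single j 1, k)
          - ∑' l, b j l * c (α + Pi.single j 1, k - l))) := by
    intro j α k
    refine hfiber _ (α + Pi.single j 1) _ ?_ ?_
    · intro y hy
      simp only [raiseMatrix]
      rw [if_neg hy, zero_mul]
    · have h := ((hdelta (Complex.I * (k j : ℂ)) (α + Pi.single j 1) k).sub
        (hconv j (α + Pi.single j 1) k)).mul_left (((κ * √((α j : ℝ) + 1) : ℝ) : ℂ))
      refine HasSum.congr_fun h fun k' => ?_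
      simp only [raiseMatrix, if_true]
      ring
  have hdown : ∀ j (α : Fin 2 → ℕ) (k : Fin 2 → ℤ),
      HasSum (fun y => -(starRingEnd ℂ) (raiseMatrix κ b j y (α, k)) * c y)
        (((κ * √(α j : ℝ) : ℝ) : ℂ) * (Complex.I * (k j : ℂ) * c (α - Pi.single j 1, k)
          + ∑' l, b j l * c (α - Pi.single j 1, k - l))) := by
    intro j α k
    -- If `α j = 0`, truncated subtraction gives `α - Pi.single j 1 = α`, but the coefficient `√0`
    -- removes this spurious term.
    rcases Nat.eq_zero_or_pos (α j) with h0 | h0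
    · have hz : ∀ y, -(starRingEnd ℂ) (raiseMatrix κ b j y (α, k)) * c y = 0 := by
        intro y
        simp only [raiseMatrix]
        rw [if_neg]
        · simp
        · intro h
          rw [h] at h0
          simp at h0
      simp only [hz, h0]
      simp
    · have hαe : α - Pi.single j 1 + Pi.single j 1 = α := by
        apply tsub_add_cancel_of_le
        intro i
        by_cases h : i = j
        · subst h; simpa using Nat.succ_le_of_lt h0
        · simp [h]
      have hαj : (((α - Pi.single j 1 : Fin 2 → ℕ) j : ℕ) : ℝ) + 1 = α j := by
        have := congrFun hαe j
        simp only [Pi.add_apply, Pi.single_eq_same] at this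
        exact_mod_cast this
      refine hfiber _ (α - Pi.single j 1) _ ?_ ?_
      · intro y hy
        simp only [raiseMatrix]
        rw [if_neg]
        · simp
        · rintro rfl
          simp at hy
      · have h := ((hdelta (Complex.I * (k j : ℂ)) (α - Pi.single j 1) k).add
          (hconv j (α - Pi.single j 1) k)).mul_left (((κ * √(α j : ℝ) : ℝ) : ℂ))
        refine HasSum.congr_fun h fun k' => ?_
        simp only [raiseMatrix, hαe, if_true, hαj]
        rw [map_mul, Complex.conj_ofReal, map_sub, ← hbc, neg_sub]
        by_cases hk : k = k'
        · subst hk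
          simp
          ring
        · rw [if_neg hk, if_neg (Ne.symm hk)]
          simp
          ring
  -- The lowering part is minus the adjoint of the raising part: conjugation keeps the sign of `i k
  -- j` up to the overall minus, and `b j (-l) = conj (b j l)` turns `-b` into `+b`.
  have hA := mul_sq_norm_eq_zero_of_antiHermitian c (fun x => γ * ∑ j, (x.1 j : ℝ))
    (fun x => by positivity)
    (fun x y => ∑ j, (raiseMatrix κ b j x y + -(starRingEnd ℂ) (raiseMatrix κ b j y x)))
    (fun x y => by
      rw [map_sum, ← Finset.sum_neg_distrib]
      refine Finset.sum_congr rfl fun j _ => ?_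
      simp only [map_add, map_neg, Complex.conj_conj]
      ring)
    (fun x => by
      rw [heq x.1 x.2]
      simp only [Finset.sum_mul, add_mul]
      exact hasSum_sum fun j _ => (hup j x.1 x.2).add (hdown j x.1 x.2))
    modeCutoff modeCutoff_nonneg finite_support_modeCutoff tendsto_modeCutoff
    (fun x y => ∑ j, ((if y.1 = x.1 + Pi.single j 1 then |κ| * raiseKernel b j (x.2 - y.2) else 0)
      + (if x.1 = y.1 + Pi.single j 1 then |κ| * raiseKernel b j (y.2 - x.2) else 0)))
    (fun n x y => by
      calc _ ≤ |modeCutoff n x - modeCutoff n y| *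
            ∑ j, (‖raiseMatrix κ b j x y‖ + ‖raiseMatrix κ b j y x‖) := by
            gcongr
            refine (norm_sum_le _ _).trans (Finset.sum_le_sum fun j _ => ?_)
            refine (norm_add_le _ _).trans (le_of_eq ?_)
            rw [norm_neg, RCLike.norm_conj]
        _ = ∑ j, (|modeCutoff n x - modeCutoff n y| * ‖raiseMatrix κ b j x y‖ +
              |modeCutoff n y - modeCutoff n x| * ‖raiseMatrix κ b j y x‖) := by
            rw [Finset.mul_sum, abs_sub_comm (modeCutoff n y)]
            simp only [mul_add]
        _ ≤ _ := Finset.sum_le_sum fun j _ =>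
            add_le_add (modeCutoff_commutator_le κ b j n x y)
              (modeCutoff_commutator_le κ b j n y x))
    (by
      simp only [Finset.sum_mul, add_mul]
      refine summable_sum fun j _ => ?_
      refine (summable_raiseKernel_mul (hb j) κ hc).add ?_
      have := (Equiv.prodComm Mode Mode).summable_iff.mpr (summable_raiseKernel_mul (hb j) κ hc)
      refine this.congr fun z => ?_
      simp only [Function.comp, Equiv.prodComm_apply, Prod.fst_swap, Prod.snd_swap,
        mul_comm ‖c z.2‖]
      rfl)
    (α, k)
  have hpos : 0 < γ * ∑ j, (α j : ℝ) := by
    apply mul_pos hγ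
    obtain ⟨j, hj⟩ : ∃ j, α j ≠ 0 := by
      by_contra! h
      exact hα (funext h)
    exact Finset.sum_pos' (fun _ _ => by positivity)
      ⟨j, Finset.mem_univ j, by exact_mod_cast Nat.pos_of_ne_zero hj⟩
  have := (mul_eq_zero.mp hA).resolve_left hpos.ne'
  simpa using this

/-! ### Absolutely convergent Fourier series of smooth periodic functions -/

/-- Smooth complex functions on `ℝ²` that are periodic with respect to `ℤ²`. -/
structure IsUnitPeriodic (g : (Fin 2 → ℝ) → ℂ) : Prop where
  smooth : ContDiff ℝ (⊤ : ℕ∞) g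
  periodic : ∀ (n : Fin 2 → ℤ) x, g (x + fun i => (n i : ℝ)) = g x

/-- The pairing `l · x`. -/
def intDot (l : Fin 2 → ℤ) (x : Fin 2 → ℝ) : ℝ := ∑ j, (l j : ℝ) * x j

/-- Fourier coefficients over the unit square. -/
def unitCoeff (g : (Fin 2 → ℝ) → ℂ) (l : Fin 2 → ℤ) : ℂ :=
  ∫ x in Set.Icc (0 : Fin 2 → ℝ) 1, Complex.exp (-(2 * Real.pi * Complex.I * intDot l x)) * g x

/-- The partial derivative in the `j`-th coordinate. -/
def unitPartial (j : Fin 2) (g : (Fin 2 → ℝ) → ℂ) (x : Fin 2 → ℝ) : ℂ :=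
  fderiv ℝ g x (Pi.single j 1)

theorem IsUnitPeriodic.partial {g : (Fin 2 → ℝ) → ℂ} (hg : IsUnitPeriodic g) (j : Fin 2) :
    IsUnitPeriodic (unitPartial j g) where
  smooth := (hg.smooth.fderiv_right (m := (⊤ : ℕ∞)) (by norm_cast)).clm_apply contDiff_const
  periodic n x := by
    unfold unitPartial
    rw [← fderiv_comp_add_right]
    congr 2
    funext y
    exact hg.periodic n y

theorem IsUnitPeriodic.sub {g h : (Fin 2 → ℝ) → ℂ} (hg : IsUnitPeriodic g)
    (hh : IsUnitPeriodic h) : IsUnitPeriodic (fun x => g x - h x) :=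
  ⟨hg.smooth.sub hh.smooth, fun n x => by rw [hg.periodic, hh.periodic]⟩

theorem IsUnitPeriodic.mul {g h : (Fin 2 → ℝ) → ℂ} (hg : IsUnitPeriodic g)
    (hh : IsUnitPeriodic h) : IsUnitPeriodic (fun x => g x * h x) :=
  ⟨hg.smooth.mul hh.smooth, fun n x => by rw [hg.periodic, hh.periodic]⟩

theorem isUnitPeriodic_exp (l : Fin 2 → ℤ) :
    IsUnitPeriodic fun x => Complex.exp (-(2 * Real.pi * Complex.I * intDot l x)) where
  smooth := by
    apply ContDiff.cexp
    apply ContDiff.neg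
    apply contDiff_const.mul
    refine Complex.ofRealCLM.contDiff.comp ?_
    exact ContDiff.sum (𝕜 := ℝ) (s := Finset.univ)
      (f := fun (j : Fin 2) (x : Fin 2 → ℝ) => (l j : ℝ) * x j)
      fun i _ => contDiff_const.mul (contDiff_apply ℝ ℝ i)
  periodic n x := by
    rw [Complex.exp_eq_exp_iff_exists_int]
    refine ⟨-∑ j, l j * n j, ?_⟩
    simp only [intDot, Fin.sum_univ_two, Pi.add_apply]
    push_cast
    ring

/-- Divergence theorem on the unit square: the contributions of opposite faces cancel by
periodicity. This is the integration by parts behind `unitCoeff_partial`. -/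
theorem integral_unitPartial {g : (Fin 2 → ℝ) → ℂ} (hg : IsUnitPeriodic g) (j : Fin 2) :
    ∫ x in Set.Icc (0 : Fin 2 → ℝ) 1, unitPartial j g x = 0 := by
  have hd : ∀ x, HasFDerivAt g (fderiv ℝ g x) x := fun x =>
    (hg.smooth.differentiable (by simp) x).hasFDerivAt
  have h := integral_divergence_of_hasFDerivAt_off_countable' (n := 1) (0 : Fin 2 → ℝ) 1
    zero_le_one (fun i => if i = j then g else 0)
    (fun i x => if i = j then fderiv ℝ g x else 0) ∅ Set.countable_empty
    (fun i => by
      by_cases h : i = j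
      · simpa [h] using hg.smooth.continuous.continuousOn
      · simp only [h, if_false]
        exact continuousOn_const)
    (fun x _ i => by
      by_cases h : i = j
      · simpa [h] using hd x
      · simp only [h, if_false]
        exact hasFDerivAt_const _ _)
    (by
      apply Continuous.integrableOn_Icc
      apply continuous_finsetSum
      intro i _
      by_cases h : i = j
      · simpa [h] using! (hg.partial j).smooth.continuous
      · simpa [h] using continuous_const)
  have e : ∀ x : Fin 2 → ℝ, ∑ i, (if i = j then fderiv ℝ g x else 0) (Pi.single i 1) =
      unitPartial j g x := by
    intro x
    rw [Finset.sum_eq_single j]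
    · simp [unitPartial]
    · intro i _ hi
      simp [hi]
    · simp
  simp only [e] at h
  rw [h]
  refine Finset.sum_eq_zero fun i _ => ?_
  by_cases hi : i = j
  · subst hi
    rw [sub_eq_zero]
    refine integral_congr_ae (Eventually.of_forall fun x => ?_)
    simp only [if_true]
    rw [← hg.periodic (Pi.single i 1) (i.insertNth ((0 : Fin 2 → ℝ) i) x)]
    congr 1
    funext m
    refine i.succAboveCases ?_ (fun m => ?_) m
    · simp
    · simp
  · simp [hi]

theorem unitPartial_exp (l : Fin 2 → ℤ) (j : Fin 2) (x : Fin 2 → ℝ) :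
    unitPartial j (fun x => Complex.exp (-(2 * Real.pi * Complex.I * intDot l x))) x =
      -(2 * Real.pi * Complex.I * l j) *
        Complex.exp (-(2 * Real.pi * Complex.I * intDot l x)) := by
  have hd := (((isUnitPeriodic_exp l).smooth.differentiable (by simp)) x).hasFDerivAt
  have h1 := hd.comp_hasDerivAt_of_eq (0 : ℝ) (f := fun t : ℝ => x + t • (Pi.single j 1 : Fin 2 → ℝ))
    (f' := Pi.single j 1)
    (by simpa using ((hasDerivAt_id (0 : ℝ)).smul_const (Pi.single j 1 : Fin 2 → ℝ)).const_add x)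
    (by simp)
  have e : ∀ t : ℝ, intDot l (x + t • (Pi.single j 1 : Fin 2 → ℝ)) = intDot l x + t * l j := by
    intro t
    simp only [intDot, Pi.add_apply, Pi.smul_apply, smul_eq_mul, mul_add, Finset.sum_add_distrib]
    congr 1
    rw [Finset.sum_eq_single j]
    · simp; ring
    · intro i _ hi; simp [hi]
    · simp
  have h2 : HasDerivAt (fun t : ℝ => Complex.exp (-(2 * Real.pi * Complex.I *
      (intDot l x + t * l j)))) (Complex.exp (-(2 * Real.pi * Complex.I *
      (intDot l x + (0 : ℝ) * l j))) * (-(2 * Real.pi * Complex.I * (1 * l j)))) 0 := by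
    apply HasDerivAt.cexp
    apply HasDerivAt.neg
    apply HasDerivAt.const_mul
    apply HasDerivAt.const_add
    apply HasDerivAt.mul_const
    exact (hasDerivAt_id (0 : ℝ)).ofReal_comp
  have h3 := h1.unique (h2.congr_of_eventuallyEq (Eventually.of_forall fun t => by
    simp only [Function.comp, e]
    push_cast
    rfl))
  unfold unitPartial
  rw [h3]
  simp
  ring

theorem unitCoeff_partial {g : (Fin 2 → ℝ) → ℂ} (hg : IsUnitPeriodic g) (j : Fin 2)
    (l : Fin 2 → ℤ) :
    unitCoeff (unitPartial j g) l = 2 * Real.pi * Complex.I * l j * unitCoeff g l := by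
  have hE := isUnitPeriodic_exp l
  have h := integral_unitPartial (hE.mul hg) j
  have e : ∀ x, unitPartial j (fun x => Complex.exp (-(2 * Real.pi * Complex.I *
      intDot l x)) * g x) x =
      Complex.exp (-(2 * Real.pi * Complex.I * intDot l x)) * unitPartial j g x -
      (2 * Real.pi * Complex.I * l j) *
        (Complex.exp (-(2 * Real.pi * Complex.I * intDot l x)) * g x) := by
    intro x
    have h1 := unitPartial_exp l j x
    unfold unitPartial at h1 ⊢
    rw [fderiv_fun_mul (hE.smooth.differentiable (by simp) x)
      (hg.smooth.differentiable (by simp) x)]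
    simp only [_root_.add_apply, _root_.smul_apply, smul_eq_mul]
    rw [h1]
    ring
  simp only [e] at h
  rw [integral_sub, integral_const_mul, sub_eq_zero] at h
  · exact h
  · exact (hE.mul (hg.partial j)).smooth.continuous.integrableOn_Icc
  · exact ((hE.mul hg).smooth.continuous.integrableOn_Icc).const_mul _

theorem exists_norm_unitCoeff_le (g : (Fin 2 → ℝ) → ℂ) :
    ∃ C, ∀ l, ‖unitCoeff g l‖ ≤ C := by
  refine ⟨∫ x in Set.Icc (0 : Fin 2 → ℝ) 1, ‖g x‖, fun l => ?_⟩
  refine (norm_integral_le_integral_norm _).trans (le_of_eq ?_)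
  refine integral_congr_ae (Eventually.of_forall fun x => ?_)
  simp only [norm_mul]
  rw [Complex.norm_exp]
  simp [Complex.mul_re, Complex.mul_im]

theorem IsUnitPeriodic.helmholtz {g : (Fin 2 → ℝ) → ℂ} (hg : IsUnitPeriodic g) (j : Fin 2) :
    IsUnitPeriodic (fun x => g x - unitPartial j (unitPartial j g) x) :=
  hg.sub ((hg.partial j).partial j)

/-- The operator `1 - ∂ⱼ²` multiplies coefficients by a factor that is at least one, including at
frequency zero, so decay follows by division without exceptional frequencies. -/
theorem unitCoeff_helmholtz {g : (Fin 2 → ℝ) → ℂ} (hg : IsUnitPeriodic g) (j : Fin 2)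
    (l : Fin 2 → ℤ) :
    unitCoeff (fun x => g x - unitPartial j (unitPartial j g) x) l =
      (1 + (2 * Real.pi * l j) ^ 2 : ℝ) * unitCoeff g l := by
  have hE := isUnitPeriodic_exp l
  have h1 := unitCoeff_partial hg j l
  have h2 := unitCoeff_partial (hg.partial j) j l
  have h3 : unitCoeff (fun x => g x - unitPartial j (unitPartial j g) x) l =
      unitCoeff g l - unitCoeff (unitPartial j (unitPartial j g)) l := by
    unfold unitCoeff
    simp only [mul_sub]
    rw [integral_sub]
    · exact (hE.mul hg).smooth.continuous.integrableOn_Icc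
    · exact (hE.mul ((hg.partial j).partial j)).smooth.continuous.integrableOn_Icc
  rw [h3, h2, h1]
  push_cast
  linear_combination (-(2 * Real.pi * l j : ℂ) ^ 2 * unitCoeff g l) * Complex.I_sq

theorem summable_inv_one_add_sq_int : Summable fun n : ℤ => (1 + (2 * Real.pi * n) ^ 2)⁻¹ := by
  have h := (Real.summable_one_div_int_pow (p := 2)).mpr one_lt_two
  refine Summable.of_norm_bounded_eventually h ?_
  rw [eventually_cofinite]
  refine (Set.finite_singleton (0 : ℤ)).subset ?_
  intro n hn
  by_contra h0
  apply hn
  have hn0 : (n : ℝ) ≠ 0 := by exact_mod_cast h0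
  have hn2 : 0 < (n : ℝ) ^ 2 := by positivity
  rw [Real.norm_eq_abs, abs_of_nonneg (by positivity), one_div]
  apply inv_anti₀ hn2
  have h4 : (1 : ℝ) ≤ (2 * Real.pi) ^ 2 := by nlinarith [Real.pi_gt_three]
  rw [mul_pow]
  nlinarith

/-- Apply `1 - ∂ⱼ²` twice in each direction: the coefficients of the resulting smooth function are
bounded, so those of `g` are at most `C / (A B)²` with `A`, `B` the two multipliers. One factor `A
B` absorbs `1 + ‖l‖`, the other is summable as a product of one-dimensional series. -/
theorem summable_unitCoeff {g : (Fin 2 → ℝ) → ℂ} (hg : IsUnitPeriodic g) :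
    Summable fun l => (1 + ‖l‖) * ‖unitCoeff g l‖ := by
  have h2 := ((hg.helmholtz 0).helmholtz 0).helmholtz 1
  obtain ⟨C, hC⟩ := exists_norm_unitCoeff_le
    (fun x => _ - unitPartial 1 (unitPartial 1 _) x)
  have hC0 : 0 ≤ C := (norm_nonneg _).trans (hC 0)
  have hs : Summable fun l : Fin 2 → ℤ =>
      C * ((1 + (2 * Real.pi * l 0) ^ 2)⁻¹ * (1 + (2 * Real.pi * l 1) ^ 2)⁻¹) := by
    apply Summable.mul_left
    have h := summable_inv_one_add_sq_int.mul_of_nonneg summable_inv_one_add_sq_int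
      (fun _ => by positivity) (fun _ => by positivity)
    exact (finTwoArrowEquiv ℤ).summable_iff.mpr h
  refine hs.of_nonneg_of_le (fun l => by positivity) fun l => ?_
  have hl := hC l
  rw [unitCoeff_helmholtz h2, unitCoeff_helmholtz ((hg.helmholtz 0).helmholtz 0),
    unitCoeff_helmholtz (hg.helmholtz 0), unitCoeff_helmholtz hg] at hl
  simp only [norm_mul, Complex.norm_real, Real.norm_eq_abs] at hl
  have hp : ∀ j, (1 : ℝ) ≤ 1 + (2 * Real.pi * l j) ^ 2 := fun j => by nlinarith [sq_nonneg (2 * Real.pi * l j)]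
  have hq : ∀ j, |(l j : ℝ)| ≤ (2 * Real.pi * l j) ^ 2 := by
    intro j
    have h1 : |(l j : ℝ)| ≤ (l j : ℝ) ^ 2 := by
      rw [← sq_abs]
      have : (|l j| : ℤ) ≤ |l j| ^ 2 := by
        rcases eq_or_ne (l j) 0 with h | h
        · simp [h]
        · have : 1 ≤ |l j| := Int.one_le_abs h
          nlinarith
      exact_mod_cast this
    have h4 : (1 : ℝ) ≤ (2 * Real.pi) ^ 2 := by nlinarith [Real.pi_gt_three]
    rw [mul_pow]
    nlinarith [sq_nonneg (l j : ℝ)]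
  set A := 1 + (2 * Real.pi * l 0) ^ 2 with hA
  set B := 1 + (2 * Real.pi * l 1) ^ 2 with hB
  have hA1 : 1 ≤ A := hp 0
  have hB1 : 1 ≤ B := hp 1
  have hn : 1 + ‖l‖ ≤ A * B := by
    have h1 : ‖l‖ ≤ A * B - 1 := by
      rw [pi_norm_le_iff_of_nonneg (by nlinarith)]
      intro j
      rw [Int.norm_eq_abs]
      have hj := hq j
      fin_cases j
      · simp only [Fin.zero_eta] at hj ⊢; nlinarith
      · simp only [Fin.mk_one] at hj ⊢; nlinarith
    linarith
  rw [abs_of_pos (by linarith), abs_of_pos (by linarith)] at hl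
  have hA0 : 0 < A := by linarith
  have hB0 : 0 < B := by linarith
  rw [← mul_inv, ← div_eq_mul_inv, le_div_iff₀ (by positivity)]
  calc (1 + ‖l‖) * ‖unitCoeff g l‖ * (A * B) ≤ (A * B) * ‖unitCoeff g l‖ * (A * B) := by gcongr
    _ = B * (B * (A * (A * ‖unitCoeff g l‖))) := by ring
    _ ≤ C := hl

/-- Periodicity lets `g` descend to a continuous function on the additive torus, where a continuous
function with summable Fourier coefficients is the pointwise sum of its series. -/
theorem hasSum_unitCoeff {g : (Fin 2 → ℝ) → ℂ} (hg : IsUnitPeriodic g) (x : Fin 2 → ℝ) :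
    HasSum (fun l => unitCoeff g l * Complex.exp (2 * Real.pi * Complex.I * intDot l x))
      (g x) := by
  have hq : IsOpenQuotientMap (Pi.map fun (_ : Fin 2) (x : ℝ) => (x : UnitAddCircle)) :=
    IsOpenQuotientMap.piMap fun _ => QuotientAddGroup.isOpenQuotientMap_mk
  let π : C(Fin 2 → ℝ, UnitAddTorus (Fin 2)) := ⟨_, hq.continuous⟩
  have hπ : IsQuotientMap π := hq.isQuotientMap
  have hfac : Function.FactorsThrough (⟨g, hg.smooth.continuous⟩ : C(Fin 2 → ℝ, ℂ)) π := by
    intro a b hab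
    have : ∀ i, ∃ n : ℤ, b i = a i + n := by
      intro i
      obtain ⟨n, hn⟩ := QuotientAddGroup.eq.mp (congrFun hab i)
      refine ⟨n, ?_⟩
      have hn' : (n : ℝ) = -a i + b i := by simpa using hn
      rw [hn']
      ring
    choose n hn using this
    change g a = g b
    rw [← hg.periodic n a]
    congr 1
    funext i
    simp [hn]
  let F : C(UnitAddTorus (Fin 2), ℂ) := hπ.lift ⟨g, hg.smooth.continuous⟩ hfac
  have hF : ∀ y : Fin 2 → ℝ, F (fun i => (y i : UnitAddCircle)) = g y := by
    intro y
    exact congrFun (congrArg DFunLike.coe (hπ.lift_comp ⟨g, hg.smooth.continuous⟩ hfac)) y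
  have hmF : ∀ (l : Fin 2 → ℤ) (y : Fin 2 → ℝ), UnitAddTorus.mFourier l (fun i => (y i : UnitAddCircle)) =
      Complex.exp (2 * Real.pi * Complex.I * intDot l y) := by
    intro l y
    simp only [UnitAddTorus.mFourier, ContinuousMap.coe_mk, fourier_coe_apply]
    rw [← Complex.exp_sum, intDot, Complex.ofReal_sum, Finset.mul_sum]
    congr 1
    refine Finset.sum_congr rfl fun j _ => ?_
    simp
    ring
  have hcoef : UnitAddTorus.mFourierCoeff F = unitCoeff g := by
    funext l
    rw [UnitAddTorus.mFourierCoeff_eq_integral _ _ 0, unitCoeff]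
    have hset : {x : Fin 2 → ℝ | ∀ i, x i ∈ Set.Ioc ((0 : Fin 2 → ℝ) i) ((0 : Fin 2 → ℝ) i + 1)} =
        Set.univ.pi fun i => Set.Ioc ((0 : Fin 2 → ℝ) i) ((1 : Fin 2 → ℝ) i) := by
      ext; simp
    rw [hset, volume_pi, setIntegral_congr_set Measure.univ_pi_Ioc_ae_eq_Icc]
    refine integral_congr_ae (Eventually.of_forall fun y => ?_)
    simp only [hF, hmF, smul_eq_mul]
    congr 2
    simp only [intDot, Pi.neg_apply, Int.cast_neg, neg_mul, Finset.sum_neg_distrib, mul_neg,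
      Complex.ofReal_neg]
  have hsum : Summable (UnitAddTorus.mFourierCoeff F) := by
    rw [hcoef]
    refine Summable.of_norm_bounded (summable_unitCoeff hg) fun l => ?_
    nlinarith [norm_nonneg l, norm_nonneg (unitCoeff g l)]
  have h := UnitAddTorus.hasSum_mFourier_series_apply_of_summable hsum (fun i => (x i : UnitAddCircle))
  simpa only [hcoef, hF, hmF, smul_eq_mul] using h

theorem unitCoeff_neg {g : (Fin 2 → ℝ) → ℂ} (hg : ∀ x, (starRingEnd ℂ) (g x) = g x)
    (l : Fin 2 → ℤ) : unitCoeff g (-l) = (starRingEnd ℂ) (unitCoeff g l) := by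
  unfold unitCoeff
  rw [← integral_conj]
  refine integral_congr_ae (Eventually.of_forall fun x => ?_)
  simp only [map_mul, hg, ← Complex.exp_conj]
  congr 2
  have h2 : (starRingEnd ℂ) 2 = 2 := Complex.conj_ofNat 2
  simp [intDot, h2]
  ring

/-- The character `q ↦ exp (i k · q)` of the torus. -/
def torusChar (k : Fin 2 → ℤ) (q : E2) : ℂ := Complex.exp (Complex.I * intDot k q)

/-- Absolutely convergent Fourier expansion of a smooth real function on the torus. -/
theorem exists_fourier_expansion {f : E2 → ℝ} (hf : IsPotential f) :
    ∃ a : (Fin 2 → ℤ) → ℂ, (∀ l, a (-l) = (starRingEnd ℂ) (a l)) ∧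
      (Summable fun l => (1 + ‖l‖) * ‖a l‖) ∧ ∀ q, HasSum (fun l => a l * torusChar l q) (f q) := by
  set g : (Fin 2 → ℝ) → ℂ := fun x => (f (WithLp.toLp 2 fun i => 2 * Real.pi * x i) : ℂ) with hgdef
  have hg : IsUnitPeriodic g := by
    constructor
    · refine Complex.ofRealCLM.contDiff.comp (hf.smooth.comp ?_)
      rw [contDiff_euclidean]
      intro i
      exact contDiff_const.mul (contDiff_apply ℝ ℝ i)
    · intro n x
      simp only [hgdef]
      rw [← hf.periodic n (WithLp.toLp 2 fun i => 2 * Real.pi * x i)]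
      congr 2
      ext i
      simp [latticeVec]
      ring
  refine ⟨unitCoeff g, unitCoeff_neg fun x => Complex.conj_ofReal _, summable_unitCoeff hg,
    fun q => ?_⟩
  have h := hasSum_unitCoeff hg (fun i => (2 * Real.pi)⁻¹ * q i)
  have hpi : (2 * Real.pi : ℝ) ≠ 0 := by positivity
  have hpi' : (Real.pi : ℂ) ≠ 0 := by exact_mod_cast Real.pi_ne_zero
  convert h using 1
  · funext l
    unfold torusChar
    congr 1
    simp only [intDot, Fin.sum_univ_two]
    push_cast
    field_simp
  · simp only [hgdef]
    congr 2
    ext i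
    simp only
    rw [mul_inv_cancel_left₀ hpi]

/-! ### Hermite polynomials and the Gaussian weight -/

open Polynomial in
theorem derivative_hermite_succ (n : ℕ) :
    derivative (hermite (n + 1)) = ((n : ℤ[X]) + 1) * hermite n := by
  induction n with
  | zero => simp
  | succ n ih =>
    rw [hermite_succ (n + 1), derivative_sub, derivative_mul, derivative_X, ih, derivative_mul]
    have h := hermite_succ n
    simp only [derivative_add, derivative_natCast, derivative_one, Nat.cast_add, Nat.cast_one]
    linear_combination ((-1 : ℤ[X]) - n) * h

open Polynomial in
/-- The Hermite polynomials, orthonormal for the centred Gaussian of variance `β⁻¹`. -/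
def hermitePoly (β : ℝ) (n : ℕ) : ℝ[X] :=
  C (√(n.factorial : ℝ))⁻¹ * ((hermite n).map (Int.castRingHom ℝ)).comp (C √β * X)

/-- The Gaussian weight on the velocity line. -/
def gaussWeight (β x : ℝ) : ℝ := Real.exp (-(β / 2) * x ^ 2)

theorem sqrt_factorial_succ (n : ℕ) :
    √((n + 1).factorial : ℝ) = √((n : ℝ) + 1) * √(n.factorial : ℝ) := by
  rw [Nat.factorial_succ, Nat.cast_mul, Real.sqrt_mul (by positivity)]
  push_cast
  rfl

-- Lowering relation, from `Heₙ' = n Heₙ₋₁` after normalisation. At `n = 0` the index `n - 1` is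
-- truncated to `0`, harmlessly, because of the factor `√0`. The same convention is used in the
-- three-term recurrence.
open Polynomial in
theorem derivative_hermitePoly (β : ℝ) (n : ℕ) :
    derivative (hermitePoly β n) = C (√β * √(n : ℝ)) * hermitePoly β (n - 1) := by
  cases n with
  | zero => simp [hermitePoly]
  | succ n =>
    have hn : √((n : ℝ) + 1) ≠ 0 := by positivity
    have hf : √(n.factorial : ℝ) ≠ 0 := by
      have : (0 : ℝ) < n.factorial := by exact_mod_cast n.factorial_pos
      positivity
    have hsq : √((n : ℝ) + 1) * √((n : ℝ) + 1) = (n : ℝ) + 1 := Real.mul_self_sqrt (by positivity)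
    have hc : (√((n + 1).factorial : ℝ))⁻¹ * ((n : ℝ) + 1) =
        √((n : ℝ) + 1) * (√(n.factorial : ℝ))⁻¹ := by
      rw [sqrt_factorial_succ]
      field_simp
      linear_combination -hsq
    simp only [hermitePoly, derivative_mul, derivative_C, zero_mul, zero_add, derivative_comp,
      derivative_X, mul_one, derivative_map, derivative_hermite_succ, Polynomial.map_mul,
      Polynomial.map_add, Polynomial.map_natCast, Polynomial.map_one, mul_comp, add_comp,
      natCast_comp, one_comp, Nat.add_sub_cancel, Nat.cast_add, Nat.cast_one]
    have hC := congrArg (C : ℝ → ℝ[X]) hc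
    simp only [map_mul, map_add, map_natCast, map_one] at hC ⊢
    linear_combination (C √β * (Polynomial.map (Int.castRingHom ℝ) (hermite n)).comp (C √β * X)) * hC

open Polynomial in
theorem X_mul_hermitePoly (β : ℝ) (n : ℕ) :
    C √β * X * hermitePoly β n =
      C √((n : ℝ) + 1) * hermitePoly β (n + 1) + C √(n : ℝ) * hermitePoly β (n - 1) := by
  have hn : √((n : ℝ) + 1) ≠ 0 := by positivity
  have hc : √((n : ℝ) + 1) * (√((n + 1).factorial : ℝ))⁻¹ = (√(n.factorial : ℝ))⁻¹ := by
    rw [sqrt_factorial_succ, mul_inv, mul_inv_cancel_left₀ hn]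
  have hC := congrArg (C : ℝ → ℝ[X]) hc
  have hd : C (√(n.factorial : ℝ))⁻¹ *
      (Polynomial.map (Int.castRingHom ℝ) (derivative (hermite n))).comp (C √β * X) =
      C √(n : ℝ) * hermitePoly β (n - 1) := by
    cases n with
    | zero => simp
    | succ n =>
      have hn : √((n : ℝ) + 1) ≠ 0 := by positivity
      have hf : √(n.factorial : ℝ) ≠ 0 := by
        have : (0 : ℝ) < n.factorial := by exact_mod_cast n.factorial_pos
        positivity
      have hsq : √((n : ℝ) + 1) * √((n : ℝ) + 1) = (n : ℝ) + 1 :=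
        Real.mul_self_sqrt (by positivity)
      have hc : (√((n + 1).factorial : ℝ))⁻¹ * ((n : ℝ) + 1) =
          √((n : ℝ) + 1) * (√(n.factorial : ℝ))⁻¹ := by
        rw [sqrt_factorial_succ]
        field_simp
        linear_combination -hsq
      have hC := congrArg (C : ℝ → ℝ[X]) hc
      simp only [hermitePoly, derivative_hermite_succ, Polynomial.map_mul,
        Polynomial.map_add, Polynomial.map_natCast, Polynomial.map_one, mul_comp, add_comp,
        natCast_comp, one_comp, Nat.add_sub_cancel, Nat.cast_add, Nat.cast_one]
      simp only [map_mul, map_add, map_natCast, map_one] at hC ⊢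
      linear_combination ((Polynomial.map (Int.castRingHom ℝ) (hermite n)).comp (C √β * X)) * hC
  rw [← hd]
  simp only [hermitePoly, hermite_succ, Polynomial.map_sub, Polynomial.map_mul, Polynomial.map_X,
    sub_comp, mul_comp, X_comp]
  simp only [map_mul] at hC
  linear_combination (-(C √β * X * (Polynomial.map (Int.castRingHom ℝ) (hermite n)).comp (C √β * X) -
    (Polynomial.map (Int.castRingHom ℝ) (derivative (hermite n))).comp (C √β * X))) * hC

theorem hermitePoly_zero (β : ℝ) : hermitePoly β 0 = 1 := by
  simp [hermitePoly]

theorem hermitePoly_one (β : ℝ) : hermitePoly β 1 = Polynomial.C √β * Polynomial.X := by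
  simp [hermitePoly]

open Polynomial in
theorem hermitePoly_ornsteinUhlenbeck {β : ℝ} (hβ : 0 < β) (n : ℕ) :
    derivative (derivative (hermitePoly β n)) - C β * X * derivative (hermitePoly β n) =
      -(C (β * n) * hermitePoly β n) := by
  have hb : √β * √β = β := Real.mul_self_sqrt hβ.le
  have hn : √(n : ℝ) * √(n : ℝ) = n := Real.mul_self_sqrt (by positivity)
  have hbC := congrArg (C : ℝ → ℝ[X]) hb
  have hnC := congrArg (C : ℝ → ℝ[X]) hn
  rw [derivative_hermitePoly, derivative_mul, derivative_C, derivative_hermitePoly]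
  have h := X_mul_hermitePoly β (n - 1)
  cases n with
  | zero => simp
  | succ n =>
    simp only [Nat.add_sub_cancel, map_mul] at h hbC hnC ⊢
    simp only [Nat.cast_add, Nat.cast_one, map_add, map_natCast, map_one] at h hbC hnC ⊢
    linear_combination (-C √β * C √((n : ℝ) + 1) * C √β) * h +
      (C √((n : ℝ) + 1) * X * hermitePoly β n * C √β) * hbC -
      (hermitePoly β (n + 1) * C √β * C √β) * hnC - ((n + 1 : ℝ[X]) * hermitePoly β (n + 1)) * hbC

theorem integrable_poly_mul_gaussWeight {β : ℝ} (hβ : 0 < β) (P : Polynomial ℝ) :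
    Integrable fun x => P.eval x * gaussWeight β x := by
  induction P using Polynomial.induction_on' with
  | add p q hp hq =>
    simp only [Polynomial.eval_add, add_mul]
    exact hp.add hq
  | monomial n a =>
    have h := (integrable_rpow_mul_exp_neg_mul_sq (b := β / 2) (by positivity) (s := n)
      (by linarith [(Nat.cast_nonneg n : (0 : ℝ) ≤ n)])).const_mul a
    simpa [gaussWeight, mul_assoc] using h

/-- The integrand is the derivative of `P` times the Gaussian weight, and both are integrable on the
line. -/
theorem integral_poly_gaussWeight_eq_zero {β : ℝ} (hβ : 0 < β) (P : Polynomial ℝ) :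
    ∫ x, (P.derivative - Polynomial.C β * Polynomial.X * P).eval x * gaussWeight β x = 0 := by
  refine integral_eq_zero_of_hasDerivAt_of_integrable (f := fun x => P.eval x * gaussWeight β x)
    (fun x => ?_) (integrable_poly_mul_gaussWeight hβ _) (integrable_poly_mul_gaussWeight hβ P)
  have h1 : HasDerivAt (gaussWeight β) (gaussWeight β x * (-(β / 2) * (2 * x))) x := by
    unfold gaussWeight
    apply HasDerivAt.exp
    apply HasDerivAt.const_mul
    simpa using hasDerivAt_pow 2 x
  have h2 := (P.hasDerivAt x).mul h1
  refine h2.congr_deriv ?_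
  simp only [Polynomial.eval_sub, Polynomial.eval_mul, Polynomial.eval_C, Polynomial.eval_X]
  ring

/-- Total mass of the Gaussian weight. -/
def gaussMass (β : ℝ) : ℝ := ∫ x, gaussWeight β x

theorem gaussMass_pos {β : ℝ} (hβ : 0 < β) : 0 < gaussMass β := by
  unfold gaussMass gaussWeight
  rw [integral_gaussian]
  positivity

/-- Integrate the total derivative of `h_m' h_n` times the weight: the Hermite equation for `h_m`
and the lowering relation give `m I(m, n) = √m √n I(m-1, n-1)`. On the diagonal this is an
induction. Off it, the right side is symmetric in `m` and `n`, so `(n - m) I(m, n) = 0`. -/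
theorem integral_hermitePoly_mul {β : ℝ} (hβ : 0 < β) (m n : ℕ) :
    ∫ x, (hermitePoly β m).eval x * (hermitePoly β n).eval x * gaussWeight β x =
      if m = n then gaussMass β else 0 := by
  set I : ℕ → ℕ → ℝ := fun m n =>
    ∫ x, (hermitePoly β m).eval x * (hermitePoly β n).eval x * gaussWeight β x with hI
  have key : ∀ m n : ℕ, β * m * I m n = β * (√(m : ℝ) * √(n : ℝ)) * I (m - 1) (n - 1) := by
    intro m n
    have h := integral_poly_gaussWeight_eq_zero hβ
      ((hermitePoly β m).derivative * hermitePoly β n)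
    have hb : √β * √β = β := Real.mul_self_sqrt hβ.le
    have e : ((hermitePoly β m).derivative * hermitePoly β n).derivative -
        Polynomial.C β * Polynomial.X * ((hermitePoly β m).derivative * hermitePoly β n) =
        Polynomial.C (β * (√(m : ℝ) * √(n : ℝ))) * (hermitePoly β (m - 1) * hermitePoly β (n - 1)) -
        Polynomial.C (β * m) * (hermitePoly β m * hermitePoly β n) := by
      have h1 := hermitePoly_ornsteinUhlenbeck hβ m
      have h2 := derivative_hermitePoly β m
      have h3 := derivative_hermitePoly β n
      have hbC := congrArg (Polynomial.C : ℝ → Polynomial ℝ) hb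
      rw [Polynomial.derivative_mul]
      simp only [map_mul] at h1 h2 h3 hbC ⊢
      linear_combination hermitePoly β n * h1 + (hermitePoly β m).derivative * h3 +
        (Polynomial.C √β * Polynomial.C √(n : ℝ) * hermitePoly β (n - 1)) * h2 +
        (Polynomial.C √(m : ℝ) * Polynomial.C √(n : ℝ) * hermitePoly β (m - 1) *
          hermitePoly β (n - 1)) * hbC
    rw [e] at h
    simp only [Polynomial.eval_sub, Polynomial.eval_mul, Polynomial.eval_C, sub_mul] at h
    have hint : ∀ (a : ℝ) (k l : ℕ), Integrable fun x =>
        a * ((hermitePoly β k).eval x * (hermitePoly β l).eval x) * gaussWeight β x := by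
      intro a k l
      simpa using integrable_poly_mul_gaussWeight hβ
        (Polynomial.C a * (hermitePoly β k * hermitePoly β l))
    rw [integral_sub (hint _ _ _) (hint _ _ _), sub_eq_zero] at h
    simp only [mul_assoc, integral_const_mul] at h
    simp only [hI, mul_assoc]
    exact h.symm
  have hsymm : ∀ m n, I m n = I n m := by
    intro m n
    simp only [hI]
    congr 1
    funext x
    ring
  change I m n = _
  split_ifs with h
  · subst h
    induction m with
    | zero => simp [hI, hermitePoly_zero, gaussMass]
    | succ m ih =>
      have := key (m + 1) (m + 1)
      rw [Real.mul_self_sqrt (by positivity), Nat.add_sub_cancel, ih] at this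
      exact mul_left_cancel₀ (by positivity) this
  · have h1 := key m n
    have h2 := key n m
    rw [hsymm n m, hsymm (n - 1) (m - 1), mul_comm √(n : ℝ), ← h1] at h2
    have h3 : β * ((n : ℝ) - m) * I m n = 0 := by linear_combination h2
    refine (mul_eq_zero.mp h3).resolve_left (mul_ne_zero hβ.ne' (sub_ne_zero.mpr ?_))
    exact_mod_cast Ne.symm h

/-! ### Approximation of polynomials by compactly supported functions -/

theorem exists_abs_eval_le (P : Polynomial ℝ) :
    ∃ (C : ℝ) (m : ℕ), 0 ≤ C ∧ ∀ x, |P.eval x| ≤ C * (1 + x ^ 2) ^ m := by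
  induction P using Polynomial.induction_on' with
  | add p q hp hq =>
    obtain ⟨C, m, hC, h⟩ := hp
    obtain ⟨C', m', hC', h'⟩ := hq
    refine ⟨C + C', max m m', by positivity, fun x => ?_⟩
    have h1 : 1 ≤ 1 + x ^ 2 := by nlinarith [sq_nonneg x]
    rw [Polynomial.eval_add, add_mul]
    refine (abs_add_le _ _).trans (add_le_add ((h x).trans ?_) ((h' x).trans ?_))
    · gcongr
      exact le_max_left _ _
    · gcongr
      exact le_max_right _ _
  | monomial n a =>
    refine ⟨|a|, n, abs_nonneg _, fun x => ?_⟩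
    rw [Polynomial.eval_monomial, abs_mul, abs_pow]
    gcongr
    rw [abs_le]
    constructor <;> nlinarith [sq_nonneg (x - 1), sq_nonneg (x + 1)]

/-- A polynomial is a locally uniform limit of compactly supported smooth functions, with
polynomial bounds on the first two derivatives. -/
theorem exists_polynomial_cutoff (P : Polynomial ℝ) :
    ∃ (f : ℕ → ℝ → ℝ) (C : ℝ) (m : ℕ), 0 ≤ C ∧ (∀ n, ContDiff ℝ (⊤ : ℕ∞) (f n)) ∧
      (∀ n, ∃ R : ℝ, ∀ x, R < |x| → f n x = 0) ∧
      (∀ n x, |f n x| ≤ C * (1 + x ^ 2) ^ m ∧ |deriv (f n) x| ≤ C * (1 + x ^ 2) ^ m ∧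
        |deriv (deriv (f n)) x| ≤ C * (1 + x ^ 2) ^ m) ∧
      ∀ x, ∀ᶠ n in atTop, f n x = P.eval x ∧ deriv (f n) x = P.derivative.eval x ∧
        deriv (deriv (f n)) x = P.derivative.derivative.eval x := by
  let χ : ContDiffBump (0 : ℝ) := ⟨1, 2, one_pos, one_lt_two⟩
  have hχ : ContDiff ℝ (⊤ : ℕ∞) χ := χ.contDiff
  have hχ1 : ContDiff ℝ (⊤ : ℕ∞) (deriv χ) := ((contDiff_succ_iff_deriv (n := (⊤ : ℕ∞))).mp hχ).2.2
  have hχ2 : ContDiff ℝ (⊤ : ℕ∞) (deriv (deriv χ)) :=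
    ((contDiff_succ_iff_deriv (n := (⊤ : ℕ∞))).mp hχ1).2.2
  have hd : ∀ x, HasDerivAt χ (deriv χ x) x := fun x =>
    (hχ.differentiable (by simp) x).hasDerivAt
  have hd1 : ∀ x, HasDerivAt (deriv χ) (deriv (deriv χ) x) x := fun x =>
    (hχ1.differentiable (by simp) x).hasDerivAt
  obtain ⟨K1, hK1⟩ := hχ1.continuous.bounded_above_of_compact_support χ.hasCompactSupport.deriv
  obtain ⟨K2, hK2⟩ := hχ2.continuous.bounded_above_of_compact_support
    χ.hasCompactSupport.deriv.deriv
  have hK1' : 0 ≤ K1 := (norm_nonneg _).trans (hK1 0)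
  have hK2' : 0 ≤ K2 := (norm_nonneg _).trans (hK2 0)
  -- Dilating a fixed bump by `r n ≤ 1` only shrinks its derivatives, which makes the bounds uniform
  -- in `n`.
  set r : ℕ → ℝ := fun n => ((n : ℝ) + 1)⁻¹ with hr
  have hr0 : ∀ n, 0 < r n := fun n => by simp only [hr]; positivity
  have hr1 : ∀ n, r n ≤ 1 := fun n => by
    simp only [hr]
    apply inv_le_one_of_one_le₀
    linarith [(Nat.cast_nonneg n : (0 : ℝ) ≤ n)]
  set f : ℕ → ℝ → ℝ := fun n x => P.eval x * χ (r n * x) with hf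
  have hf1 : ∀ n, deriv (f n) = fun x => P.derivative.eval x * χ (r n * x) +
      P.eval x * (r n * deriv χ (r n * x)) := by
    intro n
    funext x
    refine HasDerivAt.deriv ?_
    refine (P.hasDerivAt x).mul ?_
    have := (hd (r n * x)).comp x ((hasDerivAt_id x).const_mul (r n))
    simpa [Function.comp_def, mul_comm] using this
  have hf2 : ∀ n, deriv (deriv (f n)) = fun x =>
      (P.derivative.derivative.eval x * χ (r n * x) +
      P.derivative.eval x * (r n * deriv χ (r n * x))) +
      (P.derivative.eval x * (r n * deriv χ (r n * x)) +
        P.eval x * (r n * (r n * deriv (deriv χ) (r n * x)))) := by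
    intro n
    rw [hf1]
    funext x
    refine HasDerivAt.deriv ?_
    refine HasDerivAt.add ((P.derivative.hasDerivAt x).mul ?_) ((P.hasDerivAt x).mul ?_)
    · have := (hd (r n * x)).comp x ((hasDerivAt_id x).const_mul (r n))
      simpa [Function.comp_def, mul_comm] using this
    · refine HasDerivAt.const_mul _ ?_
      have := (hd1 (r n * x)).comp x ((hasDerivAt_id x).const_mul (r n))
      simpa [Function.comp_def, mul_comm] using this
  obtain ⟨C0, m0, hC0, hb0⟩ := exists_abs_eval_le P
  obtain ⟨C1, m1, hC1, hb1⟩ := exists_abs_eval_le P.derivative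
  obtain ⟨C2, m2, hC2, hb2⟩ := exists_abs_eval_le P.derivative.derivative
  set m := max m0 (max m1 m2) with hm
  set B : ℝ → ℝ := fun x => (1 + x ^ 2) ^ m with hB
  have hB0 : ∀ x, 0 ≤ B x := fun x => by simp only [hB]; positivity
  have hbase : ∀ x : ℝ, 1 ≤ 1 + x ^ 2 := fun x => by nlinarith [sq_nonneg x]
  have hb0' : ∀ x, |P.eval x| ≤ C0 * B x := fun x => (hb0 x).trans (by
    simp only [hB]; gcongr
    · exact hbase x
    · exact le_max_left _ _)
  have hb1' : ∀ x, |P.derivative.eval x| ≤ C1 * B x := fun x => (hb1 x).trans (by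
    simp only [hB]; gcongr
    · exact hbase x
    · exact (le_max_left _ _).trans (le_max_right _ _))
  have hb2' : ∀ x, |P.derivative.derivative.eval x| ≤ C2 * B x := fun x => (hb2 x).trans (by
    simp only [hB]; gcongr
    · exact hbase x
    · exact (le_max_right _ _).trans (le_max_right _ _))
  have hχle : ∀ x, |χ x| ≤ 1 := fun x => by
    rw [abs_of_nonneg χ.nonneg]; exact χ.le_one
  have hrχ1 : ∀ n x, |r n * deriv χ (r n * x)| ≤ K1 := fun n x => by
    rw [abs_mul, abs_of_pos (hr0 n)]
    calc _ ≤ 1 * K1 := by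
          gcongr
          · exact hr1 n
          · exact hK1 _
      _ = K1 := one_mul _
  have hrχ2 : ∀ n x, |r n * (r n * deriv (deriv χ) (r n * x))| ≤ K2 := fun n x => by
    rw [abs_mul, abs_mul, abs_of_pos (hr0 n)]
    calc _ ≤ 1 * (1 * K2) := by
          have h1 := hr1 n
          have h2 := hK2 (r n * x)
          have h3 := (hr0 n).le
          rw [Real.norm_eq_abs] at h2
          gcongr
      _ = K2 := by ring
  set C := C0 + C1 + C2 + C0 * K1 + 2 * (C1 * K1) + C0 * K2 with hC
  refine ⟨f, C, m, by positivity, ?_, ?_, ?_, ?_⟩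
  · intro n
    have hP : ContDiff ℝ (⊤ : ℕ∞) fun x => P.eval x := by
      simpa using P.contDiff_aeval (𝕜 := ℝ) (R := ℝ) (⊤ : ℕ∞)
    exact hP.mul (hχ.comp (contDiff_const.mul contDiff_id))
  · intro n
    refine ⟨2 / r n, fun x hx => ?_⟩
    simp only [hf]
    rw [χ.zero_of_le_dist, mul_zero]
    change 2 ≤ dist (r n * x) 0
    rw [dist_zero_right, Real.norm_eq_abs, abs_mul, abs_of_pos (hr0 n)]
    rw [div_lt_iff₀ (hr0 n)] at hx
    linarith
  · intro n x
    have p0 := hb0' x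
    have p1 := hb1' x
    have p2 := hb2' x
    have c0 := hχle (r n * x)
    have c1 := hrχ1 n x
    have c2 := hrχ2 n x
    have hBx := hB0 x
    have e0 : |P.eval x * χ (r n * x)| ≤ C0 * B x * 1 := by rw [abs_mul]; gcongr
    have e1 : |P.derivative.eval x * χ (r n * x)| ≤ C1 * B x * 1 := by rw [abs_mul]; gcongr
    have e2 : |P.derivative.derivative.eval x * χ (r n * x)| ≤ C2 * B x * 1 := by
      rw [abs_mul]; gcongr
    have e3 : |P.eval x * (r n * deriv χ (r n * x))| ≤ C0 * B x * K1 := by rw [abs_mul]; gcongr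
    have e4 : |P.derivative.eval x * (r n * deriv χ (r n * x))| ≤ C1 * B x * K1 := by
      rw [abs_mul]; gcongr
    have e5 : |P.eval x * (r n * (r n * deriv (deriv χ) (r n * x)))| ≤ C0 * B x * K2 := by
      rw [abs_mul]; gcongr
    have n0 : 0 ≤ C0 * B x := by positivity
    have n1 : 0 ≤ C1 * B x := by positivity
    have n2 : 0 ≤ C2 * B x := by positivity
    have n3 : 0 ≤ C0 * B x * K1 := by positivity
    have n4 : 0 ≤ C1 * B x * K1 := by positivity
    have n5 : 0 ≤ C0 * B x * K2 := by positivity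
    have hCB : C * (1 + x ^ 2) ^ m = C0 * B x + C1 * B x + C2 * B x + C0 * B x * K1 +
        2 * (C1 * B x * K1) + C0 * B x * K2 := by
      simp only [hC, hB]; ring
    rw [hCB]
    refine ⟨?_, ?_, ?_⟩
    · simp only [hf]
      linarith
    · rw [hf1]
      refine (abs_add_le _ _).trans ?_
      linarith
    · rw [hf2]
      refine (abs_add_le _ _).trans ((add_le_add (abs_add_le _ _) (abs_add_le _ _)).trans ?_)
      linarith
  · intro x
    have hlim : Tendsto (fun n => r n * x) atTop (𝓝 0) := by
      have : Tendsto r atTop (𝓝 0) := tendsto_one_div_add_atTop_nhds_zero_nat.congr fun n => by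
        simp [hr]
      simpa using this.mul_const x
    -- The bump equals one on a neighbourhood of each point near `0`, so at `r n * x` its first two
    -- derivatives vanish for large `n`.
    have hev : ∀ᶠ y in 𝓝 (0 : ℝ), χ =ᶠ[𝓝 y] (fun _ => (1 : ℝ)) :=
      eventually_eventually_nhds.mpr χ.eventuallyEq_one
    filter_upwards [hlim.eventually hev] with n hn
    have h0 : χ (r n * x) = 1 := hn.eq_of_nhds
    have h1 : deriv χ (r n * x) = 0 := by rw [hn.deriv_eq]; simp
    have h2 : deriv (deriv χ) (r n * x) = 0 := by
      rw [hn.deriv.deriv_eq]; simp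
    refine ⟨by simp [hf, h0], by rw [hf1]; simp [h0, h1], by rw [hf2]; simp [h0, h1, h2]⟩

/-! ### Product structure and integrability of the Gibbs measure -/

/-- Position marginal of the unnormalised Gibbs measure. -/
def posWeight (V : E2 → ℝ) (β : ℝ) : Measure E2 :=
  (volume.restrict cell).withDensity fun q => ENNReal.ofReal (Real.exp (-β * V q))

/-- Velocity marginal of the unnormalised Gibbs measure. -/
def velWeight (β : ℝ) : Measure E2 :=
  (volume : Measure E2).withDensity fun p => ENNReal.ofReal (∏ i, gaussWeight β (p i))

theorem prod_gaussWeight (β : ℝ) (p : E2) :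
    ∏ i, gaussWeight β (p i) = Real.exp (-β * (‖p‖ ^ 2 / 2)) := by
  simp only [gaussWeight, EuclideanSpace.norm_sq_eq, Fin.prod_univ_two, Fin.sum_univ_two,
    ← Real.exp_add, Real.norm_eq_abs, sq_abs]
  congr 1
  ring

theorem IsPotential.continuous {V : E2 → ℝ} (hV : IsPotential V) : Continuous V :=
  hV.smooth.continuous

theorem continuous_gaussWeight (β : ℝ) : Continuous (gaussWeight β) := by
  unfold gaussWeight
  fun_prop

theorem gaussWeight_pos (β x : ℝ) : 0 < gaussWeight β x := Real.exp_pos _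

theorem measurable_velDensity (β : ℝ) :
    Measurable fun p : E2 => ENNReal.ofReal (∏ i, gaussWeight β (p i)) := by
  refine (Continuous.measurable ?_).ennreal_ofReal
  refine continuous_finsetProd _ fun i _ => (continuous_gaussWeight β).comp ?_
  fun_prop

theorem measurable_posDensity {V : E2 → ℝ} (hV : IsPotential V) (β : ℝ) :
    Measurable fun q : E2 => ENNReal.ofReal (Real.exp (-β * V q)) := by
  have := hV.continuous
  exact (Continuous.measurable (by fun_prop)).ennreal_ofReal

theorem gibbsWeight_eq_prod {V : E2 → ℝ} (hV : IsPotential V) (β : ℝ) :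
    gibbsWeight V β = (posWeight V β).prod (velWeight β) := by
  unfold gibbsWeight posWeight velWeight
  rw [prod_withDensity (measurable_posDensity hV β) (measurable_velDensity β)]
  have : (volume : Measure Phase).restrict (cell ×ˢ Set.univ) =
      ((volume : Measure E2).restrict cell).prod volume := by
    rw [Measure.volume_eq_prod, ← Measure.prod_restrict, Measure.restrict_univ]
  rw [this]
  congr 1
  funext x
  rw [← ENNReal.ofReal_mul (Real.exp_pos _).le, prod_gaussWeight, ← Real.exp_add]
  unfold hamiltonian
  congr 2
  ring

theorem integral_prod_coord {𝕜 : Type*} [RCLike 𝕜] (h : Fin 2 → ℝ → 𝕜) :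
    ∫ p : E2, ∏ i, h i (p i) = ∏ i, ∫ x, h i x := by
  rw [← integral_fintype_prod_volume_eq_prod]
  exact (EuclideanSpace.volume_preserving_symm_measurableEquiv_toLp (Fin 2)).integral_comp'
    (fun x : Fin 2 → ℝ => ∏ i, h i (x i))

theorem integrable_prod_coord {𝕜 : Type*} [RCLike 𝕜] {h : Fin 2 → ℝ → 𝕜}
    (hh : ∀ i, Integrable (h i)) : Integrable fun p : E2 => ∏ i, h i (p i) :=
  (EuclideanSpace.volume_preserving_symm_measurableEquiv_toLp (Fin 2)).integrable_comp_of_integrable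
    (Integrable.fintype_prod hh)

theorem integral_velWeight {𝕜 : Type*} [RCLike 𝕜] (β : ℝ) (h : Fin 2 → ℝ → 𝕜) :
    ∫ p, ∏ i, h i (p i) ∂(velWeight β) = ∏ i, ∫ x, h i x * (gaussWeight β x : 𝕜) := by
  unfold velWeight
  rw [integral_withDensity_eq_integral_toReal_smul (measurable_velDensity β)
    (Eventually.of_forall fun _ => ENNReal.ofReal_lt_top), ← integral_prod_coord]
  congr 1
  funext p
  rw [ENNReal.toReal_ofReal (Finset.prod_nonneg fun i _ => (gaussWeight_pos β _).le),
    RCLike.real_smul_eq_coe_mul, Finset.prod_mul_distrib, mul_comm]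
  push_cast
  rfl

theorem integrable_velWeight {𝕜 : Type*} [RCLike 𝕜] {β : ℝ} {h : Fin 2 → ℝ → 𝕜}
    (hh : ∀ i, Integrable fun x => h i x * (gaussWeight β x : 𝕜)) :
    Integrable (fun p : E2 => ∏ i, h i (p i)) (velWeight β) := by
  unfold velWeight
  rw [integrable_withDensity_iff_integrable_smul' (measurable_velDensity β)
    (Eventually.of_forall fun _ => ENNReal.ofReal_lt_top)]
  refine (integrable_prod_coord hh).congr (Eventually.of_forall fun p => ?_)
  simp only
  rw [ENNReal.toReal_ofReal (Finset.prod_nonneg fun i _ => (gaussWeight_pos β _).le),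
    RCLike.real_smul_eq_coe_mul, Finset.prod_mul_distrib, mul_comm]
  push_cast
  rfl

theorem measurableSet_cell : MeasurableSet cell := by
  have : cell = ⋂ i, (fun q : E2 => q i) ⁻¹' Set.Ico 0 (2 * Real.pi) := by
    ext q; simp [cell]
  rw [this]
  refine MeasurableSet.iInter fun i => measurableSet_Ico.preimage ?_
  fun_prop

theorem exists_isCompact_cell_subset : ∃ K : Set E2, IsCompact K ∧ cell ⊆ K := by
  refine ⟨WithLp.toLp 2 '' Set.Icc (fun _ => 0) (fun _ => 2 * Real.pi),
    isCompact_Icc.image (by fun_prop), fun q hq => ⟨fun i => q i, ?_, rfl⟩⟩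
  exact ⟨fun i => (hq i).1, fun i => (hq i).2.le⟩

theorem integrableOn_cell {E : Type*} [NormedAddCommGroup E] {f : E2 → E} (hf : Continuous f) :
    IntegrableOn f cell := by
  obtain ⟨K, hK, hcK⟩ := exists_isCompact_cell_subset
  exact (hf.continuousOn.integrableOn_compact hK).mono_set hcK

theorem integrable_posWeight {E : Type*} [NormedAddCommGroup E] [NormedSpace ℝ E] {V : E2 → ℝ}
    (hV : IsPotential V) (β : ℝ) {f : E2 → E} (hf : Continuous f) :
    Integrable f (posWeight V β) := by
  unfold posWeight
  rw [integrable_withDensity_iff_integrable_smul' (measurable_posDensity hV β)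
    (Eventually.of_forall fun _ => ENNReal.ofReal_lt_top)]
  have := hV.continuous
  have h : Continuous fun q => Real.exp (-β * V q) • f q := by fun_prop
  refine (integrableOn_cell h).congr (Eventually.of_forall fun q => ?_)
  simp only
  rw [ENNReal.toReal_ofReal (Real.exp_pos _).le]

theorem integral_posWeight {E : Type*} [NormedAddCommGroup E] [NormedSpace ℝ E] {V : E2 → ℝ}
    (hV : IsPotential V) (β : ℝ) (f : E2 → E) :
    ∫ q, f q ∂(posWeight V β) = ∫ q in cell, Real.exp (-β * V q) • f q := by
  unfold posWeight
  rw [integral_withDensity_eq_integral_toReal_smul (measurable_posDensity hV β)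
    (Eventually.of_forall fun _ => ENNReal.ofReal_lt_top)]
  congr 1
  funext q
  rw [ENNReal.toReal_ofReal (Real.exp_pos _).le]

theorem continuous_torusChar (k : Fin 2 → ℤ) : Continuous (torusChar k) := by
  unfold torusChar intDot
  fun_prop

theorem integral_exp_int_mul (k : ℤ) :
    ∫ x : ℝ in Set.Ico 0 (2 * Real.pi), Complex.exp (Complex.I * (k * x : ℝ)) =
      if k = 0 then (2 * Real.pi : ℂ) else 0 := by
  rw [integral_Ico_eq_integral_Ioo, ← integral_Ioc_eq_integral_Ioo,
    ← intervalIntegral.integral_of_le (by positivity)]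
  split_ifs with h
  · subst h
    simp
  · have hk : Complex.I * k ≠ 0 := mul_ne_zero Complex.I_ne_zero (by exact_mod_cast h)
    have := integral_exp_mul_complex (a := 0) (b := 2 * Real.pi) hk
    simp only [Complex.ofReal_mul, Complex.ofReal_intCast, ← mul_assoc]
    rw [this, div_eq_zero_iff]
    left
    rw [sub_eq_zero, Complex.exp_eq_exp_iff_exists_int]
    refine ⟨k, ?_⟩
    push_cast
    ring

theorem integral_cell_torusChar (k : Fin 2 → ℤ) :
    ∫ q in cell, torusChar k q = if k = 0 then ((2 * Real.pi) ^ 2 : ℂ) else 0 := by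
  have h1 : ∫ q in cell, torusChar k q = ∫ q : E2, ∏ i,
      (Set.Ico 0 (2 * Real.pi)).indicator (fun x : ℝ => Complex.exp (Complex.I * (k i * x : ℝ)))
        (q i) := by
    rw [← integral_indicator measurableSet_cell]
    congr 1
    funext q
    by_cases hq : q ∈ cell
    · rw [Set.indicator_of_mem hq]
      have : ∀ i, (Set.Ico 0 (2 * Real.pi)).indicator
          (fun x : ℝ => Complex.exp (Complex.I * (k i * x : ℝ))) (q i) =
          Complex.exp (Complex.I * (k i * q i : ℝ)) := fun i => Set.indicator_of_mem (hq i) _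
      simp only [this]
      rw [← Complex.exp_sum, ← Finset.mul_sum, torusChar, intDot]
      push_cast
      rfl
    · rw [Set.indicator_of_notMem hq]
      obtain ⟨i, hi⟩ : ∃ i, q i ∉ Set.Ico 0 (2 * Real.pi) := by
        by_contra! h
        exact hq h
      exact (Finset.prod_eq_zero (Finset.mem_univ i) (Set.indicator_of_notMem hi _)).symm
  rw [h1, integral_prod_coord]
  simp only [integral_indicator measurableSet_Ico, integral_exp_int_mul, Fin.prod_univ_two]
  by_cases h0 : k 0 = 0
  · by_cases h1 : k 1 = 0
    · have : k = 0 := by ext i; fin_cases i <;> assumption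
      simp [this]
      ring
    · have : k ≠ 0 := fun h => h1 (by simp [h])
      simp [h1, this]
  · have : k ≠ 0 := fun h => h0 (by simp [h])
    simp [h0, this]

instance isFiniteMeasure_velWeight {β : ℝ} [hβ : Fact (0 < β)] : IsFiniteMeasure (velWeight β) := by
  have h : Integrable (fun _ : E2 => (1 : ℝ)) (velWeight β) := by
    have h1 := integrable_velWeight (𝕜 := ℝ) (β := β) (h := fun _ _ => 1) fun _ => by
      simpa using integrable_poly_mul_gaussWeight hβ.out 1
    simpa using h1
  exact (integrable_const_iff_isFiniteMeasure one_ne_zero).mp h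

theorem isFiniteMeasure_posWeight {V : E2 → ℝ} (hV : IsPotential V) (β : ℝ) :
    IsFiniteMeasure (posWeight V β) :=
  (integrable_const_iff_isFiniteMeasure (one_ne_zero (α := ℝ))).mp
    (integrable_posWeight hV β continuous_const)

/-- The normalising constant `Z⁻¹` of the Gibbs measure. -/
def gibbsNorm (V : E2 → ℝ) (β : ℝ) : ℝ := ((gibbsWeight V β Set.univ)⁻¹).toReal

theorem gibbsWeight_univ {V : E2 → ℝ} (hV : IsPotential V) {β : ℝ} (hβ : 0 < β) :
    gibbsWeight V β Set.univ ≠ 0 ∧ gibbsWeight V β Set.univ ≠ ∞ := by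
  have : Fact (0 < β) := ⟨hβ⟩
  have := isFiniteMeasure_posWeight hV β
  rw [gibbsWeight_eq_prod hV]
  refine ⟨?_, measure_ne_top _ _⟩
  rw [← Set.univ_prod_univ, Measure.prod_prod]
  refine mul_ne_zero ?_ ?_ <;> rw [Measure.measure_univ_ne_zero] <;> intro h
  · have h1 := integral_posWeight hV β fun q => Complex.exp (β * V q)
    have h2 := integral_cell_torusChar 0
    have e : ∀ q, Real.exp (-β * V q) • Complex.exp (β * V q) = torusChar 0 q := by
      intro q
      rw [RCLike.real_smul_eq_coe_mul]
      simp [torusChar, intDot, ← Complex.exp_add]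
    rw [h, integral_zero_measure] at h1
    simp only [e, h2, if_true] at h1
    have : (2 * Real.pi : ℂ) ≠ 0 := by exact_mod_cast (by positivity : (2 * Real.pi : ℝ) ≠ 0)
    exact pow_ne_zero 2 this h1.symm
  · have h1 := integral_velWeight (𝕜 := ℝ) β fun _ _ => 1
    rw [h, integral_zero_measure] at h1
    simp only [one_mul, RCLike.ofReal_real_eq_id, id] at h1
    have := gaussMass_pos hβ
    unfold gaussMass at this
    rw [Fin.prod_univ_two] at h1
    nlinarith

theorem gibbsNorm_pos {V : E2 → ℝ} (hV : IsPotential V) {β : ℝ} (hβ : 0 < β) :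
    0 < gibbsNorm V β := by
  obtain ⟨h0, h1⟩ := gibbsWeight_univ hV hβ
  exact ENNReal.toReal_pos (ENNReal.inv_ne_zero.mpr h1) (ENNReal.inv_ne_top.mpr h0)

theorem isProbabilityMeasure_gibbs {V : E2 → ℝ} (hV : IsPotential V) {β : ℝ} (hβ : 0 < β) :
    IsProbabilityMeasure (gibbs V β) := by
  obtain ⟨h0, h1⟩ := gibbsWeight_univ hV hβ
  refine ⟨?_⟩
  simp [gibbs, ENNReal.inv_mul_cancel h0 h1]

theorem integral_gibbs_mul {𝕜 : Type*} [RCLike 𝕜] {V : E2 → ℝ} (hV : IsPotential V) {β : ℝ}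
    (hβ : 0 < β) (f g : E2 → 𝕜) : ∫ x, f x.1 * g x.2 ∂(gibbs V β) =
      gibbsNorm V β * ((∫ q, f q ∂(posWeight V β)) * ∫ p, g p ∂(velWeight β)) := by
  have : Fact (0 < β) := ⟨hβ⟩
  have := isFiniteMeasure_posWeight hV β
  rw [gibbs, integral_smul_measure, gibbsWeight_eq_prod hV, integral_prod_mul, gibbsNorm,
    gibbsWeight_eq_prod hV, RCLike.real_smul_eq_coe_mul]

theorem integrable_gibbs_mul {𝕜 : Type*} [RCLike 𝕜] {V : E2 → ℝ} (hV : IsPotential V) {β : ℝ}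
    (hβ : 0 < β) {f g : E2 → 𝕜} (hf : Continuous f) (hg : Integrable g (velWeight β)) :
    Integrable (fun x : Phase => f x.1 * g x.2) (gibbs V β) := by
  have : Fact (0 < β) := ⟨hβ⟩
  have := isFiniteMeasure_posWeight hV β
  rw [gibbs]
  refine Integrable.smul_measure ?_ (ENNReal.inv_ne_top.mpr (gibbsWeight_univ hV hβ).1)
  rw [gibbsWeight_eq_prod hV]
  exact (integrable_posWeight hV β hf).mul_prod hg

theorem integrable_poly_velWeight {β : ℝ} (hβ : 0 < β) (P : Fin 2 → Polynomial ℝ) :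
    Integrable (fun p : E2 => ∏ i, (P i).eval (p i)) (velWeight β) :=
  integrable_velWeight (𝕜 := ℝ) (h := fun i x => (P i).eval x) fun i =>
    integrable_poly_mul_gaussWeight hβ (P i)

/-- Products of a continuous function of the position and of polynomials in the velocity
coordinates are square integrable for the Gibbs measure. -/
theorem memLp_two_gibbs {V : E2 → ℝ} (hV : IsPotential V) {β : ℝ} (hβ : 0 < β)
    {f : E2 → ℝ} (hf : Continuous f) (P : Fin 2 → Polynomial ℝ) :
    MemLp (fun x : Phase => f x.1 * ∏ i, (P i).eval (x.2 i)) 2 (gibbs V β) := by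
  have hc : Continuous fun x : Phase => f x.1 * ∏ i, (P i).eval (x.2 i) := by
    refine (hf.comp continuous_fst).mul (continuous_finsetProd _ fun i _ =>
      (P i).continuous.comp ?_)
    fun_prop
  rw [memLp_two_iff_integrable_sq hc.aestronglyMeasurable]
  have h := integrable_gibbs_mul (𝕜 := ℝ) hV hβ (hf.pow 2)
    (integrable_poly_velWeight hβ fun i => P i ^ 2)
  refine h.congr (Eventually.of_forall fun x => ?_)
  simp only [Polynomial.eval_pow, Finset.prod_pow, mul_pow, Pi.pow_apply]

/-! ### The adjoint generator on separated test functions -/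

/-- The `j`-th partial derivative on `ℝ²`. -/
def partialDeriv {F : Type*} [NormedAddCommGroup F] [NormedSpace ℝ F] (j : Fin 2) (g : E2 → F)
    (q : E2) : F := fderiv ℝ g q (EuclideanSpace.single j 1)

/-- The tensor product of one-variable functions. -/
def tensorFn (a : Fin 2 → ℝ → ℝ) (p : E2) : ℝ := ∏ i, a i (p i)

/-- Differentiation of the `j`-th factor of a tensor product. -/
def derivAt (j : Fin 2) (a : Fin 2 → ℝ → ℝ) : Fin 2 → ℝ → ℝ := Function.update a j (deriv (a j))

theorem gradient_apply {V : E2 → ℝ} (q : E2) (j : Fin 2) :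
    (gradient V q) j = partialDeriv j V q := by
  unfold partialDeriv gradient
  have h := EuclideanSpace.inner_single_right (𝕜 := ℝ) j 1
    ((InnerProductSpace.toDual ℝ E2).symm (fderiv ℝ V q))
  rw [InnerProductSpace.toDual_symm_apply] at h
  simpa using h.symm

theorem fderiv_eq_sum_partialDeriv {F : Type*} [NormedAddCommGroup F] [NormedSpace ℝ F]
    (g : E2 → F) (q v : E2) : fderiv ℝ g q v = ∑ j, v j • partialDeriv j g q := by
  have hv : v = ∑ j, v j • EuclideanSpace.single j (1 : ℝ) := by
    ext i
    fin_cases i <;> simp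
  conv_lhs => rw [hv]
  rw [map_sum]
  simp only [map_smul, partialDeriv]

theorem contDiff_coord (i : Fin 2) : ContDiff ℝ (⊤ : ℕ∞) fun p : E2 => p i :=
  (EuclideanSpace.proj i : E2 →L[ℝ] ℝ).contDiff

theorem contDiff_tensorFn {a : Fin 2 → ℝ → ℝ} (ha : ∀ i, ContDiff ℝ (⊤ : ℕ∞) (a i)) :
    ContDiff ℝ (⊤ : ℕ∞) (tensorFn a) := by
  unfold tensorFn
  exact contDiff_prod fun i _ => (ha i).comp (contDiff_coord i)

theorem contDiff_derivAt {a : Fin 2 → ℝ → ℝ} (ha : ∀ i, ContDiff ℝ (⊤ : ℕ∞) (a i)) (j i : Fin 2) :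
    ContDiff ℝ (⊤ : ℕ∞) (derivAt j a i) := by
  unfold derivAt
  by_cases h : i = j
  · subst h
    rw [Function.update_self]
    exact ((contDiff_succ_iff_deriv (n := (⊤ : ℕ∞))).mp (ha i)).2.2
  · rw [Function.update_of_ne h]
    exact ha i

theorem partialDeriv_tensorFn {a : Fin 2 → ℝ → ℝ} (ha : ∀ i, ContDiff ℝ (⊤ : ℕ∞) (a i))
    (j : Fin 2) (p : E2) : partialDeriv j (tensorFn a) p = tensorFn (derivAt j a) p := by
  have hc : ∀ i, HasFDerivAt (fun p : E2 => a i (p i))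
      (deriv (a i) (p i) • (EuclideanSpace.proj i : E2 →L[ℝ] ℝ)) p := by
    intro i
    have h1 : HasDerivAt (a i) (deriv (a i) (p i)) (p i) :=
      ((ha i).differentiable (by simp) _).hasDerivAt
    exact h1.comp_hasFDerivAt p (EuclideanSpace.proj i : E2 →L[ℝ] ℝ).hasFDerivAt
  have h := (hc 0).fun_mul (hc 1)
  have e : tensorFn a = fun p : E2 => a 0 (p 0) * a 1 (p 1) := by
    funext p; simp [tensorFn]
  unfold partialDeriv
  rw [e, HasFDerivAt.fderiv h]
  fin_cases j
  · simp [tensorFn, derivAt]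
    ring
  · simp [tensorFn, derivAt]

theorem fderiv_mul_tensor {g : E2 → ℝ} (hg : Differentiable ℝ g) {A : E2 → ℝ}
    (hA : Differentiable ℝ A) (q p v w : E2) :
    fderiv ℝ (fun x : Phase => g x.1 * A x.2) (q, p) (v, w) =
      A p * fderiv ℝ g q v + g q * fderiv ℝ A p w := by
  have h1 : HasFDerivAt (fun x : Phase => g x.1)
      ((fderiv ℝ g q).comp (ContinuousLinearMap.fst ℝ E2 E2)) (q, p) :=
    HasFDerivAt.comp (q, p) (hg q).hasFDerivAt hasFDerivAt_fst
  have h2 : HasFDerivAt (fun x : Phase => A x.2)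
      ((fderiv ℝ A p).comp (ContinuousLinearMap.snd ℝ E2 E2)) (q, p) :=
    HasFDerivAt.comp (q, p) (hA p).hasFDerivAt hasFDerivAt_snd
  rw [(h1.fun_mul h2).fderiv]
  simp
  ring

theorem laplacian_mul_tensorFn {a : Fin 2 → ℝ → ℝ} (ha : ∀ i, ContDiff ℝ (⊤ : ℕ∞) (a i))
    (c : ℝ) (p : E2) : Laplacian.laplacian (fun p => c * tensorFn a p) p =
      c * ∑ j, tensorFn (derivAt j (derivAt j a)) p := by
  have hA : ContDiff ℝ (⊤ : ℕ∞) (fun p => c * tensorFn a p) :=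
    contDiff_const.mul (contDiff_tensorFn ha)
  have hd : ∀ {b : Fin 2 → ℝ → ℝ}, (∀ i, ContDiff ℝ (⊤ : ℕ∞) (b i)) → ∀ j p,
      fderiv ℝ (fun p => c * tensorFn b p) p (EuclideanSpace.single j 1) =
        c * tensorFn (derivAt j b) p := by
    intro b hb j p
    rw [fderiv_const_mul ((contDiff_tensorFn hb).differentiable (by simp) p)]
    rw [← partialDeriv_tensorFn hb]
    rfl
  rw [InnerProductSpace.laplacian_eq_iteratedFDeriv_orthonormalBasis _
    (EuclideanSpace.basisFun (Fin 2) ℝ)]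
  rw [Finset.mul_sum]
  refine Finset.sum_congr rfl fun j _ => ?_
  rw [iteratedFDeriv_two_apply]
  simp only [EuclideanSpace.basisFun_apply, Matrix.cons_val_zero, Matrix.cons_val_one]
  have hdf : DifferentiableAt ℝ (fderiv ℝ fun p => c * tensorFn a p) p :=
    (hA.fderiv_right (m := (⊤ : ℕ∞)) (by norm_cast)).differentiable (by simp) p
  have h2 : fderiv ℝ (fun y => fderiv ℝ (fun p => c * tensorFn a p) y
      (EuclideanSpace.single j 1)) p (EuclideanSpace.single j 1) =
      fderiv ℝ (fderiv ℝ fun p => c * tensorFn a p) p (EuclideanSpace.single j 1)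
        (EuclideanSpace.single j 1) := by
    rw [fderiv_clm_apply hdf (differentiableAt_const _)]
    simp
  rw [← h2]
  simp only [hd ha]
  exact hd (contDiff_derivAt ha j) j p

/-- The explicit form contains the velocity factors only through themselves and two derivatives,
which are exactly the quantities controlled by `exists_polynomial_cutoff`. -/
theorem genAdjoint_mul_tensorFn {V : E2 → ℝ} (β γ : ℝ) {g : E2 → ℝ}
    (hg : ContDiff ℝ (⊤ : ℕ∞) g) {a : Fin 2 → ℝ → ℝ} (ha : ∀ i, ContDiff ℝ (⊤ : ℕ∞) (a i))
    (x : Phase) : genAdjoint V β γ (fun x => g x.1 * tensorFn a x.2) x =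
      ∑ j, (-(x.2 j * partialDeriv j g x.1) * tensorFn a x.2 +
        (g x.1 * partialDeriv j V x.1 - γ * (g x.1 * x.2 j)) * tensorFn (derivAt j a) x.2 +
        γ * β⁻¹ * g x.1 * tensorFn (derivAt j (derivAt j a)) x.2) := by
  obtain ⟨q, p⟩ := x
  have hgd : Differentiable ℝ g := hg.differentiable (by simp)
  have had : Differentiable ℝ (tensorFn a) := (contDiff_tensorFn ha).differentiable (by simp)
  unfold genAdjoint genHam genFD
  rw [fderiv_mul_tensor hgd had, fderiv_mul_tensor hgd had]
  simp only [laplacian_mul_tensorFn ha]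
  simp only [fderiv_eq_sum_partialDeriv, partialDeriv_tensorFn ha, Fin.sum_univ_two,
    PiLp.neg_apply, gradient_apply, smul_eq_mul, PiLp.zero_apply]
  ring

theorem isTestFunction_mul_tensorFn {g : E2 → ℝ} (hg : IsPotential g) {a : Fin 2 → ℝ → ℝ}
    (ha : ∀ i, ContDiff ℝ (⊤ : ℕ∞) (a i)) (hs : ∀ i, ∃ R : ℝ, ∀ x, R < |x| → a i x = 0) :
    IsTestFunction fun x : Phase => g x.1 * tensorFn a x.2 where
  smooth := (hg.smooth.comp contDiff_fst).mul ((contDiff_tensorFn ha).comp contDiff_snd)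
  periodic k q p := by simp only [hg.periodic]
  support := by
    choose R hR using hs
    refine ⟨|R 0| + |R 1|, fun q p hp => ?_⟩
    have h : ∃ i, R i < |p i| := by
      by_contra! h
      have h0 := (h 0).trans (le_abs_self _)
      have h1 := (h 1).trans (le_abs_self _)
      have : ‖p‖ ≤ |R 0| + |R 1| := by
        rw [EuclideanSpace.norm_eq, Fin.sum_univ_two]
        apply Real.sqrt_le_iff.mpr
        refine ⟨by positivity, ?_⟩
        simp only [Real.norm_eq_abs]
        nlinarith [abs_nonneg (p 0), abs_nonneg (p 1), abs_nonneg (R 0), abs_nonneg (R 1)]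
      linarith
    obtain ⟨i, hi⟩ := h
    simp only [tensorFn]
    rw [Finset.prod_eq_zero (Finset.mem_univ i) (hR i _ hi), mul_zero]

/-- Differentiation of the `j`-th polynomial of a family. -/
def polyDerivAt (j : Fin 2) (P : Fin 2 → Polynomial ℝ) : Fin 2 → Polynomial ℝ :=
  Function.update P j (P j).derivative

/-- The tensor product of polynomials. -/
def tensorPoly (P : Fin 2 → Polynomial ℝ) (p : E2) : ℝ := ∏ i, (P i).eval (p i)

theorem continuous_partialDeriv {F : Type*} [NormedAddCommGroup F] [NormedSpace ℝ F] {g : E2 → F}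
    (hg : ContDiff ℝ (⊤ : ℕ∞) g) (j : Fin 2) : Continuous (partialDeriv j g) :=
  (hg.continuous_fderiv (by simp)).clm_apply continuous_const

/-- The weak stationary equation, extended from compactly supported test functions to polynomials
in the velocity. -/
theorem weak_equation_poly {V : E2 → ℝ} (hV : IsPotential V) {β γ : ℝ} (hβ : 0 < β)
    {u : Phase → ℝ} (hu : MemLp u 2 (gibbs V β))
    (heq : ∀ ψ, IsTestFunction ψ → ∫ x, u x * genAdjoint V β γ ψ x ∂(gibbs V β) = 0)
    {g : E2 → ℝ} (hg : IsPotential g) (P : Fin 2 → Polynomial ℝ) :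
    ∫ x, u x * ∑ j, (-(x.2 j * partialDeriv j g x.1) * tensorPoly P x.2 +
        (g x.1 * partialDeriv j V x.1 - γ * (g x.1 * x.2 j)) * tensorPoly (polyDerivAt j P) x.2 +
        γ * β⁻¹ * g x.1 * tensorPoly (polyDerivAt j (polyDerivAt j P)) x.2) ∂(gibbs V β) = 0 := by
  choose f C m hC hsmooth hsupp hbound hlim using fun i => exists_polynomial_cutoff (P i)
  set a : ℕ → Fin 2 → ℝ → ℝ := fun n i => f i n with ha
  have has : ∀ n i, ContDiff ℝ (⊤ : ℕ∞) (a n i) := fun n i => hsmooth i n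
  have hzero : ∀ n, ∫ x, u x * genAdjoint V β γ (fun x => g x.1 * tensorFn (a n) x.2) x
      ∂(gibbs V β) = 0 := fun n =>
    heq _ (isTestFunction_mul_tensorFn hg (has n) fun i => hsupp i n)
  simp only [genAdjoint_mul_tensorFn (V := V) β γ hg.smooth (has _)] at hzero
  set B : E2 → ℝ := fun p => ∏ i, (C i * (1 + p i ^ 2) ^ m i) with hB
  have hB0 : ∀ p, 0 ≤ B p := fun p => Finset.prod_nonneg fun i _ => by
    have := hC i; positivity
  have hle : ∀ (b : Fin 2 → ℝ → ℝ) (p : E2), (∀ i, |b i (p i)| ≤ C i * (1 + p i ^ 2) ^ m i) →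
      |tensorFn b p| ≤ B p := by
    intro b p h
    unfold tensorFn
    rw [Finset.abs_prod]
    exact Finset.prod_le_prod (fun i _ => abs_nonneg _) fun i _ => h i
  have hle0 : ∀ n p, |tensorFn (a n) p| ≤ B p := fun n p => hle _ _ fun i => (hbound i n _).1
  have hle1 : ∀ n j p, |tensorFn (derivAt j (a n)) p| ≤ B p := fun n j p => hle _ _ fun i => by
    unfold derivAt
    by_cases h : i = j
    · subst h; rw [Function.update_self]; exact (hbound i n _).2.1
    · rw [Function.update_of_ne h]; exact (hbound i n _).1
  have hle2 : ∀ n j p, |tensorFn (derivAt j (derivAt j (a n))) p| ≤ B p := fun n j p =>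
    hle _ _ fun i => by
      unfold derivAt
      by_cases h : i = j
      · subst h; simp only [Function.update_self]; exact (hbound i n _).2.2
      · simp only [Function.update_of_ne h]; exact (hbound i n _).1
  set K : E2 → ℝ := fun q => ∑ j, (|partialDeriv j g q| + |g q * partialDeriv j V q| +
    |γ| * |g q| + |γ * β⁻¹ * g q|) with hK
  have hKc : Continuous K := by
    have h1 := hg.continuous
    have h2 := fun j => continuous_partialDeriv hg.smooth j
    have h3 := fun j => continuous_partialDeriv hV.smooth j
    simp only [hK]
    fun_prop
  -- The exponent `m i + 1` leaves a spare factor `1 + p i ^ 2` in each coordinate; their product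
  -- absorbs the velocity `p j` in the coefficients. The majorant `K * Q` is in `L²`, hence
  -- integrable against `u`.
  set Q : Fin 2 → Polynomial ℝ := fun i => Polynomial.C (C i) *
    (1 + Polynomial.X ^ 2) ^ (m i + 1) with hQ
  have hbd := memLp_two_gibbs hV hβ hKc Q
  have hpj : ∀ (p : E2) j, |p j| ≤ ∏ i, (1 + p i ^ 2) := by
    intro p j
    rw [Fin.prod_univ_two]
    have h0 := sq_nonneg (p 0)
    have h1 := sq_nonneg (p 1)
    have : |p j| ≤ 1 + p j ^ 2 := by
      rw [abs_le]; constructor <;> nlinarith [sq_nonneg (p j - 1), sq_nonneg (p j + 1)]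
    fin_cases j
    · simp only [Fin.zero_eta] at this ⊢; nlinarith
    · simp only [Fin.mk_one] at this ⊢; nlinarith
  have hp1 : ∀ p : E2, 1 ≤ ∏ i, (1 + p i ^ 2) := by
    intro p
    rw [Fin.prod_univ_two]
    have h0 := sq_nonneg (p 0)
    have h1 := sq_nonneg (p 1)
    nlinarith
  have hQB : ∀ p : E2, ∏ i, (Q i).eval (p i) = (∏ i, (1 + p i ^ 2)) * B p := by
    intro p
    simp only [hQ, hB, ← Finset.prod_mul_distrib]
    refine Finset.prod_congr rfl fun i _ => ?_
    simp [pow_succ]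
    ring
  have htend := tendsto_integral_of_dominated_convergence (μ := gibbs V β)
    (F := fun n x => u x * ∑ j, (-(x.2 j * partialDeriv j g x.1) * tensorFn (a n) x.2 +
        (g x.1 * partialDeriv j V x.1 - γ * (g x.1 * x.2 j)) * tensorFn (derivAt j (a n)) x.2 +
        γ * β⁻¹ * g x.1 * tensorFn (derivAt j (derivAt j (a n))) x.2))
    (f := fun x => u x * ∑ j, (-(x.2 j * partialDeriv j g x.1) * tensorPoly P x.2 +
        (g x.1 * partialDeriv j V x.1 - γ * (g x.1 * x.2 j)) * tensorPoly (polyDerivAt j P) x.2 +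
        γ * β⁻¹ * g x.1 * tensorPoly (polyDerivAt j (polyDerivAt j P)) x.2))
    (fun x => |u x| * |K x.1 * ∏ i, (Q i).eval (x.2 i)|) ?_ ?_ ?_ ?_
  · simp only [hzero] at htend
    exact tendsto_nhds_unique htend tendsto_const_nhds
  · intro n
    refine hu.aestronglyMeasurable.mul (Continuous.aestronglyMeasurable ?_)
    have h1 := hg.continuous
    have h2 := fun j => continuous_partialDeriv hg.smooth j
    have h3 := fun j => continuous_partialDeriv hV.smooth j
    have h4 := (contDiff_tensorFn (has n)).continuous
    have h5 := fun j => (contDiff_tensorFn (contDiff_derivAt (has n) j)).continuous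
    have h6 := fun j => (contDiff_tensorFn
      (contDiff_derivAt (contDiff_derivAt (has n) j) j)).continuous
    fun_prop
  · refine (hu.integrable_mul hbd).abs.congr (Eventually.of_forall fun x => ?_)
    simp only [Pi.mul_apply, abs_mul]
  · intro n
    refine Eventually.of_forall fun x => ?_
    rw [Real.norm_eq_abs, abs_mul]
    refine mul_le_mul_of_nonneg_left ?_ (abs_nonneg _)
    refine le_trans ?_ (le_abs_self _)
    rw [hQB]
    simp only [hK, Finset.sum_mul]
    refine (Finset.abs_sum_le_sum_abs _ _).trans (Finset.sum_le_sum fun j _ => ?_)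
    set S := ∏ i, (1 + x.2 i ^ 2)
    have t0 := hle0 n x.2
    have t1 := hle1 n j x.2
    have t2 := hle2 n j x.2
    have s0 := hpj x.2 j
    have s1 := hp1 x.2
    have b0 := hB0 x.2
    have i1 : |-(x.2 j * partialDeriv j g x.1) * tensorFn (a n) x.2| ≤
        |partialDeriv j g x.1| * (S * B x.2) := by
      rw [abs_mul, abs_neg, abs_mul]
      calc _ ≤ S * |partialDeriv j g x.1| * B x.2 := by gcongr
        _ = _ := by ring
    have i2 : |(g x.1 * partialDeriv j V x.1 - γ * (g x.1 * x.2 j)) *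
        tensorFn (derivAt j (a n)) x.2| ≤
        (|g x.1 * partialDeriv j V x.1| + |γ| * |g x.1|) * (S * B x.2) := by
      rw [abs_mul]
      have : |g x.1 * partialDeriv j V x.1 - γ * (g x.1 * x.2 j)| ≤
          (|g x.1 * partialDeriv j V x.1| + |γ| * |g x.1|) * S := by
        refine (abs_sub _ _).trans ?_
        rw [abs_mul γ, abs_mul (g x.1) (x.2 j), add_mul, mul_assoc |γ|]
        gcongr
        exact le_mul_of_one_le_right (abs_nonneg _) s1
      calc _ ≤ ((|g x.1 * partialDeriv j V x.1| + |γ| * |g x.1|) * S) * B x.2 := by gcongr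
        _ = _ := by ring
    have i3 : |γ * β⁻¹ * g x.1 * tensorFn (derivAt j (derivAt j (a n))) x.2| ≤
        |γ * β⁻¹ * g x.1| * (S * B x.2) := by
      rw [abs_mul]
      gcongr
      exact t2.trans (le_mul_of_one_le_left b0 s1)
    refine (abs_add_le _ _).trans ((add_le_add_left (abs_add_le _ _) _).trans ?_)
    linarith
  · refine Eventually.of_forall fun x => ?_
    have hev : ∀ᶠ n in atTop, ∀ i, f i n (x.2 i) = (P i).eval (x.2 i) ∧
        deriv (f i n) (x.2 i) = (P i).derivative.eval (x.2 i) ∧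
        deriv (deriv (f i n)) (x.2 i) = (P i).derivative.derivative.eval (x.2 i) :=
      eventually_all.mpr fun i => hlim i (x.2 i)
    refine tendsto_const_nhds.congr' ?_
    filter_upwards [hev] with n hn
    have e0 : tensorFn (a n) x.2 = tensorPoly P x.2 :=
      Finset.prod_congr rfl fun i _ => (hn i).1
    have e1 : ∀ j, tensorFn (derivAt j (a n)) x.2 = tensorPoly (polyDerivAt j P) x.2 := fun j =>
      Finset.prod_congr rfl fun i _ => by
        unfold derivAt polyDerivAt
        by_cases h : i = j
        · subst h; simp only [Function.update_self]; exact (hn i).2.1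
        · simp only [Function.update_of_ne h]; exact (hn i).1
    have e2 : ∀ j, tensorFn (derivAt j (derivAt j (a n))) x.2 =
        tensorPoly (polyDerivAt j (polyDerivAt j P)) x.2 := fun j =>
      Finset.prod_congr rfl fun i _ => by
        unfold derivAt polyDerivAt
        by_cases h : i = j
        · subst h; simp only [Function.update_self]; exact (hn i).2.2
        · simp only [Function.update_of_ne h]; exact (hn i).1
    simp only [e0, e1, e2]

/-! ### The stationary equation in the Hermite basis -/

/-- Product Hermite functions in the velocity. -/
def hermiteFn (β : ℝ) (α : Fin 2 → ℕ) (p : E2) : ℝ := tensorPoly (fun i => hermitePoly β (α i)) p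

theorem continuous_tensorPoly (P : Fin 2 → Polynomial ℝ) : Continuous (tensorPoly P) :=
  continuous_finsetProd _ fun i _ => (P i).continuous.comp (by fun_prop)

theorem tensorPoly_update (P : Fin 2 → Polynomial ℝ) (j : Fin 2) (Q : Polynomial ℝ) (p : E2) :
    tensorPoly (Function.update P j Q) p = Q.eval (p j) * tensorPoly (Function.update P j 1) p := by
  fin_cases j <;> simp [tensorPoly, mul_comm]

theorem tensorPoly_eq_mul (P : Fin 2 → Polynomial ℝ) (j : Fin 2) (p : E2) :
    tensorPoly P p = (P j).eval (p j) * tensorPoly (Function.update P j 1) p := by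
  rw [← tensorPoly_update, Function.update_eq_self]

theorem hermiteFn_add_single (β : ℝ) (α : Fin 2 → ℕ) (j : Fin 2) (p : E2) :
    hermiteFn β (α + Pi.single j 1) p = (hermitePoly β (α j + 1)).eval (p j) *
      tensorPoly (Function.update (fun i => hermitePoly β (α i)) j 1) p := by
  rw [← tensorPoly_update, hermiteFn]
  congr 1
  funext i
  by_cases h : i = j
  · subst h; simp
  · simp [h]

theorem hermiteFn_sub_single (β : ℝ) (α : Fin 2 → ℕ) (j : Fin 2) (p : E2) :
    hermiteFn β (α - Pi.single j 1) p = (hermitePoly β (α j - 1)).eval (p j) *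
      tensorPoly (Function.update (fun i => hermitePoly β (α i)) j 1) p := by
  rw [← tensorPoly_update, hermiteFn]
  congr 1
  funext i
  by_cases h : i = j
  · subst h; simp
  · simp [h]

/-- Transport by `p j` is the only term of the adjoint that raises the Hermite index. -/
theorem velocity_mul_hermiteFn {β : ℝ} (hβ : 0 < β) (α : Fin 2 → ℕ) (j : Fin 2) (p : E2) :
    p j * hermiteFn β α p = (√β)⁻¹ * √((α j : ℝ) + 1) * hermiteFn β (α + Pi.single j 1) p +
      (√β)⁻¹ * √(α j : ℝ) * hermiteFn β (α - Pi.single j 1) p := by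
  have hb : √β ≠ 0 := by positivity
  have h := congrArg (Polynomial.eval (p j)) (X_mul_hermitePoly β (α j))
  simp only [Polynomial.eval_mul, Polynomial.eval_add, Polynomial.eval_C, Polynomial.eval_X] at h
  rw [hermiteFn_add_single, hermiteFn_sub_single, hermiteFn, tensorPoly_eq_mul _ j]
  have hbi : (√β)⁻¹ * √β = 1 := inv_mul_cancel₀ hb
  set T := tensorPoly (Function.update (fun i => hermitePoly β (α i)) j 1) p
  linear_combination ((√β)⁻¹ * T) * h - (p j * (hermitePoly β (α j)).eval (p j) * T) * hbi

theorem tensorPoly_polyDerivAt_hermite (β : ℝ) (α : Fin 2 → ℕ) (j : Fin 2) (p : E2) :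
    tensorPoly (polyDerivAt j fun i => hermitePoly β (α i)) p =
      √β * √(α j : ℝ) * hermiteFn β (α - Pi.single j 1) p := by
  rw [polyDerivAt, tensorPoly_update, hermiteFn_sub_single, derivative_hermitePoly]
  simp only [Polynomial.eval_mul, Polynomial.eval_C]
  ring

/-- Hermite functions are eigenfunctions of the fluctuation-dissipation part. This yields the
diagonal `γ |α|` of the mode system. -/
theorem tensorPoly_ornsteinUhlenbeck {β : ℝ} (hβ : 0 < β) (α : Fin 2 → ℕ) (j : Fin 2) (p : E2) :
    β⁻¹ * tensorPoly (polyDerivAt j (polyDerivAt j fun i => hermitePoly β (α i))) p -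
      p j * tensorPoly (polyDerivAt j fun i => hermitePoly β (α i)) p =
      -((α j : ℝ) * hermiteFn β α p) := by
  have h := congrArg (Polynomial.eval (p j)) (hermitePoly_ornsteinUhlenbeck hβ (α j))
  simp only [Polynomial.eval_mul, Polynomial.eval_sub, Polynomial.eval_neg, Polynomial.eval_C,
    Polynomial.eval_X] at h
  simp only [polyDerivAt, Function.update_self, Function.update_idem]
  rw [hermiteFn, tensorPoly_update _ j (Polynomial.derivative (hermitePoly β (α j))),
    tensorPoly_update _ j (Polynomial.derivative (Polynomial.derivative (hermitePoly β (α j)))),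
    tensorPoly_eq_mul (fun i => hermitePoly β (α i)) j]
  have hb : β ≠ 0 := hβ.ne'
  field_simp
  linear_combination (tensorPoly (Function.update (fun i => hermitePoly β (α i)) j 1) p) * h

/-- The pairing of `u` with a function of the position times a Hermite function. -/
def hermitePairing {𝕜 : Type*} [RCLike 𝕜] (V : E2 → ℝ) (β : ℝ) (u : Phase → ℝ) (F : E2 → 𝕜)
    (α : Fin 2 → ℕ) : 𝕜 := ∫ x, (u x : 𝕜) * (F x.1 * (hermiteFn β α x.2 : 𝕜)) ∂(gibbs V β)

section Pairing

variable {V : E2 → ℝ} {β : ℝ} {u : Phase → ℝ}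

theorem integrable_hermitePairing {𝕜 : Type*} [RCLike 𝕜] (hV : IsPotential V) (hβ : 0 < β)
    (hu : MemLp u 2 (gibbs V β)) {F : E2 → 𝕜} (hF : Continuous F) (α : Fin 2 → ℕ) :
    Integrable (fun x => (u x : 𝕜) * (F x.1 * (hermiteFn β α x.2 : 𝕜))) (gibbs V β) := by
  have h := hu.integrable_mul (memLp_two_gibbs hV hβ hF.norm fun i => hermitePoly β (α i))
  refine h.norm.mono' ?_ (Eventually.of_forall fun x => ?_)
  · have hh : Continuous (hermiteFn β α) := continuous_tensorPoly _
    have h1 : AEStronglyMeasurable (fun x => (u x : 𝕜)) (gibbs V β) :=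
      RCLike.continuous_ofReal.comp_aestronglyMeasurable hu.aestronglyMeasurable
    have h2 : Continuous fun x : Phase => F x.1 * (hermiteFn β α x.2 : 𝕜) :=
      (hF.comp continuous_fst).mul (RCLike.continuous_ofReal.comp (hh.comp continuous_snd))
    exact h1.mul h2.aestronglyMeasurable
  · simp only [norm_mul, Pi.mul_apply, RCLike.norm_ofReal, Real.norm_eq_abs, hermiteFn,
      tensorPoly, abs_norm]
    rfl

theorem hermitePairing_add {𝕜 : Type*} [RCLike 𝕜] (hV : IsPotential V) (hβ : 0 < β)
    (hu : MemLp u 2 (gibbs V β)) {F G : E2 → 𝕜} (hF : Continuous F) (hG : Continuous G)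
    (α : Fin 2 → ℕ) : hermitePairing V β u (fun q => F q + G q) α =
      hermitePairing V β u F α + hermitePairing V β u G α := by
  unfold hermitePairing
  rw [← integral_add (integrable_hermitePairing hV hβ hu hF α)
    (integrable_hermitePairing hV hβ hu hG α)]
  congr 1
  funext x
  ring

theorem hermitePairing_const_mul {𝕜 : Type*} [RCLike 𝕜] (c : 𝕜) (F : E2 → 𝕜) (α : Fin 2 → ℕ) :
    hermitePairing V β u (fun q => c * F q) α = c * hermitePairing V β u F α := by
  unfold hermitePairing
  rw [← integral_const_mul]
  congr 1
  funext x
  ring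

theorem hermitePairing_re (hV : IsPotential V) (hβ : 0 < β) (hu : MemLp u 2 (gibbs V β))
    {F : E2 → ℂ} (hF : Continuous F) (α : Fin 2 → ℕ) :
    (hermitePairing V β u F α).re = hermitePairing V β u (fun q => (F q).re) α := by
  unfold hermitePairing
  rw [← RCLike.re_eq_complex_re, ← integral_re (integrable_hermitePairing hV hβ hu hF α)]
  congr 1
  funext x
  simp

theorem hermitePairing_im (hV : IsPotential V) (hβ : 0 < β) (hu : MemLp u 2 (gibbs V β))
    {F : E2 → ℂ} (hF : Continuous F) (α : Fin 2 → ℕ) :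
    (hermitePairing V β u F α).im = hermitePairing V β u (fun q => (F q).im) α := by
  unfold hermitePairing
  rw [← RCLike.im_eq_complex_im, ← integral_im (integrable_hermitePairing hV hβ hu hF α)]
  congr 1
  funext x
  simp

/-- The weak stationary equation in the Hermite basis. -/
theorem weak_equation_hermite_real (hV : IsPotential V) {γ : ℝ} (hβ : 0 < β)
    (hu : MemLp u 2 (gibbs V β))
    (heq : ∀ ψ, IsTestFunction ψ → ∫ x, u x * genAdjoint V β γ ψ x ∂(gibbs V β) = 0)
    {g : E2 → ℝ} (hg : IsPotential g) (α : Fin 2 → ℕ) :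
    γ * (∑ j, (α j : ℝ)) * hermitePairing V β u g α = ∑ j,
      ((√β)⁻¹ * √((α j : ℝ) + 1) *
          hermitePairing V β u (fun q => -partialDeriv j g q) (α + Pi.single j 1) +
        (√β)⁻¹ * √(α j : ℝ) * hermitePairing V β u
          (fun q => -partialDeriv j g q + β * partialDeriv j V q * g q) (α - Pi.single j 1)) := by
  have h := weak_equation_poly hV hβ hu heq hg fun i => hermitePoly β (α i)
  have hgc := hg.continuous
  have hdg := fun j => continuous_partialDeriv hg.smooth j
  have hdV := fun j => continuous_partialDeriv hV.smooth j
  have hbb : √β * √β = β := Real.mul_self_sqrt hβ.le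
  have hb : √β ≠ 0 := by positivity
  have i1 := fun j => (integrable_hermitePairing (𝕜 := ℝ) hV hβ hu
    (F := fun q => -partialDeriv j g q) (by fun_prop) (α + Pi.single j 1)).const_mul
      ((√β)⁻¹ * √((α j : ℝ) + 1))
  have i2 := fun j => (integrable_hermitePairing (𝕜 := ℝ) hV hβ hu
    (F := fun q => -partialDeriv j g q + β * partialDeriv j V q * g q) (by fun_prop)
      (α - Pi.single j 1)).const_mul ((√β)⁻¹ * √(α j : ℝ))
  have i0 := (integrable_hermitePairing (𝕜 := ℝ) hV hβ hu hgc α).const_mul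
    (γ * (∑ j, (α j : ℝ)))
  have i12 := fun j => (i1 j).fun_add (i2 j)
  unfold hermitePairing
  simp only [← integral_const_mul]
  simp only [← integral_add (i1 _) (i2 _)]
  rw [← integral_finsetSum _ fun j _ => i12 j, ← sub_eq_zero, ← neg_eq_zero,
    neg_sub, ← integral_sub (integrable_finsetSum _ fun j _ => i12 j) i0, ← h]
  congr 1
  funext x
  have e1 := fun j => velocity_mul_hermiteFn hβ α j x.2
  have e2 := fun j => tensorPoly_polyDerivAt_hermite β α j x.2
  have e3 := fun j => tensorPoly_ornsteinUhlenbeck hβ α j x.2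
  -- Pointwise decomposition into raised, lowered and diagonal terms. The force term lowers with
  -- coefficient `√β √(α j)`, written as `(√β)⁻¹ β √(α j)` to combine with the lowering part of `p
  -- j`.
  have e4 : ∀ j, -(x.2 j * partialDeriv j g x.1) *
        tensorPoly (fun i => hermitePoly β (α i)) x.2 +
      (g x.1 * partialDeriv j V x.1 - γ * (g x.1 * x.2 j)) *
        tensorPoly (polyDerivAt j fun i => hermitePoly β (α i)) x.2 +
      γ * β⁻¹ * g x.1 *
        tensorPoly (polyDerivAt j (polyDerivAt j fun i => hermitePoly β (α i))) x.2 =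
      -partialDeriv j g x.1 * ((√β)⁻¹ * √((α j : ℝ) + 1) * hermiteFn β (α + Pi.single j 1) x.2 +
        (√β)⁻¹ * √(α j : ℝ) * hermiteFn β (α - Pi.single j 1) x.2) +
      g x.1 * partialDeriv j V x.1 * ((√β)⁻¹ * β * √(α j : ℝ) *
        hermiteFn β (α - Pi.single j 1) x.2) - γ * g x.1 * (α j * hermiteFn β α x.2) := by
    intro j
    rw [← e1 j]
    have : (√β)⁻¹ * β = √β := by
      rw [inv_mul_eq_iff_eq_mul₀ hb, hbb]
    rw [this, ← e2 j]
    have h3 := e3 j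
    simp only [hermiteFn] at h3 ⊢
    linear_combination (γ * g x.1) * h3
  simp only [e4, RCLike.ofReal_real_eq_id, id, Fin.sum_univ_two]
  ring

/-- Since `u` and the operator are real, the complex identity is the real one applied to the real
and imaginary parts of `G`. -/
theorem weak_equation_hermite (hV : IsPotential V) {γ : ℝ} (hβ : 0 < β)
    (hu : MemLp u 2 (gibbs V β))
    (heq : ∀ ψ, IsTestFunction ψ → ∫ x, u x * genAdjoint V β γ ψ x ∂(gibbs V β) = 0)
    {G : E2 → ℂ} (hG : ContDiff ℝ (⊤ : ℕ∞) G)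
    (hper : ∀ (k : Fin 2 → ℤ) q, G (q + latticeVec k) = G q) (α : Fin 2 → ℕ) :
    ((γ * ∑ j, (α j : ℝ) : ℝ) : ℂ) * hermitePairing V β u G α = ∑ j,
      ((((√β)⁻¹ * √((α j : ℝ) + 1) : ℝ) : ℂ) *
          hermitePairing V β u (fun q => -partialDeriv j G q) (α + Pi.single j 1) +
        (((√β)⁻¹ * √(α j : ℝ) : ℝ) : ℂ) * hermitePairing V β u
          (fun q => -partialDeriv j G q + (β * partialDeriv j V q : ℝ) * G q)
            (α - Pi.single j 1)) := by
  have hGc := hG.continuous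
  have hdG := fun j => continuous_partialDeriv hG j
  have hdV := fun j => continuous_partialDeriv hV.smooth j
  have hdiff : ∀ q, HasFDerivAt G (fderiv ℝ G q) q := fun q =>
    (hG.differentiable (by simp) q).hasFDerivAt
  have hre : IsPotential fun q => (G q).re :=
    ⟨Complex.reCLM.contDiff.comp hG, fun k q => by rw [hper]⟩
  have him : IsPotential fun q => (G q).im :=
    ⟨Complex.imCLM.contDiff.comp hG, fun k q => by rw [hper]⟩
  have dre : ∀ j q, partialDeriv j (fun q => (G q).re) q = (partialDeriv j G q).re := by
    intro j q
    have := (Complex.reCLM.hasFDerivAt.comp q (hdiff q)).fderiv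
    unfold partialDeriv
    change fderiv ℝ (⇑Complex.reCLM ∘ G) q _ = _
    rw [this]
    rfl
  have dim : ∀ j q, partialDeriv j (fun q => (G q).im) q = (partialDeriv j G q).im := by
    intro j q
    have := (Complex.imCLM.hasFDerivAt.comp q (hdiff q)).fderiv
    unfold partialDeriv
    change fderiv ℝ (⇑Complex.imCLM ∘ G) q _ = _
    rw [this]
    rfl
  have c1 : ∀ j, Continuous fun q => -partialDeriv j G q := fun j => by fun_prop
  have c2 : ∀ j, Continuous fun q => -partialDeriv j G q + (β * partialDeriv j V q : ℝ) * G q :=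
    fun j => by fun_prop
  have h1 := weak_equation_hermite_real hV hβ hu heq hre α
  have h2 := weak_equation_hermite_real hV hβ hu heq him α
  apply Complex.ext
  · rw [Complex.re_ofReal_mul, hermitePairing_re hV hβ hu hGc, h1, Complex.re_sum]
    refine Finset.sum_congr rfl fun j _ => ?_
    rw [Complex.add_re, Complex.re_ofReal_mul, Complex.re_ofReal_mul,
      hermitePairing_re hV hβ hu (c1 j), hermitePairing_re hV hβ hu (c2 j)]
    simp only [dre, Complex.neg_re, Complex.add_re, Complex.re_ofReal_mul]
  · rw [Complex.im_ofReal_mul, hermitePairing_im hV hβ hu hGc, h2, Complex.im_sum]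
    refine Finset.sum_congr rfl fun j _ => ?_
    rw [Complex.add_im, Complex.im_ofReal_mul, Complex.im_ofReal_mul,
      hermitePairing_im hV hβ hu (c1 j), hermitePairing_im hV hβ hu (c2 j)]
    simp only [dim, Complex.neg_im, Complex.add_im, Complex.im_ofReal_mul]

/-- Pairings may be expanded along absolutely convergent Fourier series. -/
theorem hasSum_hermitePairing (hV : IsPotential V) (hβ : 0 < β) (hu : MemLp u 2 (gibbs V β))
    {F : E2 → ℂ} (hF : Continuous F) {f : E2 → ℝ} {a : (Fin 2 → ℤ) → ℂ}
    (ha : Summable fun l => (1 + ‖l‖) * ‖a l‖)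
    (hf : ∀ q, HasSum (fun l => a l * torusChar l q) (f q)) (α : Fin 2 → ℕ) :
    HasSum (fun l => a l * hermitePairing V β u (fun q => torusChar l q * F q) α)
      (hermitePairing V β u (fun q => f q * F q) α) := by
  have has : Summable fun l => ‖a l‖ :=
    ha.of_nonneg_of_le (fun _ => norm_nonneg _) fun l => by
      nlinarith [norm_nonneg l, norm_nonneg (a l)]
  -- Characters are unimodular, so the termwise `L¹` norms are `‖a l‖` times a constant and sum and
  -- integral may be exchanged.
  have hchar : ∀ l q, ‖torusChar l q‖ = 1 := fun l q => by
    rw [torusChar, mul_comm, Complex.norm_exp_ofReal_mul_I]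
  have hint : ∀ l, Integrable (fun x => a l * ((u x : ℂ) * ((torusChar l x.1 * F x.1) *
      (hermiteFn β α x.2 : ℂ)))) (gibbs V β) := fun l =>
    (integrable_hermitePairing hV hβ hu ((continuous_torusChar l).mul hF) α).const_mul (a l)
  have h := hasSum_integral_of_summable_integral_norm hint (by
    have e : ∀ l, ∫ x, ‖a l * ((u x : ℂ) * ((torusChar l x.1 * F x.1) *
        (hermiteFn β α x.2 : ℂ)))‖ ∂(gibbs V β) =
        ‖a l‖ * ∫ x, ‖(u x : ℂ) * (F x.1 * (hermiteFn β α x.2 : ℂ))‖ ∂(gibbs V β) := by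
      intro l
      rw [← integral_const_mul]
      congr 1
      funext x
      simp only [norm_mul, hchar, one_mul]
    simp only [e]
    exact has.mul_right _)
  simp only [integral_const_mul] at h
  have e : hermitePairing V β u (fun q => f q * F q) α = ∫ x, ∑' l, a l * ((u x : ℂ) *
      ((torusChar l x.1 * F x.1) * (hermiteFn β α x.2 : ℂ))) ∂(gibbs V β) := by
    unfold hermitePairing
    congr 1
    funext x
    have h2 := (hf x.1).mul_left ((u x : ℂ) * (F x.1 * (hermiteFn β α x.2 : ℂ)))
    refine Eq.symm (HasSum.tsum_eq ?_)
    have e2 : (u x : ℂ) * (f x.1 * F x.1 * (hermiteFn β α x.2 : ℂ)) =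
        (u x : ℂ) * (F x.1 * (hermiteFn β α x.2 : ℂ)) * f x.1 := by ring
    refine e2 ▸ h2.congr_fun fun l => ?_
    ring
  rw [e]
  exact h

end Pairing

/-! ### Fourier-Hermite modes, Bessel's inequality and the Liouville property -/

/-- The Fourier modes, weighted by the square root of the inverse Gibbs density. -/
def posMode (V : E2 → ℝ) (β : ℝ) (k : Fin 2 → ℤ) (q : E2) : ℂ :=
  Real.exp (β / 2 * V q) * torusChar (-k) q

theorem torusChar_add (k l : Fin 2 → ℤ) (q : E2) :
    torusChar (k + l) q = torusChar k q * torusChar l q := by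
  simp only [torusChar, intDot, ← Complex.exp_add, ← mul_add]
  congr 2
  simp only [Pi.add_apply, Fin.sum_univ_two]
  push_cast
  ring

/-- Multiplication by a function of the position thereby acts on mode coefficients as convolution
with its Fourier coefficients. -/
theorem torusChar_mul_posMode (V : E2 → ℝ) (β : ℝ) (k l : Fin 2 → ℤ) (q : E2) :
    torusChar l q * posMode V β k q = posMode V β (k - l) q := by
  rw [posMode, posMode, neg_sub, sub_eq_add_neg, torusChar_add]
  ring

theorem conj_torusChar (k : Fin 2 → ℤ) (q : E2) :
    (starRingEnd ℂ) (torusChar k q) = torusChar (-k) q := by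
  unfold torusChar
  rw [← Complex.exp_conj]
  congr 1
  simp [intDot]
  ring

theorem contDiff_torusChar (k : Fin 2 → ℤ) : ContDiff ℝ (⊤ : ℕ∞) (torusChar k) := by
  unfold torusChar
  refine ContDiff.cexp (contDiff_const.mul (Complex.ofRealCLM.contDiff.comp ?_))
  exact ContDiff.sum (𝕜 := ℝ) (s := Finset.univ)
    (f := fun (j : Fin 2) (q : E2) => (k j : ℝ) * q j)
    fun i _ => contDiff_const.mul (contDiff_coord i)

theorem torusChar_periodic (k n : Fin 2 → ℤ) (q : E2) :
    torusChar k (q + latticeVec n) = torusChar k q := by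
  unfold torusChar
  rw [Complex.exp_eq_exp_iff_exists_int]
  refine ⟨∑ j, k j * n j, ?_⟩
  simp only [intDot, Fin.sum_univ_two, PiLp.add_apply, latticeVec]
  push_cast
  ring

theorem contDiff_posMode {V : E2 → ℝ} (hV : IsPotential V) (β : ℝ) (k : Fin 2 → ℤ) :
    ContDiff ℝ (⊤ : ℕ∞) (posMode V β k) :=
  (Complex.ofRealCLM.contDiff.comp (contDiff_const.mul hV.smooth).exp).mul (contDiff_torusChar _)

theorem posMode_periodic {V : E2 → ℝ} (hV : IsPotential V) (β : ℝ) (k n : Fin 2 → ℤ) (q : E2) :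
    posMode V β k (q + latticeVec n) = posMode V β k q := by
  rw [posMode, torusChar_periodic, hV.periodic, posMode]

/-- The weight `e^{βV/2}` splits the force evenly: `-∂ⱼ` becomes `i kⱼ - (β/2) ∂ⱼV`, and `-∂ⱼ + β
∂ⱼV` becomes `i kⱼ + (β/2) ∂ⱼV`. With this choice the raising and lowering parts are negative
adjoints of each other. -/
theorem partialDeriv_posMode {V : E2 → ℝ} (hV : IsPotential V) (β : ℝ) (k : Fin 2 → ℤ)
    (j : Fin 2) (q : E2) : partialDeriv j (posMode V β k) q =
      ((β / 2 * partialDeriv j V q : ℝ) - Complex.I * k j) * posMode V β k q := by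
  have h1 := (hV.smooth.differentiable (by simp) q).hasFDerivAt
  have h2 : ∀ i, HasFDerivAt (fun q : E2 => q i) (EuclideanSpace.proj i : E2 →L[ℝ] ℝ) q :=
    fun i => (EuclideanSpace.proj i : E2 →L[ℝ] ℝ).hasFDerivAt
  have h3 := Complex.ofRealCLM.hasFDerivAt.comp q (h1.const_mul (β / 2))
  have h4 := Complex.ofRealCLM.hasFDerivAt.comp q
    (((h2 0).const_mul (k 0 : ℝ)).fun_add ((h2 1).const_mul (k 1 : ℝ)))
  have h5 := (h3.fun_sub (h4.const_mul Complex.I)).cexp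
  have e : posMode V β k = fun q => Complex.exp ((Complex.ofRealCLM ∘ fun y => β / 2 * V y) q -
      Complex.I * (Complex.ofRealCLM ∘ fun y : E2 => (k 0 : ℝ) * y 0 + (k 1 : ℝ) * y 1) q) := by
    funext q
    simp only [posMode, torusChar, intDot, Function.comp, Complex.ofRealCLM_apply,
      Complex.ofReal_exp, ← Complex.exp_add, Fin.sum_univ_two, Pi.neg_apply]
    congr 1
    push_cast
    ring
  rw [partialDeriv, e, h5.fderiv]
  fin_cases j <;> simp [partialDeriv] <;> ring

variable {V : E2 → ℝ} {β : ℝ} {u : Phase → ℝ}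

/-- The function on phase space attached to a mode. -/
def modeFn (V : E2 → ℝ) (β : ℝ) (x : Mode) (y : Phase) : ℂ :=
  posMode V β x.2 y.1 * (hermiteFn β x.1 y.2 : ℂ)

theorem integral_hermiteFn_mul (hβ : 0 < β) (α α' : Fin 2 → ℕ) :
    ∫ p, ((hermiteFn β α p : ℂ) * (hermiteFn β α' p : ℂ)) ∂(velWeight β) =
      if α = α' then (gaussMass β : ℂ) ^ 2 else 0 := by
  have h := integral_velWeight (𝕜 := ℝ) β fun i x =>
    (hermitePoly β (α i)).eval x * (hermitePoly β (α' i)).eval x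
  have e : ∀ p : E2, ((hermiteFn β α p : ℂ) * (hermiteFn β α' p : ℂ)) =
      ((∏ i, ((hermitePoly β (α i)).eval (p i) * (hermitePoly β (α' i)).eval (p i)) : ℝ) : ℂ) := by
    intro p
    rw [← Complex.ofReal_mul, hermiteFn, hermiteFn, tensorPoly, tensorPoly, Finset.prod_mul_distrib]
  simp only [e]
  rw [integral_complex_ofReal, h]
  simp only [RCLike.ofReal_real_eq_id, id, integral_hermitePoly_mul hβ, Fin.prod_univ_two]
  by_cases h0 : α 0 = α' 0
  · by_cases h1 : α 1 = α' 1
    · have : α = α' := by ext i; fin_cases i <;> assumption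
      simp [this, sq]
    · have : α ≠ α' := fun h => h1 (by simp [h])
      simp [h1, this]
  · have : α ≠ α' := fun h => h0 (by simp [h])
    simp [h0, this]

/-- The two factors `e^{βV/2}` cancel the position density, leaving characters on the cell with
Lebesgue measure and Hermite functions under the Gaussian. -/
theorem integral_conj_modeFn_mul (hV : IsPotential V) (hβ : 0 < β) (x y : Mode) :
    ∫ z, (starRingEnd ℂ) (modeFn V β x z) * modeFn V β y z ∂(gibbs V β) =
      if x = y then ((gibbsNorm V β * ((2 * Real.pi) ^ 2 * gaussMass β ^ 2) : ℝ) : ℂ) else 0 := by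
  have e : ∀ z, (starRingEnd ℂ) (modeFn V β x z) * modeFn V β y z =
      (Real.exp (β * V z.1) * torusChar (x.2 - y.2) z.1) *
        ((hermiteFn β x.1 z.2 : ℂ) * (hermiteFn β y.1 z.2 : ℂ)) := by
    intro z
    simp only [modeFn, posMode, map_mul, Complex.conj_ofReal, conj_torusChar, neg_neg]
    rw [sub_eq_add_neg, torusChar_add]
    have : Real.exp (β * V z.1) = Real.exp (β / 2 * V z.1) * Real.exp (β / 2 * V z.1) := by
      rw [← Real.exp_add]; congr 1; ring
    rw [this]
    push_cast
    ring
  simp only [e]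
  rw [integral_gibbs_mul (𝕜 := ℂ) hV hβ
    (fun q => Real.exp (β * V q) * torusChar (x.2 - y.2) q)
    (fun p => (hermiteFn β x.1 p : ℂ) * (hermiteFn β y.1 p : ℂ)),
    integral_hermiteFn_mul hβ, integral_posWeight hV]
  have e2 : ∀ q, Real.exp (-β * V q) • ((Real.exp (β * V q) : ℂ) * torusChar (x.2 - y.2) q) =
      torusChar (x.2 - y.2) q := by
    intro q
    rw [RCLike.real_smul_eq_coe_mul, ← mul_assoc]
    have : Real.exp (-β * V q) * Real.exp (β * V q) = 1 := by
      rw [← Real.exp_add]; simp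
    have h2 : ((Real.exp (-β * V q) : ℝ) : ℂ) * ((Real.exp (β * V q) : ℝ) : ℂ) = 1 := by
      rw [← Complex.ofReal_mul, this, Complex.ofReal_one]
    change ((Real.exp (-β * V q) : ℝ) : ℂ) * ((Real.exp (β * V q) : ℝ) : ℂ) * _ = _
    rw [h2, one_mul]
  simp only [e2, integral_cell_torusChar, sub_eq_zero]
  obtain ⟨α, k⟩ := x
  obtain ⟨α', k'⟩ := y
  simp only [Prod.mk.injEq]
  by_cases h1 : α = α' <;> by_cases h2 : k = k' <;> simp [h1, h2]

theorem memLp_modeFn (hV : IsPotential V) (hβ : 0 < β) (x : Mode) :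
    MemLp (modeFn V β x) 2 (gibbs V β) := by
  have hc := (contDiff_posMode hV β x.2).continuous
  have h := memLp_two_gibbs hV hβ hc.norm fun i => hermitePoly β (x.1 i)
  have hh : Continuous (hermiteFn β x.1) := continuous_tensorPoly _
  refine h.of_le (Continuous.aestronglyMeasurable ?_) (Eventually.of_forall fun z => ?_)
  · unfold modeFn
    fun_prop
  · simp only [modeFn, norm_mul, Complex.norm_real, norm_norm, hermiteFn, tensorPoly]
    rfl

/-- Bessel's inequality in the Fourier--Hermite basis. -/
theorem summable_sq_norm_hermitePairing (hV : IsPotential V) (hβ : 0 < β)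
    (hu : MemLp u 2 (gibbs V β)) :
    Summable fun x : Mode => ‖hermitePairing V β u (posMode V β x.2) x.1‖ ^ 2 := by
  set κ : ℝ := gibbsNorm V β * ((2 * Real.pi) ^ 2 * gaussMass β ^ 2) with hκ
  have hκ0 : 0 < κ := by
    have h1 := gibbsNorm_pos hV hβ
    have h2 := gaussMass_pos hβ
    positivity
  have huC : MemLp (fun x => (u x : ℂ)) 2 (gibbs V β) := hu.ofReal
  set v : Mode → Lp ℂ 2 (gibbs V β) := fun x =>
    ((√κ)⁻¹ : ℂ) • (memLp_modeFn hV hβ x).toLp (modeFn V β x) with hv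
  have hinner : ∀ (f g : Phase → ℂ) (hf : MemLp f 2 (gibbs V β)) (hg : MemLp g 2 (gibbs V β)),
      inner ℂ (hf.toLp f) (hg.toLp g) = ∫ z, (starRingEnd ℂ) (f z) * g z ∂(gibbs V β) := by
    intro f g hf hg
    rw [L2.inner_def]
    refine integral_congr_ae ?_
    filter_upwards [hf.coeFn_toLp, hg.coeFn_toLp] with z h1 h2
    rw [h1, h2, RCLike.inner_apply, mul_comm]
  have horth : Orthonormal ℂ v := by
    rw [orthonormal_iff_ite]
    intro x y
    simp only [hv, inner_smul_left, inner_smul_right, hinner, integral_conj_modeFn_mul hV hβ,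
      ← hκ]
    split_ifs with h
    · have h1 : ((√κ : ℝ) : ℂ) ≠ 0 := by
        exact_mod_cast (Real.sqrt_pos.mpr hκ0).ne'
      have h2 : ((√κ : ℝ) : ℂ) * (√κ : ℝ) = κ := by
        rw [← Complex.ofReal_mul, Real.mul_self_sqrt hκ0.le]
      rw [map_inv₀, Complex.conj_ofReal, ← h2]
      field_simp
    · simp
  have h := (horth.inner_products_summable (x := huC.toLp _)).mul_left κ
  refine h.congr fun x => ?_
  simp only [hv, inner_smul_left, hinner]
  have e : ∫ z, (starRingEnd ℂ) (modeFn V β x z) * (u z : ℂ) ∂(gibbs V β) =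
      (starRingEnd ℂ) (hermitePairing V β u (posMode V β x.2) x.1) := by
    unfold hermitePairing
    rw [← integral_conj]
    congr 1
    funext z
    simp only [modeFn, map_mul, Complex.conj_ofReal, Complex.coe_algebraMap]
    ring
  rw [e, norm_mul, RCLike.norm_conj, RCLike.norm_conj, norm_inv, Complex.norm_real,
    Real.norm_eq_abs, abs_of_nonneg (Real.sqrt_nonneg _), mul_pow, inv_pow, Real.sq_sqrt hκ0.le]
  field_simp

theorem IsPotential.partialDeriv (hV : IsPotential V) (c : ℝ) (j : Fin 2) :
    IsPotential fun q => c * partialDeriv j V q where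
  smooth := contDiff_const.mul
    ((hV.smooth.fderiv_right (m := (⊤ : ℕ∞)) (by norm_cast)).clm_apply contDiff_const)
  periodic k q := by
    unfold Langevin.partialDeriv
    rw [← fderiv_comp_add_right]
    congr 3
    funext y
    exact hV.periodic k y

/-- A square-integrable weak solution of the stationary equation `L u = 0` has no component along
the velocities. -/
theorem integral_mul_velocity_eq_zero (hV : IsPotential V) {γ : ℝ} (hβ : 0 < β) (hγ : 0 < γ)
    (hu : MemLp u 2 (gibbs V β))
    (heq : ∀ ψ, IsTestFunction ψ → ∫ x, u x * genAdjoint V β γ ψ x ∂(gibbs V β) = 0) (j : Fin 2) :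
    ∫ x, u x * x.2 j ∂(gibbs V β) = 0 := by
  choose b hbc hbs hb using fun j => exists_fourier_expansion (hV.partialDeriv (β / 2) j)
  have hcont : ∀ k, Continuous (posMode V β k) := fun k => (contDiff_posMode hV β k).continuous
  have hW : ∀ j, Continuous fun q => β / 2 * partialDeriv j V q := fun j =>
    (hV.partialDeriv (β / 2) j).continuous
  have hWp : ∀ j k α, hermitePairing V β u
      (fun q => ((β / 2 * partialDeriv j V q : ℝ) : ℂ) * posMode V β k q) α =
      ∑' l, b j l * hermitePairing V β u (posMode V β (k - l)) α := by
    intro j k α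
    have h := hasSum_hermitePairing hV hβ hu (hcont k) (hbs j) (hb j) α
    simp only [torusChar_mul_posMode] at h
    exact h.tsum_eq.symm
  -- Here `b j` is the Fourier series of `(β/2) ∂ⱼV`. It is real, hence the conjugation symmetry,
  -- and smooth, hence the weighted summability.
  have hzero := mode_coeff_eq_zero hγ (√β)⁻¹ b hbc hbs
    (fun x => hermitePairing V β u (posMode V β x.2) x.1)
    (summable_sq_norm_hermitePairing hV hβ hu) (by
      intro α k
      rw [weak_equation_hermite hV hβ hu heq (contDiff_posMode hV β k)
        (fun n q => posMode_periodic hV β k n q) α]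
      refine Finset.sum_congr rfl fun j _ => ?_
      have c1 : Continuous fun q => (Complex.I * (k j : ℂ)) * posMode V β k q :=
        continuous_const.mul (hcont k)
      have c2 : Continuous fun q =>
          ((β / 2 * partialDeriv j V q : ℝ) : ℂ) * posMode V β k q :=
        (Complex.continuous_ofReal.comp (hW j)).mul (hcont k)
      have c3 : Continuous fun q =>
          (-1 : ℂ) * (((β / 2 * partialDeriv j V q : ℝ) : ℂ) * posMode V β k q) :=
        continuous_const.mul c2
      have e1 : (fun q => -partialDeriv j (posMode V β k) q) = fun q =>
          (Complex.I * (k j : ℂ)) * posMode V β k q +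
            (-1 : ℂ) * (((β / 2 * partialDeriv j V q : ℝ) : ℂ) * posMode V β k q) := by
        funext q
        rw [partialDeriv_posMode hV]
        ring
      have e2 : (fun q => -partialDeriv j (posMode V β k) q +
          ((β * partialDeriv j V q : ℝ) : ℂ) * posMode V β k q) = fun q =>
          (Complex.I * (k j : ℂ)) * posMode V β k q +
            ((β / 2 * partialDeriv j V q : ℝ) : ℂ) * posMode V β k q := by
        funext q
        rw [partialDeriv_posMode hV]
        push_cast
        ring
      rw [e2, e1, hermitePairing_add hV hβ hu c1 c3, hermitePairing_add hV hβ hu c1 c2,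
        hermitePairing_const_mul, hermitePairing_const_mul, hermitePairing_const_mul, hWp, hWp]
      ring)
  -- Undo the weight: `e^{-βV/2}` times the zero mode is `1`, so expanding `e^{-βV/2}` writes `√β ∫
  -- u pⱼ dμ` as a series of coefficients of Hermite index `Pi.single j 1`, all of which vanish.
  obtain ⟨a, -, has, ha⟩ := exists_fourier_expansion (f := fun q => Real.exp (-(β / 2) * V q))
    ⟨(contDiff_const.mul hV.smooth).exp, fun k q => by rw [hV.periodic]⟩
  have hs := hasSum_hermitePairing hV hβ hu (hcont 0) has ha (Pi.single j 1)
  have hne : (Pi.single j 1 : Fin 2 → ℕ) ≠ 0 := by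
    intro h
    simpa using congrFun h j
  simp only [torusChar_mul_posMode] at hs
  have hz : ∀ k, hermitePairing V β u (posMode V β k) (Pi.single j 1) = 0 := fun k =>
    hzero _ k hne
  simp only [hz, mul_zero] at hs
  have h0 := hs.unique hasSum_zero
  have hpos : √β ≠ 0 := by positivity
  have hh : ∀ p : E2, hermiteFn β (Pi.single j 1) p = √β * p j := by
    intro p
    fin_cases j <;> simp [hermiteFn, tensorPoly, hermitePoly_zero, hermitePoly_one]
  have e : ∀ x : Phase, (u x : ℂ) * ((Real.exp (-(β / 2) * V x.1) : ℝ) * posMode V β 0 x.1 *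
      (hermiteFn β (Pi.single j 1) x.2 : ℂ)) = ((√β * (u x * x.2 j) : ℝ) : ℂ) := by
    intro x
    have h1 : Real.exp (-(β / 2) * V x.1) * Real.exp (β / 2 * V x.1) = 1 := by
      rw [← Real.exp_add]; simp
    have h2 : ((Real.exp (-(β / 2) * V x.1) : ℝ) : ℂ) * ((Real.exp (β / 2 * V x.1) : ℝ) : ℂ) = 1 := by
      rw [← Complex.ofReal_mul, h1, Complex.ofReal_one]
    have h3 : torusChar (-0) x.1 = 1 := by simp [torusChar, intDot]
    rw [posMode, h3, hh, mul_one, h2]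
    push_cast
    ring
  have h4 : ∫ x, ((√β * (u x * x.2 j) : ℝ) : ℂ) ∂(gibbs V β) = 0 := by
    rw [← h0]
    unfold hermitePairing
    congr 1
    funext x
    exact (e x).symm
  rw [integral_complex_ofReal, integral_const_mul, Complex.ofReal_eq_zero] at h4
  exact (mul_eq_zero.mp h4).resolve_left hpos

/-! ### Symmetries acting on the Gibbs measure and on the generator -/

/-- An involutive symmetry `q ↦ R q + c` of the torus that preserves the potential, where `R` is a
signed permutation of the coordinates. -/
structure TorusSymmetry (V : E2 → ℝ) where
  /-- the linear part -/
  R : E2 ≃ₗᵢ[ℝ] E2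
  /-- the translation part -/
  c : E2
  /-- the permutation of the coordinates -/
  τ : Equiv.Perm (Fin 2)
  /-- the signs -/
  s : Fin 2 → ℝ
  sign : ∀ j, s j = 1 ∨ s j = -1
  apply : ∀ p j, R p j = s j * p (τ j)
  involutive_linear : ∀ p, R (R p) = p
  involutive : ∀ q, R (R q + c) + c = q
  lattice : ∀ k, ∃ l, R (latticeVec k) = latticeVec l
  cell : (fun q => R q + c) ⁻¹' cell =ᵐ[volume] cell
  potential : ∀ q, V (R q + c) = V q

namespace TorusSymmetry

variable {V : E2 → ℝ} (T : TorusSymmetry V)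

/-- The action of a symmetry on phase space. -/
def phase : Phase ≃ᵐ Phase where
  toFun x := (T.R x.1 + T.c, T.R x.2)
  invFun x := (T.R x.1 + T.c, T.R x.2)
  left_inv x := by simp only [T.involutive, T.involutive_linear]
  right_inv x := by simp only [T.involutive, T.involutive_linear]
  measurable_toFun := by
    have := T.R.continuous
    exact Continuous.measurable (f := fun x : Phase => (T.R x.1 + T.c, T.R x.2)) (by fun_prop)
  measurable_invFun := by
    have := T.R.continuous
    exact Continuous.measurable (f := fun x : Phase => (T.R x.1 + T.c, T.R x.2)) (by fun_prop)

theorem phase_apply (x : Phase) : T.phase x = (T.R x.1 + T.c, T.R x.2) := rfl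

theorem phase_phase (x : Phase) : T.phase (T.phase x) = x := T.phase.left_inv x

end TorusSymmetry

theorem measurePreserving_withDensity {α β : Type*} [MeasurableSpace α] [MeasurableSpace β]
    {μ : Measure α} {ν : Measure β} {f : α → β} (hf : MeasurePreserving f μ ν) {g : β → ℝ≥0∞}
    (hg : Measurable g) : MeasurePreserving f (μ.withDensity (g ∘ f)) (ν.withDensity g) := by
  refine ⟨hf.measurable, ?_⟩
  ext s hs
  rw [Measure.map_apply hf.measurable hs, withDensity_apply _ (hf.measurable hs),
    withDensity_apply _ hs]
  exact hf.setLIntegral_comp_preimage hs hg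

namespace TorusSymmetry

variable {V : E2 → ℝ} (T : TorusSymmetry V)

theorem measurePreserving_posWeight (hV : IsPotential V) (β : ℝ) :
    MeasurePreserving (fun q => T.R q + T.c) (posWeight V β) (posWeight V β) := by
  have h1 : MeasurePreserving (fun q => T.R q + T.c) (volume : Measure E2) volume :=
    (measurePreserving_add_right volume T.c).comp T.R.measurePreserving
  have h2 := h1.restrict_preimage measurableSet_cell
  rw [Measure.restrict_congr_set T.cell] at h2
  have h3 := measurePreserving_withDensity h2 (measurable_posDensity hV β)
  have e : (fun q : E2 => ENNReal.ofReal (Real.exp (-β * V q))) ∘ (fun q => T.R q + T.c) =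
      fun q => ENNReal.ofReal (Real.exp (-β * V q)) := by
    funext q
    simp only [Function.comp, T.potential]
  rw [e] at h3
  exact h3

theorem measurePreserving_velWeight (β : ℝ) :
    MeasurePreserving (fun p => T.R p) (velWeight β) (velWeight β) := by
  have h3 := measurePreserving_withDensity (T.R.measurePreserving) (measurable_velDensity β)
  have e : (fun p : E2 => ENNReal.ofReal (∏ i, gaussWeight β (p i))) ∘ T.R =
      fun p => ENNReal.ofReal (∏ i, gaussWeight β (p i)) := by
    funext p
    simp only [Function.comp, prod_gaussWeight, LinearIsometryEquiv.norm_map]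
  rw [e] at h3
  exact h3

theorem measurePreserving_gibbs (hV : IsPotential V) {β : ℝ} (hβ : 0 < β) :
    MeasurePreserving T.phase (gibbs V β) (gibbs V β) := by
  have : Fact (0 < β) := ⟨hβ⟩
  have := isFiniteMeasure_posWeight hV β
  have h := (T.measurePreserving_posWeight hV β).prod (T.measurePreserving_velWeight β)
  unfold gibbs
  refine MeasurePreserving.smul_measure (c := (gibbsWeight V β Set.univ)⁻¹) ?_
  rw [gibbsWeight_eq_prod hV]
  exact h

theorem gradient_apply_symm (hV : IsPotential V) (q : E2) :
    gradient V (T.R q + T.c) = T.R (gradient V q) := by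
  have hd : Differentiable ℝ V := hV.smooth.differentiable (by simp)
  have h1 : HasFDerivAt (fun q => T.R q + T.c) (T.R : E2 →L[ℝ] E2) q :=
    (T.R : E2 →L[ℝ] E2).hasFDerivAt.add_const T.c
  have h2 := ((hd (T.R q + T.c)).hasFDerivAt.comp q h1).fderiv
  have e : V ∘ (fun q => T.R q + T.c) = V := funext T.potential
  rw [e] at h2
  refine ext_inner_right ℝ fun v => ?_
  have h3 : ∀ q v, inner ℝ (gradient V q) v = fderiv ℝ V q v := fun q v => by
    rw [gradient, InnerProductSpace.toDual_symm_apply]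
  -- An orthogonal involution is self-adjoint.
  have h4 : inner ℝ (T.R (gradient V q)) v = inner ℝ (gradient V q) (T.R v) := by
    rw [← T.R.inner_map_map (gradient V q), T.involutive_linear]
  rw [h4, h3, h3, h2]
  simp [T.involutive_linear]

end TorusSymmetry

/-- The Laplacian may be computed in any orthonormal basis: use the standard one on the left and its
image under `R` on the right. -/
theorem laplacian_comp_linearIsometryEquiv {f : E2 → ℝ} (hf : ContDiff ℝ (⊤ : ℕ∞) f)
    (R : E2 ≃ₗᵢ[ℝ] E2) (p : E2) :
    Laplacian.laplacian (fun p => f (R p)) p = Laplacian.laplacian f (R p) := by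
  rw [InnerProductSpace.laplacian_eq_iteratedFDeriv_orthonormalBasis _
      (EuclideanSpace.basisFun (Fin 2) ℝ),
    InnerProductSpace.laplacian_eq_iteratedFDeriv_orthonormalBasis f
      ((EuclideanSpace.basisFun (Fin 2) ℝ).map R)]
  refine Finset.sum_congr rfl fun i _ => ?_
  have h := (R : E2 →L[ℝ] E2).iteratedFDeriv_comp_right hf p (i := 2)
    (WithTop.coe_le_coe.2 (le_top : (2 : ℕ∞) ≤ ⊤))
  change iteratedFDeriv ℝ 2 (f ∘ (R : E2 →L[ℝ] E2)) p _ = _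
  rw [h]
  simp only [ContinuousMultilinearMap.compContinuousLinearMap_apply]
  congr 1
  funext m
  fin_cases m <;> simp

/-- Expresses the partial Laplacian through derivatives on the whole phase space, so that its joint
continuity and its locality in `(q, p)` can be read off. -/
theorem laplacian_slice {ψ : Phase → ℝ} (hψ : ContDiff ℝ (⊤ : ℕ∞) ψ) (x : Phase) :
    Laplacian.laplacian (fun p => ψ (x.1, p)) x.2 =
      ∑ j : Fin 2, fderiv ℝ (fun y => fderiv ℝ ψ y (0, EuclideanSpace.basisFun (Fin 2) ℝ j)) x
        (0, EuclideanSpace.basisFun (Fin 2) ℝ j) := by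
  obtain ⟨q, p⟩ := x
  have hslice : ∀ {F : Phase → ℝ}, Differentiable ℝ F → ∀ p v,
      fderiv ℝ (fun p => F (q, p)) p v = fderiv ℝ F (q, p) (0, v) := by
    intro F hF p v
    have h := ((hF (q, p)).hasFDerivAt.comp p (hasFDerivAt_prodMk_right q p)).fderiv
    change fderiv ℝ (F ∘ fun p => (q, p)) p v = _
    rw [h]
    simp
  have hd : ∀ w : Phase, ContDiff ℝ (⊤ : ℕ∞) fun y => fderiv ℝ ψ y w := fun w =>
    (hψ.fderiv_right (m := (⊤ : ℕ∞)) (by simp)).clm_apply contDiff_const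
  have hc : ContDiff ℝ (⊤ : ℕ∞) fun p => ψ (q, p) := hψ.comp (contDiff_const.prodMk contDiff_id)
  rw [InnerProductSpace.laplacian_eq_iteratedFDeriv_orthonormalBasis _
      (EuclideanSpace.basisFun (Fin 2) ℝ)]
  refine Finset.sum_congr rfl fun j _ => ?_
  rw [iteratedFDeriv_two_apply]
  simp only [Matrix.cons_val_zero, Matrix.cons_val_one]
  set e := EuclideanSpace.basisFun (Fin 2) ℝ j
  have h1 : fderiv ℝ (fun p => fderiv ℝ (fun p => ψ (q, p)) p e) p e =
      fderiv ℝ (fderiv ℝ fun p => ψ (q, p)) p e e := by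
    rw [fderiv_clm_apply ((hc.fderiv_right (m := (⊤ : ℕ∞)) (by simp)).differentiable (by simp) p)
      (differentiableAt_const e)]
    simp
  rw [← h1, ← hslice ((hd _).differentiable (by simp))]
  simp only [hslice (hψ.differentiable (by simp))]

theorem continuous_gradient {V : E2 → ℝ} (hV : IsPotential V) : Continuous (gradient V) := by
  have := hV.smooth.continuous_fderiv (by simp)
  unfold gradient
  fun_prop

theorem continuous_genAdjoint {V : E2 → ℝ} (hV : IsPotential V) (β γ : ℝ) {ψ : Phase → ℝ}
    (hψ : ContDiff ℝ (⊤ : ℕ∞) ψ) : Continuous (genAdjoint V β γ ψ) := by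
  have h1 := hψ.continuous_fderiv (by simp)
  have h2 := continuous_gradient hV
  have hd : ∀ w : Phase, ContDiff ℝ (⊤ : ℕ∞) fun y => fderiv ℝ ψ y w := fun w =>
    (hψ.fderiv_right (m := (⊤ : ℕ∞)) (by simp)).clm_apply contDiff_const
  have h3 := fun w => (hd w).continuous_fderiv (by simp)
  unfold genAdjoint genHam genFD
  simp only [laplacian_slice hψ]
  fun_prop

theorem ae_gibbs_mem_cell (V : E2 → ℝ) (β : ℝ) : ∀ᵐ x ∂(gibbs V β), x.1 ∈ cell := by
  refine Measure.ae_smul_measure ?_ _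
  refine (withDensity_absolutelyContinuous _ _).ae_le ?_
  filter_upwards [ae_restrict_mem (measurableSet_cell.prod MeasurableSet.univ)] with x hx
  exact hx.1

/-- The formal adjoint maps test functions to square integrable functions. -/
theorem memLp_genAdjoint {V : E2 → ℝ} {β γ : ℝ} (hV : IsPotential V) (hβ : 0 < β) {ψ : Phase → ℝ}
    (hψ : IsTestFunction ψ) : MemLp (genAdjoint V β γ ψ) 2 (gibbs V β) := by
  have := isProbabilityMeasure_gibbs hV hβ
  have hc := continuous_genAdjoint hV β γ hψ.smooth
  obtain ⟨R, hR⟩ := hψ.support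
  obtain ⟨K, hK, hcK⟩ := exists_isCompact_cell_subset
  obtain ⟨C, hC⟩ := (hK.prod (isCompact_closedBall (0 : E2) R)).exists_bound_of_continuousOn
    hc.continuousOn
  refine MemLp.of_bound hc.aestronglyMeasurable (max C 0) ?_
  filter_upwards [ae_gibbs_mem_cell V β] with x hx
  by_cases h : ‖x.2‖ ≤ R
  · exact (hC x ⟨hcK hx, by simpa using h⟩).trans (le_max_left _ _)
  · have hz : ψ =ᶠ[𝓝 x] fun _ => 0 := by
      have ho : IsOpen {y : Phase | R < ‖y.2‖} := isOpen_lt continuous_const (by fun_prop)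
      filter_upwards [ho.mem_nhds (not_le.1 h)] with y hy using hR _ _ hy
    have hz' := hz.eventuallyEq_nhds
    have h0 : fderiv ℝ ψ x = 0 := by rw [hz.fderiv_eq]; simp
    have h1 : ∀ w : Phase, (fun y => fderiv ℝ ψ y w) =ᶠ[𝓝 x] fun _ => 0 := fun w => by
      filter_upwards [hz'] with y hy
      rw [hy.fderiv_eq]; simp
    have h2 : genAdjoint V β γ ψ x = 0 := by
      simp only [genAdjoint, genHam, genFD, laplacian_slice hψ.smooth, h0, (h1 _).fderiv_eq]
      simp
    rw [h2]
    simp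

/-! ### Equivariance of solutions of the Poisson equation -/

namespace TorusSymmetry

variable {V : E2 → ℝ} (T : TorusSymmetry V)

theorem contDiff_phase : ContDiff ℝ (⊤ : ℕ∞) T.phase := by
  have h := (T.R : E2 →L[ℝ] E2).contDiff (n := (⊤ : ℕ∞))
  exact ((h.comp contDiff_fst).add contDiff_const).prodMk (h.comp contDiff_snd)

theorem isTestFunction_comp {ψ : Phase → ℝ} (hψ : IsTestFunction ψ) :
    IsTestFunction (fun x => ψ (T.phase x)) where
  smooth := hψ.smooth.comp T.contDiff_phase
  periodic k q p := by
    obtain ⟨l, hl⟩ := T.lattice k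
    simp only [phase_apply, map_add, hl]
    rw [add_right_comm, hψ.periodic]
  support := by
    obtain ⟨R, hR⟩ := hψ.support
    exact ⟨R, fun q p hp => hR _ _ (by simpa using hp)⟩

/-- The same `R` acts on positions and velocities, which preserves `p · ∇_q`; the gradient of `V` is
equivariant; and the Laplacian in `p` is invariant under isometries. -/
theorem genAdjoint_comp (hV : IsPotential V) (β γ : ℝ) {ψ : Phase → ℝ}
    (hψ : ContDiff ℝ (⊤ : ℕ∞) ψ) (x : Phase) :
    genAdjoint V β γ (fun x => ψ (T.phase x)) x = genAdjoint V β γ ψ (T.phase x) := by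
  obtain ⟨q, p⟩ := x
  have h1 : HasFDerivAt T.phase ((T.R : E2 →L[ℝ] E2).prodMap (T.R : E2 →L[ℝ] E2)) (q, p) := by
    have a1 : HasFDerivAt (fun x : Phase => T.R x.1 + T.c)
        ((T.R : E2 →L[ℝ] E2).comp (ContinuousLinearMap.fst ℝ E2 E2)) (q, p) :=
      ((T.R : E2 →L[ℝ] E2).hasFDerivAt.comp (q, p) hasFDerivAt_fst).add_const T.c
    have a2 : HasFDerivAt (fun x : Phase => T.R x.2)
        ((T.R : E2 →L[ℝ] E2).comp (ContinuousLinearMap.snd ℝ E2 E2)) (q, p) :=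
      (T.R : E2 →L[ℝ] E2).hasFDerivAt.comp (q, p) hasFDerivAt_snd
    exact a1.prodMk a2
  have h2 := ((hψ.differentiable (by simp) (T.phase (q, p))).hasFDerivAt.comp (q, p) h1).fderiv
  have hfd : ∀ v w, fderiv ℝ (fun x => ψ (T.phase x)) (q, p) (v, w) =
      fderiv ℝ ψ (T.phase (q, p)) (T.R v, T.R w) := by
    intro v w
    change fderiv ℝ (ψ ∘ T.phase) (q, p) (v, w) = _
    rw [h2]
    rfl
  have hlap : Laplacian.laplacian (fun p => ψ (T.phase (q, p))) p =
      Laplacian.laplacian (fun p => ψ ((T.phase (q, p)).1, p)) (T.R p) := by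
    have hc : ContDiff ℝ (⊤ : ℕ∞) fun p => ψ (T.R q + T.c, p) :=
      hψ.comp (contDiff_const.prodMk contDiff_id)
    exact laplacian_comp_linearIsometryEquiv hc T.R p
  simp only [genAdjoint, genHam, genFD, hfd, hlap]
  simp only [phase_apply, T.gradient_apply_symm hV, map_neg, map_zero]

theorem integral_comp_phase (hV : IsPotential V) {β : ℝ} (hβ : 0 < β) (f : Phase → ℝ) :
    ∫ x, f (T.phase x) ∂(gibbs V β) = ∫ x, f x ∂(gibbs V β) :=
  (T.measurePreserving_gibbs hV hβ).integral_comp' f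

/-- The matrix of a Poisson solution transforms equivariantly under a symmetry. -/
theorem poisson_equivariant (hV : IsPotential V) {β γ : ℝ} (hβ : 0 < β) (hγ : 0 < γ)
    {φ : Fin 2 → Phase → ℝ} (hφ : ∀ i, IsPoissonSolution V β γ i (φ i)) (i j : Fin 2) :
    T.s j * ∫ x, φ i x * x.2 (T.τ j) ∂(gibbs V β) =
      T.s i * ∫ x, φ (T.τ i) x * x.2 j ∂(gibbs V β) := by
  have hmp := T.measurePreserving_gibbs hV hβ
  have h1 : MemLp (fun x => φ i (T.phase x)) 2 (gibbs V β) :=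
    (hφ i).memLp.comp_measurePreserving hmp
  have h2 : MemLp (fun x => T.s i * φ (T.τ i) x) 2 (gibbs V β) := (hφ (T.τ i)).memLp.const_mul _
  have hv : ∀ j : Fin 2, MemLp (fun x : Phase => x.2 j) 2 (gibbs V β) := by
    intro j
    have h := memLp_two_gibbs hV hβ (f := fun _ => 1) continuous_const
      (Function.update (fun _ => 1) j Polynomial.X)
    refine h.ae_eq (Eventually.of_forall fun x => ?_)
    fin_cases j <;> simp
  -- Changing variables by the involution moves the symmetry onto the test function. The right-hand
  -- side `pᵢ` becomes `sᵢ p_{τ i}`, the source for `s i * φ (τ i)`, so the difference solves the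
  -- homogeneous equation.
  have hsol : ∀ ψ, IsTestFunction ψ → ∫ x, (φ i (T.phase x) - T.s i * φ (T.τ i) x) *
      genAdjoint V β γ ψ x ∂(gibbs V β) = 0 := by
    intro ψ hψ
    have hL := memLp_genAdjoint (γ := γ) hV hβ hψ
    have e1 : ∫ x, φ i (T.phase x) * genAdjoint V β γ ψ x ∂(gibbs V β) =
        -(T.s i * ∫ x, x.2 (T.τ i) * ψ x ∂(gibbs V β)) := by
      rw [← T.integral_comp_phase hV hβ]
      simp only [phase_phase, ← T.genAdjoint_comp hV β γ hψ.smooth]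
      rw [← neg_eq_iff_eq_neg, (hφ i).equation _ (T.isTestFunction_comp hψ),
        ← T.integral_comp_phase hV hβ, ← integral_const_mul]
      congr 1
      funext x
      simp only [phase_phase]
      rw [phase_apply, T.apply]
      ring
    have e2 : ∫ x, T.s i * φ (T.τ i) x * genAdjoint V β γ ψ x ∂(gibbs V β) =
        -(T.s i * ∫ x, x.2 (T.τ i) * ψ x ∂(gibbs V β)) := by
      rw [← (hφ (T.τ i)).equation ψ hψ, mul_neg, neg_neg, ← integral_const_mul]
      simp only [mul_assoc]
    simp only [sub_mul]
    have i1 : Integrable (fun x => φ i (T.phase x) * genAdjoint V β γ ψ x) (gibbs V β) :=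
      h1.integrable_mul hL
    have i2 : Integrable (fun x => T.s i * φ (T.τ i) x * genAdjoint V β γ ψ x) (gibbs V β) :=
      h2.integrable_mul hL
    rw [integral_sub i1 i2, e1, e2, sub_self]
  have h := integral_mul_velocity_eq_zero hV hβ hγ (h1.sub h2) hsol j
  simp only [Pi.sub_apply, sub_mul] at h
  have i1 : Integrable (fun x => φ i (T.phase x) * x.2 j) (gibbs V β) := h1.integrable_mul (hv j)
  have i2 : Integrable (fun x => T.s i * φ (T.τ i) x * x.2 j) (gibbs V β) :=
    h2.integrable_mul (hv j)
  rw [integral_sub i1 i2, sub_eq_zero] at h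
  simp only [mul_assoc, integral_const_mul] at h
  rw [← h, ← T.integral_comp_phase hV hβ, ← integral_const_mul]
  congr 1
  funext x
  have hr := congrArg (fun p : E2 => p j) (T.involutive_linear x.2)
  simp only [T.apply] at hr
  rw [phase_apply, T.apply, ← hr]
  ring

end TorusSymmetry

/-! ### The exchange and reflection symmetries, and the Poisson case -/

/-- The reflection `x ↦ 2π - x` carries `[0, 2π)` to `(0, 2π]`, so the cell is preserved only off
such hyperplanes. -/
theorem ae_coord_ne (i : Fin 2) (a : ℝ) : ∀ᵐ q : E2, q i ≠ a := by
  have h : ∀ᵐ f : Fin 2 → ℝ, f i ≠ a := by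
    have := Measure.pi_hyperplane (fun _ : Fin 2 => (volume : Measure ℝ)) i a
    simpa [ae_iff, volume_pi] using this
  exact (EuclideanSpace.volume_preserving_symm_measurableEquiv_toLp (Fin 2)).quasiMeasurePreserving.ae h

namespace TorusSymmetry

variable {V : E2 → ℝ}

/-- The symmetry that exchanges the coordinates. -/
def swap (hV : ∀ a b : ℝ, V !₂[a, b] = V !₂[b, a]) : TorusSymmetry V where
  R := LinearIsometryEquiv.piLpCongrLeft 2 ℝ ℝ (Equiv.swap 0 1)
  c := 0
  τ := Equiv.swap 0 1
  s := 1
  sign _ := Or.inl rfl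
  apply p j := by simp [LinearIsometryEquiv.piLpCongrLeft_apply]
  involutive_linear p := by
    ext j
    fin_cases j <;> simp [LinearIsometryEquiv.piLpCongrLeft_apply]
  involutive p := by
    ext j
    fin_cases j <;> simp [LinearIsometryEquiv.piLpCongrLeft_apply]
  lattice k := ⟨k ∘ Equiv.swap 0 1, by
    ext j
    fin_cases j <;> simp [LinearIsometryEquiv.piLpCongrLeft_apply, latticeVec]⟩
  cell := by
    refine Eventually.of_forall fun q => propext ?_
    change _ ∈ Langevin.cell ↔ _ ∈ Langevin.cell
    simp [Langevin.cell, Fin.forall_fin_two, LinearIsometryEquiv.piLpCongrLeft_apply]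
    tauto
  potential q := by
    have h := hV (q 1) (q 0)
    convert h using 2
    · ext j
      fin_cases j <;> simp [LinearIsometryEquiv.piLpCongrLeft_apply]
    · ext j
      fin_cases j <;> simp

/-- The linear reflection of the coordinate `i`. -/
def coordReflection (i : Fin 2) : E2 ≃ₗᵢ[ℝ] E2 :=
  LinearIsometryEquiv.piLpCongrRight 2 fun j =>
    if j = i then LinearIsometryEquiv.neg ℝ else LinearIsometryEquiv.refl ℝ ℝ

theorem coordReflection_apply (i : Fin 2) (p : E2) (j : Fin 2) :
    coordReflection i p j = (if j = i then -1 else 1) * p j := by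
  by_cases h : j = i <;> simp [coordReflection, h]

/-- The symmetry that reflects the coordinate `i`, shifted by a period so that it preserves the
fundamental cell. -/
def reflection (hp : IsPotential V) (i : Fin 2) (hV : ∀ q, V (coordReflection i q) = V q) :
    TorusSymmetry V where
  R := coordReflection i
  c := latticeVec (Pi.single i 1)
  τ := 1
  s j := if j = i then -1 else 1
  sign j := by by_cases h : j = i <;> simp [h]
  apply p j := coordReflection_apply i p j
  involutive_linear p := by
    ext j
    by_cases h : j = i <;> simp [coordReflection_apply, h]
  involutive p := by
    ext j
    by_cases h : j = i <;> simp [coordReflection_apply, h, latticeVec]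
  lattice k := ⟨fun j => if j = i then -k j else k j, by
    ext j
    by_cases h : j = i <;> simp [coordReflection_apply, h, latticeVec]⟩
  cell := by
    filter_upwards [ae_coord_ne i 0, ae_coord_ne i (2 * Real.pi)] with q h0 h1
    refine propext ?_
    change _ ∈ Langevin.cell ↔ _ ∈ Langevin.cell
    refine forall_congr' fun j => ?_
    by_cases h : j = i
    · subst h
      simp only [Set.mem_Ico, PiLp.add_apply, coordReflection_apply, latticeVec, if_true,
        Pi.single_eq_same, Int.cast_one]
      constructor
      · rintro ⟨h2, h3⟩
        exact ⟨by linarith, lt_of_le_of_ne (by linarith) h1⟩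
      · rintro ⟨h2, h3⟩
        have := lt_of_le_of_ne h2 (Ne.symm h0)
        exact ⟨by linarith, by linarith⟩
    · simp [coordReflection_apply, h, latticeVec]
  potential q := by rw [hp.periodic, hV]

end TorusSymmetry

/-- A potential that is even in one coordinate has a reflection symmetry. -/
theorem exists_reflection {V : E2 → ℝ} (hV : (∀ a b : ℝ, V !₂[a, b] = V !₂[a, -b]) ∨
    (∀ a b : ℝ, V !₂[a, b] = V !₂[-a, b])) : ∃ i, ∀ q, V (TorusSymmetry.coordReflection i q) = V q := by
  have hq : ∀ q : E2, q = !₂[q 0, q 1] := fun q => by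
    ext j
    fin_cases j <;> rfl
  rcases hV with h | h
  · refine ⟨1, fun q => ?_⟩
    conv_rhs => rw [hq q, h]
    rw [hq (TorusSymmetry.coordReflection 1 q)]
    simp [TorusSymmetry.coordReflection_apply]
  · refine ⟨0, fun q => ?_⟩
    conv_rhs => rw [hq q, h]
    rw [hq (TorusSymmetry.coordReflection 0 q)]
    simp [TorusSymmetry.coordReflection_apply]

theorem poisson_diag_eq {V : E2 → ℝ} (hV : IsPotential V) {β γ : ℝ} (hβ : 0 < β) (hγ : 0 < γ)
    {D : Matrix (Fin 2) (Fin 2) ℝ} (hD : IsPoissonDiffusion V β γ D)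
    (hs : ∀ a b : ℝ, V !₂[a, b] = V !₂[b, a]) : D 0 0 = D 1 1 := by
  obtain ⟨φ, hφ, h⟩ := hD
  have e := (TorusSymmetry.swap hs).poisson_equivariant hV hβ hγ hφ 0 1
  rw [h, h]
  simpa [TorusSymmetry.swap] using e

theorem poisson_offDiag_eq_zero {V : E2 → ℝ} (hV : IsPotential V) {β γ : ℝ} (hβ : 0 < β)
    (hγ : 0 < γ) {D : Matrix (Fin 2) (Fin 2) ℝ} (hD : IsPoissonDiffusion V β γ D) {i : Fin 2}
    (hs : ∀ q, V (TorusSymmetry.coordReflection i q) = V q) : D 0 1 = 0 ∧ D 1 0 = 0 := by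
  obtain ⟨φ, hφ, h⟩ := hD
  have e1 := (TorusSymmetry.reflection hV i hs).poisson_equivariant hV hβ hγ hφ 0 1
  have e2 := (TorusSymmetry.reflection hV i hs).poisson_equivariant hV hβ hγ hφ 1 0
  rw [h, h]
  fin_cases i
  all_goals
    simp [TorusSymmetry.reflection] at e1 e2
    constructor <;> linarith

/-! ### Pathwise uniqueness and invariance of the stationary law -/

/-- Two solutions of an integral equation with the same continuous forcing coincide. -/
theorem eq_of_forcing_eq {E : Type*} [NormedAddCommGroup E] [NormedSpace ℝ E] [CompleteSpace E]
    {L : E → E} (hL : LocallyLipschitz L) {x y : ℝ → E} (hx : Continuous x) (hy : Continuous y)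
    (h : ∀ t, 0 ≤ t → x t - ∫ s in (0 : ℝ)..t, L (x s) = y t - ∫ s in (0 : ℝ)..t, L (y s))
    {t : ℝ} (ht : 0 ≤ t) : x t = y t := by
  set K : Set E := x '' Set.Icc 0 t ∪ y '' Set.Icc 0 t
  have hK : IsCompact K := (isCompact_Icc.image hx).union (isCompact_Icc.image hy)
  obtain ⟨C, hC⟩ := (hL.locallyLipschitzOn (s := K)).exists_lipschitzOnWith_of_compact hK
  -- With `ρ` the common forcing, both integrated drifts solve `f' = L (f + ρ)` from `0`. A
  -- Lipschitz constant is needed only on the compact set swept by the two paths, so local Lipschitz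
  -- continuity suffices.
  set ρ : ℝ → E := fun t => x t - ∫ s in (0 : ℝ)..t, L (x s) with hρ
  have hLx : Continuous fun s => L (x s) := hL.continuous.comp hx
  have hLy : Continuous fun s => L (y s) := hL.continuous.comp hy
  have key := ODE_solution_unique_of_mem_Icc_right (a := 0) (b := t) (K := C)
    (v := fun t z => L (z + ρ t)) (s := fun t => {z | z + ρ t ∈ K})
    (f := fun t => ∫ s in (0 : ℝ)..t, L (x s)) (g := fun t => ∫ s in (0 : ℝ)..t, L (y s))
    (fun r _ => by
      refine LipschitzOnWith.of_dist_le_mul fun a ha b hb => ?_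
      simpa using hC.dist_le_mul _ ha _ hb)
    (fun r _ => (hLx.integral_hasStrictDerivAt 0 r).hasDerivAt.continuousAt.continuousWithinAt)
    (fun r _ => by
      simpa [hρ] using (hLx.integral_hasStrictDerivAt 0 r).hasDerivAt.hasDerivWithinAt)
    (fun r hr => by
      simp only [hρ, Set.mem_ofPred_eq, add_sub_cancel]
      exact Or.inl ⟨r, ⟨hr.1, hr.2.le⟩, rfl⟩)
    (fun r hr => (hLy.integral_hasStrictDerivAt 0 r).hasDerivAt.continuousAt.continuousWithinAt)
    (fun r hr => by
      simpa [hρ, h r hr.1] using (hLy.integral_hasStrictDerivAt 0 r).hasDerivAt.hasDerivWithinAt)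
    (fun r hr => by
      simp only [hρ, h r hr.1, Set.mem_ofPred_eq, add_sub_cancel]
      exact Or.inr ⟨r, ⟨hr.1, hr.2.le⟩, rfl⟩)
    (by simp) (Set.right_mem_Icc.2 ht)
  have h1 := h t ht
  simp only at key
  rw [key] at h1
  exact sub_left_injective h1

/-- The drift of the Langevin dynamics. -/
def drift (V : E2 → ℝ) (γ : ℝ) (x : Phase) : Phase := (x.2, -gradient V x.1 - γ • x.2)

theorem contDiff_gradient {V : E2 → ℝ} (hV : IsPotential V) : ContDiff ℝ 1 (gradient V) :=
  (InnerProductSpace.toDual ℝ E2).symm.toContinuousLinearEquiv.contDiff.comp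
    (hV.smooth.fderiv_right (m := 1) (WithTop.coe_le_coe.2 (le_top : (2 : ℕ∞) ≤ ⊤)))

theorem locallyLipschitz_drift {V : E2 → ℝ} (hV : IsPotential V) (γ : ℝ) :
    LocallyLipschitz (drift V γ) := by
  have h := contDiff_gradient hV
  exact ContDiff.locallyLipschitz (𝕂 := ℝ) (contDiff_snd.prodMk
    (((h.comp contDiff_fst).neg).sub (contDiff_snd.const_smul γ)))

/-- The random forcing that produces a given path in phase space, read off along a dense sequence
of times. -/
def forcing (V : E2 → ℝ) (γ : ℝ) (x : C(ℝ≥0, E2) × C(ℝ≥0, E2)) (n : ℕ) : Phase :=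
  (x.1 (TopologicalSpace.denseSeq ℝ≥0 n), x.2 (TopologicalSpace.denseSeq ℝ≥0 n)) -
    ∫ s in (0 : ℝ)..TopologicalSpace.denseSeq ℝ≥0 n, drift V γ (x.1 s.toNNReal, x.2 s.toNNReal)

theorem continuous_forcing {V : E2 → ℝ} (hV : IsPotential V) (γ : ℝ) :
    Continuous (forcing V γ) := by
  refine continuous_pi fun n => ?_
  refine Continuous.sub (by fun_prop) ?_
  refine intervalIntegral.continuous_parametric_intervalIntegral_of_continuous' ?_ _ _
  refine (locallyLipschitz_drift hV γ).continuous.comp ?_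
  fun_prop

/-- Forcings that agree at a dense set of times agree at all times by continuity, and then pathwise
uniqueness applies. -/
theorem injective_forcing {V : E2 → ℝ} (hV : IsPotential V) (γ : ℝ) :
    Function.Injective (forcing V γ) := by
  intro x y hxy
  have hL := locallyLipschitz_drift hV γ
  have hc : ∀ x : C(ℝ≥0, E2) × C(ℝ≥0, E2),
      Continuous fun s : ℝ => (x.1 s.toNNReal, x.2 s.toNNReal) := fun x => by fun_prop
  have hf : ∀ x : C(ℝ≥0, E2) × C(ℝ≥0, E2), Continuous fun t : ℝ≥0 =>
      (x.1 t, x.2 t) - ∫ s in (0 : ℝ)..t, drift V γ (x.1 s.toNNReal, x.2 s.toNNReal) := fun x => by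
    have h1 : Continuous fun t : ℝ => ∫ s in (0 : ℝ)..t, drift V γ (x.1 s.toNNReal, x.2 s.toNNReal) :=
      intervalIntegral.continuous_primitive
        (fun a b => (hL.continuous.comp (hc x)).intervalIntegrable a b) 0
    have h2 := h1.comp NNReal.continuous_coe
    have h3 : Continuous fun t : ℝ≥0 => (x.1 t, x.2 t) := by fun_prop
    exact h3.sub h2
  have heq := (TopologicalSpace.denseRange_denseSeq ℝ≥0).equalizer (hf x) (hf y) hxy
  have key : ∀ t : ℝ≥0, (x.1 t, x.2 t) = (y.1 t, y.2 t) := fun t => by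
    have h := eq_of_forcing_eq hL (hc x) (hc y) (fun r hr => by
      have h := congrFun heq r.toNNReal
      simpa only [Real.coe_toNNReal r hr] using h) t.2
    simpa using h
  exact Prod.ext (ContinuousMap.ext fun t => congrArg Prod.fst (key t))
    (ContinuousMap.ext fun t => congrArg Prod.snd (key t))

/-- By Lusin-Souslin, an injective continuous map out of the Polish path space is a Borel embedding.
Keeping countably many times makes the target a countable product. Laws on path space can therefore
be compared through their forcings. -/
theorem measurableEmbedding_forcing {V : E2 → ℝ} (hV : IsPotential V) (γ : ℝ) :
    MeasurableEmbedding (forcing V γ) :=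
  (continuous_forcing hV γ).measurableEmbedding (injective_forcing hV γ)

/-- The law of a pre-Brownian motion does not depend on the motion. -/
theorem map_eq_of_isPreBrownianReal {Ω : Type*} [MeasurableSpace Ω] {P : Measure Ω}
    [IsProbabilityMeasure P] {X Y : ℝ≥0 → Ω → ℝ} (hX : IsPreBrownianReal X P)
    (hY : IsPreBrownianReal Y P) (mX : ∀ t, Measurable (X t)) (mY : ∀ t, Measurable (Y t)) :
    P.map (fun ω t => X t ω) = P.map (fun ω t => Y t ω) := by
  rw [map_eq_iff_forall_finset_map_restrict_eq (measurable_pi_lambda _ mX).aemeasurable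
    (measurable_pi_lambda _ mY).aemeasurable]
  exact fun I => (hX.hasLaw I).map_eq.trans (hY.hasLaw I).map_eq.symm

namespace TorusSymmetry

variable {V : E2 → ℝ} (T : TorusSymmetry V)

/-- The law of planar Brownian motion is invariant under signed permutations of the coordinates. -/
theorem map_brownian {Ω : Type*} [MeasurableSpace Ω] {P : Measure Ω} [IsProbabilityMeasure P]
    {w : Fin 2 → ℝ≥0 → Ω → ℝ} (hw : IsBrownian2 P w) :
    P.map (fun ω j t => T.s j * w (T.τ j) t ω) = P.map (fun ω j t => w j t ω) := by
  have hm : ∀ j, Measurable fun ω t => w j t ω := fun j => measurable_pi_lambda _ (hw.measurable j)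
  have hs : ∀ j, Measurable fun (f : ℝ≥0 → ℝ) t => T.s j * f t := fun j => by fun_prop
  have hi : iIndepFun (fun j ω t => T.s j * w (T.τ j) t ω) P :=
    (hw.indep.precomp T.τ.injective).comp (fun j (f : ℝ≥0 → ℝ) t => T.s j * f t) hs
  have hm' : ∀ j, Measurable fun ω t => T.s j * w (T.τ j) t ω := fun j => (hs j).comp (hm (T.τ j))
  rw [(iIndepFun_iff_map_fun_eq_pi_map fun j => (hm' j).aemeasurable).1 hi,
    (iIndepFun_iff_map_fun_eq_pi_map fun j => (hm j).aemeasurable).1 hw.indep]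
  congr 1
  funext j
  have h0 := (hw.brownian (T.τ j)).toIsPreBrownianReal
  have h1 : IsPreBrownianReal (fun t ω => T.s j * w (T.τ j) t ω) P := by
    rcases T.sign j with h | h
    · simpa [h] using h0
    · simpa [h, Pi.neg_def] using h0.neg
  exact map_eq_of_isPreBrownianReal h1 (hw.brownian j).toIsPreBrownianReal
    (fun t => (hw.measurable _ t).const_mul _) (hw.measurable j)

end TorusSymmetry

/-- The forcing of a solution of the Langevin equation with a given initial point and a given
Brownian path. -/
def noise (β γ : ℝ) (z : Phase × (Fin 2 → ℝ≥0 → ℝ)) (n : ℕ) : Phase :=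
  z.1 + (0, √(2 * γ / β) • WithLp.toLp 2 fun i => z.2 i (TopologicalSpace.denseSeq ℝ≥0 n))

theorem measurable_noise (β γ : ℝ) : Measurable (noise β γ) := by
  unfold noise
  fun_prop

/-- Rearranges the Langevin equation so that the forcing is a measurable function of the initial
point and the Brownian path alone. -/
theorem forcing_eq_noise {V : E2 → ℝ} (hV : IsPotential V) {β γ : ℝ} {w : Fin 2 → ℝ≥0 → ℝ}
    {q p : C(ℝ≥0, E2)}
    (hq : ∀ t : ℝ≥0, q t = q 0 + ∫ s in (0 : ℝ)..t, p s.toNNReal)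
    (hp : ∀ t : ℝ≥0, p t = p 0 - (∫ s in (0 : ℝ)..t, gradient V (q s.toNNReal))
      - γ • (∫ s in (0 : ℝ)..t, p s.toNNReal) + √(2 * γ / β) • WithLp.toLp 2 fun i => w i t) :
    forcing V γ (q, p) = noise β γ ((q 0, p 0), w) := by
  funext n
  set t := TopologicalSpace.denseSeq ℝ≥0 n with ht
  have hcp : Continuous fun s : ℝ => p s.toNNReal := by fun_prop
  have hcg : Continuous fun s : ℝ => gradient V (q s.toNNReal) :=
    (continuous_gradient hV).comp (by fun_prop)
  have hcd : Continuous fun s : ℝ => -gradient V (q s.toNNReal) - γ • p s.toNNReal := by fun_prop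
  have e : ∫ s in (0 : ℝ)..t, drift V γ (q s.toNNReal, p s.toNNReal) =
      (∫ s in (0 : ℝ)..t, p s.toNNReal, -(∫ s in (0 : ℝ)..t, gradient V (q s.toNNReal))
        - γ • ∫ s in (0 : ℝ)..t, p s.toNNReal) := by
    have hd : Continuous fun s : ℝ => drift V γ (q s.toNNReal, p s.toNNReal) := hcp.prodMk hcd
    have h1 := (ContinuousLinearMap.fst ℝ E2 E2).intervalIntegral_comp_comm
      (hd.intervalIntegrable (μ := volume) 0 t)
    have h2 := (ContinuousLinearMap.snd ℝ E2 E2).intervalIntegral_comp_comm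
      (hd.intervalIntegrable (μ := volume) 0 t)
    refine Prod.ext h1.symm (h2.symm.trans ?_)
    change ∫ s in (0 : ℝ)..t, (-gradient V (q s.toNNReal) - γ • p s.toNNReal) = _
    have hcn : Continuous fun s : ℝ => -gradient V (q s.toNNReal) := hcg.neg
    have hcs : Continuous fun s : ℝ => γ • p s.toNNReal := hcp.const_smul γ
    rw [intervalIntegral.integral_sub (hcn.intervalIntegrable _ _)
      (hcs.intervalIntegrable _ _), intervalIntegral.integral_neg,
      intervalIntegral.integral_smul]
  simp only [forcing, noise, ← ht, e]
  rw [hq t, hp t]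
  ext1
  · simp
  · simp only [Prod.snd_sub, Prod.snd_add]
    abel

namespace TorusSymmetry

variable {V : E2 → ℝ} (T : TorusSymmetry V)

/-- The action of a symmetry on paths in phase space. -/
def path (x : C(ℝ≥0, E2) × C(ℝ≥0, E2)) : C(ℝ≥0, E2) × C(ℝ≥0, E2) :=
  (⟨fun t => T.R (x.1 t) + T.c, by have := T.R.continuous; fun_prop⟩,
    ⟨fun t => T.R (x.2 t), by have := T.R.continuous; fun_prop⟩)

theorem continuous_path : Continuous T.path := by
  have h := T.R.continuous
  refine Continuous.prodMk ?_ ?_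
  · exact (ContinuousMap.continuous_postcomp ⟨fun q => T.R q + T.c, by fun_prop⟩).comp
      continuous_fst
  · exact (ContinuousMap.continuous_postcomp ⟨fun p => T.R p, h⟩).comp continuous_snd

/-- A symmetry maps solutions of the Langevin equation to solutions with transformed noise. -/
theorem forcing_path (hV : IsPotential V) {β γ : ℝ} {w : Fin 2 → ℝ≥0 → ℝ}
    {q p : C(ℝ≥0, E2)}
    (hq : ∀ t : ℝ≥0, q t = q 0 + ∫ s in (0 : ℝ)..t, p s.toNNReal)
    (hp : ∀ t : ℝ≥0, p t = p 0 - (∫ s in (0 : ℝ)..t, gradient V (q s.toNNReal))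
      - γ • (∫ s in (0 : ℝ)..t, p s.toNNReal) + √(2 * γ / β) • WithLp.toLp 2 fun i => w i t) :
    forcing V γ (T.path (q, p)) =
      noise β γ (T.phase (q 0, p 0), fun j t => T.s j * w (T.τ j) t) := by
  have hR : ∀ f : ℝ → E2, ∀ t : ℝ, ∫ s in (0 : ℝ)..t, T.R (f s) = T.R (∫ s in (0 : ℝ)..t, f s) :=
    fun f t => by
      simp only [intervalIntegral, map_sub]
      congr 1 <;> exact T.R.toContinuousLinearEquiv.integral_comp_comm f
  have hw : ∀ t, (WithLp.toLp 2 fun j => T.s j * w (T.τ j) t : E2) =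
      T.R (WithLp.toLp 2 fun j => w j t) := fun t => by
    ext j
    rw [T.apply]
  refine forcing_eq_noise hV (q := (T.path (q, p)).1) (p := (T.path (q, p)).2) ?_ ?_
  · intro t
    change T.R (q t) + T.c = T.R (q 0) + T.c + ∫ s in (0 : ℝ)..t, T.R (p s.toNNReal)
    rw [hR, hq t, map_add]
    abel
  · intro t
    change T.R (p t) = T.R (p 0) - (∫ s in (0 : ℝ)..t, gradient V (T.R (q s.toNNReal) + T.c))
      - γ • (∫ s in (0 : ℝ)..t, T.R (p s.toNNReal)) + _
    simp only [T.gradient_apply_symm hV, hR, hw]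
    rw [hp t]
    simp only [map_add, map_sub, map_smul]

/-- The law of a stationary solution is invariant under the symmetries of the potential. -/
theorem map_path (hV : IsPotential V) {β γ : ℝ} (hβ : 0 < β) {Ω : Type*} [MeasurableSpace Ω]
    {P : Measure Ω} [IsProbabilityMeasure P] {w : Fin 2 → ℝ≥0 → Ω → ℝ} {q p : Ω → C(ℝ≥0, E2)}
    (h : IsStationarySolution P V β γ w q p) :
    P.map (fun ω => T.path (q ω, p ω)) = P.map fun ω => (q ω, p ω) := by
  have hemb := measurableEmbedding_forcing hV γ
  have hqp : Measurable fun ω => (q ω, p ω) := h.measurable_q.prodMk h.measurable_p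
  have hpath : Measurable fun ω => T.path (q ω, p ω) := T.continuous_path.measurable.comp hqp
  have hx : Measurable fun ω => (q ω 0, p ω 0) := by
    have h0 : Continuous fun x : C(ℝ≥0, E2) × C(ℝ≥0, E2) => (x.1 0, x.2 0) := by fun_prop
    exact h0.measurable.comp hqp
  have hw : Measurable fun ω i t => w i t ω :=
    measurable_pi_lambda _ fun i => measurable_pi_lambda _ (h.brownian.measurable i)
  have hs : Measurable fun (f : Fin 2 → ℝ≥0 → ℝ) j t => T.s j * f (T.τ j) t := by fun_prop
  -- The data have a product law. The Gibbs factor is invariant because the symmetry preserves the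
  -- cell, where the representative of `q₀` is chosen, and the Brownian factor because `R` is a
  -- signed permutation.
  have hlaw : P.map (fun ω => (T.phase (q ω 0, p ω 0), fun j t => T.s j * w (T.τ j) t ω)) =
      P.map (fun ω => ((q ω 0, p ω 0), fun j t => w j t ω)) := by
    have hi := h.initial_indep.comp T.phase.measurable hs
    have e1 := (indepFun_iff_map_prod_eq_prod_map_map (T.phase.measurable.comp hx).aemeasurable
      (hs.comp hw).aemeasurable).1 hi
    have e2 := (indepFun_iff_map_prod_eq_prod_map_map hx.aemeasurable hw.aemeasurable).1
      h.initial_indep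
    have e3 : P.map (T.phase ∘ fun ω => (q ω 0, p ω 0)) = P.map fun ω => (q ω 0, p ω 0) := by
      rw [← Measure.map_map T.phase.measurable hx, h.initial_law.map_eq,
        (T.measurePreserving_gibbs hV hβ).map_eq]
    have e4 : P.map ((fun (f : Fin 2 → ℝ≥0 → ℝ) j t => T.s j * f (T.τ j) t) ∘
        fun ω i t => w i t ω) = P.map fun ω j t => w j t ω := T.map_brownian h.brownian
    rw [e3, e4, ← e2] at e1
    exact e1
  have e : (P.map (fun ω => T.path (q ω, p ω))).map (forcing V γ) =
      (P.map fun ω => (q ω, p ω)).map (forcing V γ) := by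
    rw [Measure.map_map hemb.measurable hpath, Measure.map_map hemb.measurable hqp]
    have a1 : forcing V γ ∘ (fun ω => T.path (q ω, p ω)) =ᵐ[P] noise β γ ∘
        fun ω => (T.phase (q ω 0, p ω 0), fun j t => T.s j * w (T.τ j) t ω) := by
      filter_upwards [h.position, h.velocity] with ω h1 h2 using T.forcing_path hV h1 h2
    have a2 : forcing V γ ∘ (fun ω => (q ω, p ω)) =ᵐ[P] noise β γ ∘
        fun ω => ((q ω 0, p ω 0), fun j t => w j t ω) := by
      filter_upwards [h.position, h.velocity] with ω h1 h2 using forcing_eq_noise hV h1 h2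
    have hxw : Measurable fun ω => (T.phase (q ω 0, p ω 0), fun j t => T.s j * w (T.τ j) t ω) :=
      (T.phase.measurable.comp hx).prodMk (hs.comp hw)
    rw [Measure.map_congr a1, Measure.map_congr a2,
      ← Measure.map_map (measurable_noise β γ) hxw,
      ← Measure.map_map (measurable_noise β γ) (hx.prodMk hw)]
    exact congrArg _ hlaw
  -- A measurable embedding allows the law of the path to be recovered from the law of its forcing.
  rw [← hemb.comap_map (P.map fun ω => T.path (q ω, p ω)), e, hemb.comap_map]

end TorusSymmetry

/-! ### Invariance of the diffusive limit and of its covariance -/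

theorem continuous_rescale (ε : ℝ≥0) : Continuous (rescale ε) := by
  refine ContinuousMap.continuous_of_continuous_uncurry _ ?_
  change Continuous fun x : C(ℝ≥0, E2) × ℝ≥0 => (ε : ℝ) • x.1 (x.2 / ε ^ 2)
  fun_prop

/-- The covariance of a linear image of planar Brownian motion at time one. -/
theorem integral_brownian_mul {Ω : Type*} [MeasurableSpace Ω] {P : Measure Ω}
    [IsProbabilityMeasure P] {W : Fin 2 → ℝ≥0 → Ω → ℝ} (hW : IsBrownian2 P W)
    (S : Matrix (Fin 2) (Fin 2) ℝ) (i k : Fin 2) :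
    ∫ ω, (S *ᵥ fun j => W j 1 ω) i * (S *ᵥ fun j => W j 1 ω) k ∂P = (S * Sᵀ) i k := by
  have hb : ∀ j, IsPreBrownianReal (W j) P := fun j => (hW.brownian j).toIsPreBrownianReal
  have hL : ∀ j, MemLp (W j 1) 2 P := fun j =>
    ((hb j).hasLaw_eval 1).hasGaussianLaw.memLp_two
  have hint : ∀ j l, Integrable (fun ω => W j 1 ω * W l 1 ω) P := fun j l =>
    (hL j).integrable_mul (hL l)
  have hcov : ∀ j l, ∫ ω, W j 1 ω * W l 1 ω ∂P = if j = l then 1 else 0 := by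
    intro j l
    have h0 := covariance_eq_sub (hL j) (hL l)
    simp only [(hb _).integral_eval, mul_zero, sub_zero] at h0
    change ∫ ω, (W j 1 * W l 1) ω ∂P = _
    rw [← h0]
    by_cases h : j = l
    · subst h
      simp [(hb j).covariance_eval]
    · rw [if_neg h]
      have hi : IndepFun (W j 1) (W l 1) P :=
        (hW.indep.indepFun h).comp (measurable_pi_apply (1 : ℝ≥0)) (measurable_pi_apply (1 : ℝ≥0))
      exact hi.covariance_eq_zero (hL j) (hL l)
  simp only [Matrix.mulVec, dotProduct, Finset.sum_mul_sum]
  have hI : ∀ j l, Integrable (fun ω => S i j * W j 1 ω * (S k l * W l 1 ω)) P := fun j l => by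
    refine ((hint j l).const_mul (S i j * S k l)).congr (Eventually.of_forall fun ω => ?_)
    simp only
    ring
  rw [integral_finsetSum _ fun j _ => integrable_finsetSum _ fun l _ => hI j l]
  simp only [Matrix.mul_apply, Matrix.transpose_apply]
  refine Finset.sum_congr rfl fun j _ => ?_
  rw [integral_finsetSum _ fun l _ => hI j l]
  have e : ∀ l, ∫ ω, S i j * W j 1 ω * (S k l * W l 1 ω) ∂P =
      S i j * S k l * if j = l then 1 else 0 := fun l => by
    rw [← hcov j l, ← integral_const_mul]
    congr 1
    funext ω
    ring
  simp [e]

namespace TorusSymmetry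

variable {V : E2 → ℝ} (T : TorusSymmetry V)

/-- The law of a diffusive limit is invariant under the linear part of a symmetry. -/
theorem map_limit (hV : IsPotential V) {β γ : ℝ} (hβ : 0 < β) {Ω : Type*} [MeasurableSpace Ω]
    {P : Measure Ω} [IsProbabilityMeasure P] {w : Fin 2 → ℝ≥0 → Ω → ℝ} {q p : Ω → C(ℝ≥0, E2)}
    (h : IsStationarySolution P V β γ w q p) {Ω' : Type*} [MeasurableSpace Ω'] {P' : Measure Ω'}
    [IsProbabilityMeasure P'] {Z : Ω' → C(ℝ≥0, E2)}
    (hZ : TendstoInDistribution (fun (ε : ℝ≥0) ω => rescale ε (q ω)) (𝓝[>] 0) Z (fun _ => P) P') :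
    P'.map (fun ω => T.R (Z ω 1)) = P'.map fun ω => Z ω 1 := by
  have hR := T.R.continuous
  have h1 := hZ.continuous_comp (g := fun x : C(ℝ≥0, E2) => x 1) (by fun_prop)
  have h2 := hZ.continuous_comp (g := fun x : C(ℝ≥0, E2) => T.R (x 1)) (by fun_prop)
  have hc : Tendsto (fun ε : ℝ≥0 => (ε : ℝ) • T.c) (𝓝[>] 0) (𝓝 0) := by
    have : Continuous fun ε : ℝ≥0 => (ε : ℝ) • T.c := by fun_prop
    exact (this.tendsto' 0 0 (by simp)).mono_left nhdsWithin_le_nhds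
  -- Slutsky's lemma: the deterministic shift `ε c`, which is what rescaling leaves of the
  -- translation, tends to zero and does not affect the limit.
  have h3 := h2.add_of_tendstoInMeasure_const (Y := fun (ε : ℝ≥0) (_ : Ω) => (ε : ℝ) • T.c)
    (c := 0) (by
      rw [tendstoInMeasure_iff_norm]
      intro r hr
      refine tendsto_const_nhds.congr' ?_
      filter_upwards [hc.norm.eventually_lt_const (by simpa using hr)] with ε hε
      simp [not_le.2 hε]) (fun ε => aemeasurable_const)
  have hqp : Measurable fun ω => (q ω, p ω) := h.measurable_q.prodMk h.measurable_p
  have h4 : TendstoInDistribution (fun (ε : ℝ≥0) ω => rescale ε (q ω) 1) (𝓝[>] 0)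
      (fun ω => T.R (Z ω 1) + 0) (fun _ => P) P' := by
    refine ⟨h1.forall_aemeasurable, h3.aemeasurable_limit, ?_⟩
    -- For each fixed `ε` the transformed and the original rescaled positions at time one have the
    -- same law, so both limits belong to the same family of laws.
    refine h3.tendsto.congr fun ε => Subtype.ext ?_
    have hg : Measurable fun x : C(ℝ≥0, E2) × C(ℝ≥0, E2) => rescale ε x.1 1 := by
      have := continuous_rescale ε
      exact Continuous.measurable (by fun_prop)
    have e := congrArg (fun m => Measure.map (fun x : C(ℝ≥0, E2) × C(ℝ≥0, E2) => rescale ε x.1 1) m)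
      (T.map_path hV hβ h)
    have hpath : Measurable fun ω => T.path (q ω, p ω) := T.continuous_path.measurable.comp hqp
    simp only [Measure.map_map hg hpath, Measure.map_map hg hqp] at e
    refine Eq.trans (congrArg (fun f => P.map f) (funext fun ω => ?_)) e
    change T.R ((ε : ℝ) • q ω (1 / ε ^ 2)) + (ε : ℝ) • T.c =
      (ε : ℝ) • (T.R (q ω (1 / ε ^ 2)) + T.c)
    rw [map_smul, smul_add]
  have h5 := tendstoInDistribution_unique _ h4 h1
  simpa [Function.comp_def] using h5

/-- The effective diffusion matrix is invariant under a symmetry. -/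
theorem effectiveDiffusion_invariant (hV : IsPotential V) {β γ : ℝ} (hβ : 0 < β)
    {D : Matrix (Fin 2) (Fin 2) ℝ} (hD : IsEffectiveDiffusion.{u, v} V β γ D) (i k : Fin 2) :
    D i k = T.s i * T.s k * D (T.τ i) (T.τ k) := by
  obtain ⟨Ω, _, P, _, w, q, p, Ω', _, P', _, W, Z, S, hsol, hW, hS, hSD, hZ, hlim⟩ := hD
  have hlaw := T.map_limit hV hβ hsol hlim
  have hST : Sᵀ = S := hS.isHermitian
  have hm : AEMeasurable (fun ω => Z ω 1) P' := by
    have h0 : Continuous fun x : C(ℝ≥0, E2) => x 1 := by fun_prop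
    exact h0.measurable.comp_aemeasurable hlim.aemeasurable_limit
  -- A positive semidefinite root is symmetric, so the covariance `S Sᵀ` of the limit at time one is
  -- `S * S = 2 D`.
  have hcov : ∀ i k, ∫ ω, Z ω 1 i * Z ω 1 k ∂P' = 2 * D i k := by
    intro i k
    have h0 := integral_brownian_mul hW S i k
    rw [hST, hSD, Matrix.smul_apply, smul_eq_mul] at h0
    rw [← h0]
    refine integral_congr_ae ?_
    filter_upwards [hZ] with ω hω
    rw [hω]
  have hR : AEMeasurable (fun ω => T.R (Z ω 1)) P' := T.R.continuous.measurable.comp_aemeasurable hm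
  have hf : Continuous fun z : E2 => z i * z k := by fun_prop
  have e : ∫ z, z i * z k ∂(P'.map fun ω => T.R (Z ω 1)) =
      ∫ z, z i * z k ∂(P'.map fun ω => Z ω 1) := by rw [hlaw]
  rw [integral_map hR hf.aestronglyMeasurable, integral_map hm hf.aestronglyMeasurable, hcov] at e
  have e2 : ∫ ω, T.R (Z ω 1) i * T.R (Z ω 1) k ∂P' =
      T.s i * T.s k * ∫ ω, Z ω 1 (T.τ i) * Z ω 1 (T.τ k) ∂P' := by
    rw [← integral_const_mul]
    congr 1
    funext ω
    rw [T.apply, T.apply]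
    ring
  rw [e2, hcov] at e
  linarith

end TorusSymmetry

theorem effective_diag_eq {V : E2 → ℝ} (hV : IsPotential V) {β γ : ℝ} (hβ : 0 < β)
    {D : Matrix (Fin 2) (Fin 2) ℝ} (hD : IsEffectiveDiffusion.{u, v} V β γ D)
    (hs : ∀ a b : ℝ, V !₂[a, b] = V !₂[b, a]) : D 0 0 = D 1 1 := by
  simpa [TorusSymmetry.swap] using
    (TorusSymmetry.swap hs).effectiveDiffusion_invariant hV hβ hD 0 0

theorem effective_offDiag_eq_zero {V : E2 → ℝ} (hV : IsPotential V) {β γ : ℝ} (hβ : 0 < β)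
    {D : Matrix (Fin 2) (Fin 2) ℝ} (hD : IsEffectiveDiffusion.{u, v} V β γ D) {i : Fin 2}
    (hs : ∀ q, V (TorusSymmetry.coordReflection i q) = V q) : D 0 1 = 0 ∧ D 1 0 = 0 := by
  have e1 := (TorusSymmetry.reflection hV i hs).effectiveDiffusion_invariant hV hβ hD 0 1
  have e2 := (TorusSymmetry.reflection hV i hs).effectiveDiffusion_invariant hV hβ hD 1 0
  fin_cases i
  all_goals
    simp [TorusSymmetry.reflection] at e1 e2
    constructor <;> linarith

end Langevin
end

theorem mainTheorem9 (V : Langevin.E2 → ℝ) (hV : Langevin.IsPotential V)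
    (β γ : ℝ) (hβ : 0 < β) (hγ : 0 < γ) (D : Matrix (Fin 2) (Fin 2) ℝ)
    (hD : Langevin.IsEffectiveDiffusion.{u, v} V β γ D ∨ Langevin.IsPoissonDiffusion V β γ D) :
    ((∀ a b : ℝ, V !₂[a, b] = V !₂[b, a]) → D 0 0 = D 1 1) ∧
    (((∀ a b : ℝ, V !₂[a, b] = V !₂[a, -b]) ∨ (∀ a b : ℝ, V !₂[a, b] = V !₂[-a, b])) →
      D 0 1 = 0 ∧ D 1 0 = 0) := by
  rcases hD with hD | hD
  · refine ⟨Langevin.effective_diag_eq hV hβ hD, fun h => ?_⟩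
    obtain ⟨i, hi⟩ := Langevin.exists_reflection h
    exact Langevin.effective_offDiag_eq_zero hV hβ hD hi
  · refine ⟨Langevin.poisson_diag_eq hV hβ hγ hD, fun h => ?_⟩
    obtain ⟨i, hi⟩ := Langevin.exists_reflection h
    exact Langevin.poisson_offDiag_eq_zero hV hβ hγ hD hi
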